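/- Let $\mathcal C$ be a monoidal category with unit $\mathcal O$, let $\mathcal D$ be a monoidal category with unit $\mathbf 1$ that is preadditive with biadditive tensor product (for example, $\mathcal C$ and $\mathcal D$ abelian monoidal categories), and let $F:\mathcal C\to\mathcal D$ be a (lax) monoidal functor with structure morphisms $\eta:\mathbf 1\to F\mathcal O$ and $\mu^{X_1,X_2}:FX_1\otimes FX_2\to F(X_1\otimes X_2)$. Canonical coherence isomorphisms are suppressed. *Cochains.* Let $C^k(F)$ be the abelian group of natural transformations $c^{X_1,\dots,X_k}:FX_1\otimes\cdots\otimes FX_k\to F(X_1\otimes\cdots\otimes X_k)$ of multifunctors, with $C^0(F)=\mathrm{Hom}(\mathbf 1,F\mathcal O)$. For a monoid $(A,\eta_A,m)$ in $\mathcal D$ let $C^k(A)=\mathrm{Hom}(A^{\otimes k},A)$, with $C^0(A)=\mathrm{Hom}(\mathbf 1,A)$. In both cases cochains can be substituted into cochains; put $m=\mu\in C^2(F)$ in the first case. Define, in element-wise notation, for $c\in C^k$, $k\ge 0$, $x\in C^i$, $y\in C^j$, $y_p\in C^{j_p}$: $$dc(n_1,\dots,n_{k+1})=(-1)^{k-1}m(n_1,c(n_2,\dots,n_{k+1}))+\sum_{l=1}^{k}(-1)^{l+k-1}c(\dots,m(n_l,n_{l+1}),\dots)+m(c(n_1,\dots,n_k),n_{k+1}),$$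 $$(x\cdot y)(n_1,\dots,n_{i+j})=(-1)^{ij}\,m(x(n_1,\dots,n_i),y(n_{i+1},\dots,n_{i+j})),$$ $$x\circ(y_1,\dots,y_r)=\sum(-1)^{\sum_p (j_p-1)k_p}\;x(\dots,y_1(\dots),\dots,y_r(\dots),\dots),$$ the last sum being over all ways of inserting $y_1,\dots,y_r$, in this order, into $r$ distinct inputs of $x$, where $k_p$ is the number of inputs to the left of those of $y_p$. Extend these operations additively to $\bigoplus_k C^k$. *Strong homotopy Gerstenhaber algebras.* Write $|x|=\deg x-1$. A strong homotopy Gerstenhaber algebra is a graded abelian group with an additive map $d$ of degree $1$, a biadditive product of degree $0$, and multiadditive braces $x\circ(y_1,\dots,y_r)$ of degree $-r$ ($r\ge 0$) such that, for homogeneous elements: 1. $d^2=0$, the product is associative, and $d(x\cdot y)=dx\cdot y+(-1)^{\deg x}x\cdot dy$; 2. $x\circ()=x$ and $$(x\circ(x_1,\dots,x_r))\circ(y_1,\dots,y_s)=\sum_{0\le i_1\le j_1\le\cdots\le i_r\le j_r\le s}(-1)^{\sum_p|x_p|\sum_{q\le i_p}|y_q|}\,x\circ(y_1,\dots,y_{i_1},x_1\circ(y_{i_1+1},\dots,y_{j_1}),\dots,x_r\circ(y_{i_r+1},\dots,y_{j_r}),\dots,y_s);$$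 3. $(x\cdot x')\circ(y_1,\dots,y_s)=\sum_{k=0}^{s}(-1)^{\deg x'\,(|y_1|+\cdots+|y_k|)}\,(x\circ(y_1,\dots,y_k))\cdot(x'\circ(y_{k+1},\dots,y_s))$; 4. for $s\ge1$, $$d(x\circ(y_1,\dots,y_s))-(dx)\circ(y_1,\dots,y_s)-(-1)^{|x|}\sum_{k=1}^{s}(-1)^{|y_1|+\cdots+|y_{k-1}|}x\circ(\dots,dy_k,\dots)$$ $$=(-1)^{\deg x\,|y_1|}y_1\cdot(x\circ(y_2,\dots,y_s))-(-1)^{|x|}\sum_{k=1}^{s-1}(-1)^{|y_1|+\cdots+|y_k|}x\circ(\dots,y_k\cdot y_{k+1},\dots)+(-1)^{|x|+|y_1|+\cdots+|y_{s-1}|}(x\circ(y_1,\dots,y_{s-1}))\cdot y_s.$$ A homomorphism of strong homotopy Gerstenhaber algebras is a degree-preserving additive map that commutes with $d$, the product and all braces. **Proposition.** $A=F\mathcal O$ with unit $\eta:\mathbf 1\to F\mathcal O$ and multiplication $F\mathcal O\otimes F\mathcal O\xrightarrow{\mu^{\mathcal O,\mathcal O}}F(\mathcal O\otimes\mathcal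 O)\cong F\mathcal O$ is a monoid in $\mathcal D$. The operations above make both $\bigoplus_kC^k(F)$ and $\bigoplus_kC^k(F\mathcal O)$ strong homotopy Gerstenhaber algebras, and the evaluation at the monoidal unit $$C^k(F)\to C^k(F\mathcal O),\qquad c\mapsto c^{\mathcal O,\dots,\mathcal O}:(F\mathcal O)^{\otimes k}\to F(\mathcal O\otimes\cdots\otimes\mathcal O)\cong F\mathcal O,$$ is a homomorphism of strong homotopy Gerstenhaber algebras. -/

import Mathlib

open CategoryTheory MonoidalCategory DirectSum

noncomputable section

namespace SHGerstenhaber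

/-! ### Strong homotopy Gerstenhaber algebras -/

section Algebra

universe w w'

/-- A homogeneous element of a graded abelian group: a degree and an element of that degree. -/
abbrev Homog (V : ℕ → Type w) : Type w := Σ n, V n

/-- A homogeneous element regarded as an element of the total group `⨁ n, V n`. -/
def Homog.tot {V : ℕ → Type w} [∀ n, AddCommGroup (V n)] (x : Homog V) : ⨁ n, V n :=
  DirectSum.of V x.1 x.2

/-- The shifted degree `|x| = deg x - 1`. -/
def Homog.red {V : ℕ → Type w} (x : Homog V) : ℤ := (x.1 : ℤ) - 1

/-- The total shifted degree `|y₁| + ⋯ + |yₛ|` of a list of homogeneous elements. -/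
def redSum {V : ℕ → Type w} (ys : List (Homog V)) : ℤ := (ys.map Homog.red).sum

/-- The operations of a strong homotopy Gerstenhaber algebra on a graded abelian group: a
differential, a product `x · y`, and the braces `x ∘ (y₁, …, yᵣ)`, here `brace x [y₁, …, yᵣ]`.
The laws are in `IsSHGerstenhaberAlgebra`. -/
structure Operations (V : ℕ → Type w) [∀ n, AddCommGroup (V n)] where
  d : (⨁ n, V n) → ⨁ n, V n
  mul : (⨁ n, V n) → (⨁ n, V n) → ⨁ n, V n
  brace : (⨁ n, V n) → List (⨁ n, V n) → ⨁ n, V n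

/-- The terms of the right-hand side of the pre-Jacobi identity for
`(x ∘ (x₁, …, xᵣ)) ∘ (y₁, …, yₛ)`: for all `0 ≤ i₁ ≤ j₁ ≤ i₂ ≤ ⋯ ≤ iᵣ ≤ jᵣ ≤ s`, the argument list
`y₁, …, y_{i₁}, x₁ ∘ (y_{i₁+1}, …, y_{j₁}), …, y_{iᵣ}, xᵣ ∘ (y_{iᵣ+1}, …, y_{jᵣ}), …, yₛ`
with the exponent `∑ₚ |xₚ| (|y₁| + ⋯ + |y_{iₚ}|)` of its sign. In the recursion `a = i₁` and
`b = j₁`. -/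
def preJacobiTerms {V : ℕ → Type w} [∀ n, AddCommGroup (V n)] (S : Operations V) :
    List (Homog V) → List (Homog V) → List (ℤ × List (⨁ n, V n))
  | [], ys => [(0, ys.map Homog.tot)]
  | x :: xs, ys =>
    (List.range (ys.length + 1)).flatMap fun b =>
      (List.range (b + 1)).flatMap fun a =>
        (preJacobiTerms S xs (ys.drop b)).map fun t =>
          (x.red * redSum (ys.take a) + redSum xs * redSum (ys.take b) + t.1,
            (ys.take a).map Homog.tot ++
              S.brace x.tot (((ys.take b).drop a).map Homog.tot) :: t.2)

/-- The laws of a strong homotopy Gerstenhaber algebra in the sense of Gerstenhaber and Voronov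
(a homotopy G-algebra): a brace algebra that is also a differential graded associative algebra,
with the distributivity and homotopy identities between the product, the differential and the
braces. -/
structure IsSHGerstenhaberAlgebra {V : ℕ → Type w} [∀ n, AddCommGroup (V n)]
    (S : Operations V) : Prop where
  /- additivity -/
  d_add : ∀ x y, S.d (x + y) = S.d x + S.d y
  add_mul : ∀ x y z, S.mul (x + y) z = S.mul x z + S.mul y z
  mul_add : ∀ x y z, S.mul x (y + z) = S.mul x y + S.mul x z
  brace_add_left : ∀ x y L, S.brace (x + y) L = S.brace x L + S.brace y L
  brace_add_right : ∀ x L y z L',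
    S.brace x (L ++ (y + z) :: L') = S.brace x (L ++ y :: L') + S.brace x (L ++ z :: L')
  /- degrees: `d` has degree `1`, the product degree `0`, the `r`-ary brace degree `-r` -/
  d_degree : ∀ (x : Homog V) (n : ℕ), n ≠ x.1 + 1 → S.d x.tot n = 0
  mul_degree : ∀ (x y : Homog V) (n : ℕ), n ≠ x.1 + y.1 → S.mul x.tot y.tot n = 0
  brace_degree : ∀ (x : Homog V) (ys : List (Homog V)) (n : ℕ),
    n + ys.length ≠ x.1 + (ys.map Sigma.fst).sum → S.brace x.tot (ys.map Homog.tot) n = 0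
  /- differential graded associative algebra -/
  d_d : ∀ x, S.d (S.d x) = 0
  mul_assoc : ∀ x y z, S.mul (S.mul x y) z = S.mul x (S.mul y z)
  d_mul : ∀ x y : Homog V, S.d (S.mul x.tot y.tot) =
    S.mul (S.d x.tot) y.tot + (x.1 : ℤ).negOnePow • S.mul x.tot (S.d y.tot)
  /- brace algebra -/
  brace_nil : ∀ x, S.brace x [] = x
  brace_brace : ∀ (x : Homog V) (xs ys : List (Homog V)),
    S.brace (S.brace x.tot (xs.map Homog.tot)) (ys.map Homog.tot) =
      ((preJacobiTerms S xs ys).map fun t => t.1.negOnePow • S.brace x.tot t.2).sum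
  /- distributivity -/
  mul_brace : ∀ (x x' : Homog V) (ys : List (Homog V)),
    S.brace (S.mul x.tot x'.tot) (ys.map Homog.tot) =
      ∑ k ∈ Finset.range (ys.length + 1), ((x'.1 : ℤ) * redSum (ys.take k)).negOnePow •
        S.mul (S.brace x.tot ((ys.take k).map Homog.tot))
          (S.brace x'.tot ((ys.drop k).map Homog.tot))
  /- homotopy -/
  d_brace : ∀ (x : Homog V) (ys : List (Homog V)) (hys : ys ≠ []),
    S.d (S.brace x.tot (ys.map Homog.tot)) - S.brace (S.d x.tot) (ys.map Homog.tot)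
        - x.red.negOnePow • ∑ k : Fin ys.length, (redSum (ys.take k.1)).negOnePow •
            S.brace x.tot ((ys.take k.1).map Homog.tot ++
              S.d (ys[k.1]'(by omega)).tot :: (ys.drop (k.1 + 1)).map Homog.tot) =
      ((x.1 : ℤ) * (ys.head hys).red).negOnePow •
          S.mul (ys.head hys).tot (S.brace x.tot (ys.tail.map Homog.tot))
        - x.red.negOnePow • ∑ k : Fin (ys.length - 1), (redSum (ys.take (k.1 + 1))).negOnePow •
            S.brace x.tot ((ys.take k.1).map Homog.tot ++
              S.mul (ys[k.1]'(by omega)).tot (ys[k.1 + 1]'(by omega)).tot ::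
                (ys.drop (k.1 + 2)).map Homog.tot)
        + (x.red + redSum ys.dropLast).negOnePow •
            S.mul (S.brace x.tot (ys.dropLast.map Homog.tot)) (ys.getLast hys).tot

/-- A degreewise additive map is a homomorphism of strong homotopy Gerstenhaber algebras if it
commutes with the differential, the product and all braces. -/
structure IsSHGerstenhaberHom {V : ℕ → Type w} [∀ n, AddCommGroup (V n)]
    {W : ℕ → Type w'} [∀ n, AddCommGroup (W n)]
    (S : Operations V) (T : Operations W) (φ : ∀ n, V n →+ W n) : Prop where
  map_d : ∀ x, DirectSum.map φ (S.d x) = T.d (DirectSum.map φ x)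
  map_mul : ∀ x y, DirectSum.map φ (S.mul x y) = T.mul (DirectSum.map φ x) (DirectSum.map φ y)
  map_brace : ∀ x L, DirectSum.map φ (S.brace x L) =
    T.brace (DirectSum.map φ x) (L.map (DirectSum.map φ))

/-! ### Gerstenhaber–Voronov operations from substitution of cochains -/

/-- `m₀ + ⋯ + m_{i-1}`, by recursion. -/
def blockSum : ∀ i : ℕ, (Fin i → ℕ) → ℕ
  | 0, _ => 0
  | i + 1, m => blockSum i (fun q => m q.castSucc) + m (Fin.last i)

/-- `m₀ + ⋯ + m_{q-1}`, the number of inputs in the blocks before the block `q`. -/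
def offset {i : ℕ} (m : Fin i → ℕ) (q : Fin i) : ℕ :=
  blockSum q.1 (fun t => m ⟨t.1, t.2.trans q.2⟩)

/-- The `A`-valued cochains `V n` with their simultaneous substitution: `comp x g` is the cochain
`x(g₀(…), …, g_{i-1}(…))`; `one` is the identity `1`-cochain and `m` is the multiplication
`2`-cochain. -/
structure Substitution (V : ℕ → Type w) where
  one : V 1
  m : V 2
  comp : ∀ {i : ℕ}, V i → ∀ g : Fin i → Homog V, V (blockSum i fun q => (g q).1)

namespace Substitution

variable {V : ℕ → Type w} [∀ n, AddCommGroup (V n)] (O : Substitution V)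

/-- `x(g₀(…), …, g_{i-1}(…))` as an element of the total group. -/
def sub {i : ℕ} (x : V i) (g : Fin i → Homog V) : ⨁ n, V n :=
  DirectSum.of V _ (O.comp x g)

/-- The word of length `i` with `ys p` at the place `s p` and the identity cochain elsewhere. -/
def word {i r : ℕ} (s : Fin r → Fin i) (ys : Fin r → Homog V) (q : Fin i) : Homog V :=
  open Classical in if h : ∃ p, s p = q then ys h.choose else ⟨1, O.one⟩

/-- The differential of a `k`-cochain:
`(-1)^(k-1) m(n₁, c(n₂, …)) + ∑ᵢ (-1)^(i+k-1) c(…, m(nᵢ, nᵢ₊₁), …) + m(c(n₁, …), nₖ₊₁)`.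
The index `i` below starts from `0`. -/
def dHom {k : ℕ} (c : V k) : ⨁ n, V n :=
  ((k : ℤ) - 1).negOnePow • O.sub O.m ![⟨1, O.one⟩, ⟨k, c⟩]
    + ∑ i : Fin k, (((i.1 : ℤ) + 1) + k - 1).negOnePow •
        O.sub c (Function.update (fun _ => ⟨1, O.one⟩) i ⟨2, O.m⟩)
    + O.sub O.m ![⟨k, c⟩, ⟨1, O.one⟩]

/-- The product of homogeneous cochains, `(-1)^(ij) m(x(n₁, …, nᵢ), y(nᵢ₊₁, …, nᵢ₊ⱼ))`. -/
def mulHom {i j : ℕ} (x : V i) (y : V j) : ⨁ n, V n :=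
  ((i : ℤ) * j).negOnePow • O.sub O.m ![⟨i, x⟩, ⟨j, y⟩]

/-- The brace of homogeneous cochains: the sum over all ways to insert `y₁, …, yᵣ`, in this order,
into places `s 1 < ⋯ < s r` of `x`, with the sign `(-1)^(∑ₚ (jₚ - 1) kₚ)`, where `jₚ` is the degree
of `yₚ` and `kₚ` is the number of inputs to the left of those of `yₚ`. -/
def braceHom {i r : ℕ} (x : V i) (ys : Fin r → Homog V) : ⨁ n, V n :=
  open Classical in
  ∑ s ∈ (Finset.univ : Finset (Fin r → Fin i)).filter StrictMono,
    (∑ p, (ys p).red * (offset (fun q => (O.word s ys q).1) (s p) : ℤ)).negOnePow •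
      O.sub x (O.word s ys)

/-- The Gerstenhaber–Voronov operations, extended additively from homogeneous cochains to the
total group by summing over the homogeneous components of all arguments. -/
def operations : Operations V where
  d x := open Classical in ∑ k ∈ DFinsupp.support x, O.dHom (x k)
  mul x y := open Classical in
    ∑ i ∈ DFinsupp.support x, ∑ j ∈ DFinsupp.support y, O.mulHom (x i) (y j)
  brace x L := open Classical in
    ∑ i ∈ DFinsupp.support x,
      ∑ j ∈ Fintype.piFinset (fun p : Fin L.length => DFinsupp.support (L.get p)),
        O.braceHom (x i) (fun p => ⟨j p, L.get p (j p)⟩)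

end Substitution

end Algebra

/-! ### Iterated tensor products -/

section Tensor

universe v u

variable {C : Type u} [Category.{v} C] [MonoidalCategory C]

/-- The tensor product `X₀ ⊗ ⋯ ⊗ X_{n-1}`, bracketed as `((𝟙 ⊗ X₀) ⊗ X₁) ⊗ ⋯ ⊗ X_{n-1}`;
it is the unit for `n = 0`. -/
def tensorObj : ∀ n : ℕ, (Fin n → C) → C
  | 0, _ => 𝟙_ C
  | n + 1, X => tensorObj n (fun q => X q.castSucc) ⊗ X (Fin.last n)

/-- The tensor product of morphisms `f₀ ⊗ ⋯ ⊗ f_{n-1}`. -/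
def tensorMap : ∀ (n : ℕ) {X Y : Fin n → C}, (∀ q, X q ⟶ Y q) → (tensorObj n X ⟶ tensorObj n Y)
  | 0, _, _, _ => 𝟙 (𝟙_ C)
  | n + 1, _, _, f => tensorMap n (fun q => f q.castSucc) ⊗ₘ f (Fin.last n)

theorem tensorMap_comp : ∀ (n : ℕ) {X Y Z : Fin n → C} (f : ∀ q, X q ⟶ Y q)
    (g : ∀ q, Y q ⟶ Z q), tensorMap n (fun q => f q ≫ g q) = tensorMap n f ≫ tensorMap n g
  | 0, _, _, _, _, _ => (Category.comp_id (𝟙 (𝟙_ C))).symm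
  | n + 1, _, _, _, f, g => by
    simp only [tensorMap, tensorMap_comp n]
    exact (tensorHom_comp_tensorHom _ _ _ _).symm

/-- The canonical isomorphism
`X₀ ⊗ ⋯ ⊗ X_{a+b-1} ≅ (X₀ ⊗ ⋯ ⊗ X_{a-1}) ⊗ (X_a ⊗ ⋯ ⊗ X_{a+b-1})`. -/
def appendIso (a : ℕ) : ∀ (b : ℕ) (X : Fin (a + b) → C),
    tensorObj (a + b) X ≅
      tensorObj a (fun q => X (Fin.castAdd b q)) ⊗ tensorObj b (fun q => X (Fin.natAdd a q))
  | 0, X => (ρ_ (tensorObj a X)).symm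
  | b + 1, X =>
    whiskerRightIso (appendIso a b (fun q => X q.castSucc)) (X (Fin.last (a + b))) ≪≫ α_ _ _ _

theorem offset_add_le : ∀ {i : ℕ} (m : Fin i → ℕ) (q : Fin i),
    offset m q + m q ≤ blockSum i m
  | 0, _, q => q.elim0
  | i + 1, m, q => by
    induction q using Fin.lastCases with
    | last => exact le_rfl
    | cast q => exact (offset_add_le (fun q => m q.castSucc) q).trans (Nat.le_add_right _ _)

/-- The position of the `t`-th element of the block `q` when `m₀ + ⋯ + m_{i-1}` elements are
divided into `i` consecutive blocks of lengths `m₀, …, m_{i-1}`. -/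
def blockIdx {i : ℕ} (m : Fin i → ℕ) (q : Fin i) (t : Fin (m q)) : Fin (blockSum i m) :=
  ⟨offset m q + t.1, (Nat.add_lt_add_left t.2 _).trans_le (offset_add_le m q)⟩

/-- The canonical isomorphism from the tensor product of all `X`'s to the tensor product of the
tensor products over consecutive blocks. -/
def blockIso : ∀ {i : ℕ} (m : Fin i → ℕ) (X : Fin (blockSum i m) → C),
    tensorObj (blockSum i m) X ≅
      tensorObj i (fun q => tensorObj (m q) (fun t => X (blockIdx m q t)))
  | 0, _, _ => Iso.refl (𝟙_ C)
  | i + 1, m, X =>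
    appendIso (blockSum i fun q => m q.castSucc) (m (Fin.last i)) X ≪≫
      whiskerRightIso (blockIso (fun q => m q.castSucc) (fun t => X (Fin.castAdd _ t)))
        (tensorObj (m (Fin.last i)) (fun t => X (Fin.natAdd _ t)))

theorem appendIso_naturality (a : ℕ) : ∀ (b : ℕ) {X Y : Fin (a + b) → C} (f : ∀ q, X q ⟶ Y q),
    tensorMap (a + b) f ≫ (appendIso a b Y).hom =
      (appendIso a b X).hom ≫ (tensorMap a (fun q => f (Fin.castAdd b q)) ⊗ₘ
        tensorMap b (fun q => f (Fin.natAdd a q)))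
  | 0, X, Y, f => by
    simp only [appendIso, Iso.symm_hom]
    change tensorMap a f ≫ (ρ_ (tensorObj a Y)).inv =
      (ρ_ (tensorObj a X)).inv ≫ (tensorMap a f ⊗ₘ 𝟙 (𝟙_ C))
    simp
  | b + 1, X, Y, f => by
    have h := appendIso_naturality a b (fun q => f q.castSucc)
    change (tensorMap (a + b) (fun q => f q.castSucc) ⊗ₘ f (Fin.last (a + b))) ≫
        (appendIso a b (fun q => Y q.castSucc)).hom ▷ Y (Fin.last (a + b)) ≫ (α_ _ _ _).hom =
      ((appendIso a b (fun q => X q.castSucc)).hom ▷ X (Fin.last (a + b)) ≫ (α_ _ _ _).hom) ≫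
        (tensorMap a (fun q => f (Fin.castAdd b q).castSucc) ⊗ₘ
          (tensorMap b (fun q => f (Fin.natAdd a q).castSucc) ⊗ₘ f (Fin.last (a + b))))
    rw [Category.assoc, ← associator_naturality, ← Category.assoc, ← Category.assoc,
      tensorHom_comp_whiskerRight, h, whiskerRight_comp_tensorHom]

theorem blockIso_naturality : ∀ {i : ℕ} (m : Fin i → ℕ) {X Y : Fin (blockSum i m) → C}
    (f : ∀ q, X q ⟶ Y q),
    tensorMap (blockSum i m) f ≫ (blockIso m Y).hom =
      (blockIso m X).hom ≫ tensorMap i (fun q => tensorMap (m q) (fun t => f (blockIdx m q t)))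
  | 0, _, X, Y, f => rfl
  | i + 1, m, X, Y, f => by
    have h := blockIso_naturality (fun q => m q.castSucc) (fun t => f (Fin.castAdd _ t))
    have h' := appendIso_naturality (blockSum i fun q => m q.castSucc) (m (Fin.last i)) f
    change tensorMap (blockSum i (fun q => m q.castSucc) + m (Fin.last i)) f ≫
        (appendIso _ _ Y).hom ≫
          (blockIso (fun q => m q.castSucc) (fun t => Y (Fin.castAdd _ t))).hom ▷
            tensorObj (m (Fin.last i)) (fun t => Y (Fin.natAdd _ t)) =
      ((appendIso _ _ X).hom ≫
          (blockIso (fun q => m q.castSucc) (fun t => X (Fin.castAdd _ t))).hom ▷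
            tensorObj (m (Fin.last i)) (fun t => X (Fin.natAdd _ t))) ≫
        (tensorMap i (fun q => tensorMap (m q.castSucc)
            (fun t => f (Fin.castAdd _ (blockIdx (fun q => m q.castSucc) q t)))) ⊗ₘ
          tensorMap (m (Fin.last i)) (fun t => f (Fin.natAdd _ t)))
    rw [← Category.assoc, h', Category.assoc, Category.assoc, tensorHom_comp_whiskerRight, h,
      whiskerRight_comp_tensorHom]

variable (C) in
/-- The canonical isomorphism `𝟙 ⊗ ⋯ ⊗ 𝟙 ≅ 𝟙`. -/
def unitIso : ∀ n : ℕ, tensorObj n (fun _ => 𝟙_ C) ≅ 𝟙_ C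
  | 0 => Iso.refl (𝟙_ C)
  | n + 1 => whiskerRightIso (unitIso n) (𝟙_ C) ≪≫ λ_ (𝟙_ C)

end Tensor

/-! ### The Hochschild complex of a monoidal functor -/

section Functor

universe v₁ u₁ v₂ u₂

variable {C : Type u₁} [Category.{v₁} C] [MonoidalCategory C]
  {D : Type u₂} [Category.{v₂} D] [MonoidalCategory D]

/-- The `k`-cochains of `F`: natural transformations of multifunctors
`F X₁ ⊗ ⋯ ⊗ F Xₖ ⟶ F (X₁ ⊗ ⋯ ⊗ Xₖ)`; for `k = 0` these are the morphisms `𝟙 ⟶ F 𝟙`. -/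
@[ext]
structure FunctorCochain (F : C ⥤ D) (k : ℕ) : Type (max u₁ v₁ v₂) where
  app : ∀ X : Fin k → C, tensorObj k (fun q => F.obj (X q)) ⟶ F.obj (tensorObj k X)
  naturality : ∀ {X Y : Fin k → C} (f : ∀ q, X q ⟶ Y q),
    tensorMap k (fun q => F.map (f q)) ≫ app Y = app X ≫ F.map (tensorMap k f)

namespace FunctorCochain

variable [Preadditive D] {F : C ⥤ D} {k : ℕ}

instance : Zero (FunctorCochain F k) where
  zero := ⟨fun _ => 0, by simp⟩

instance : Add (FunctorCochain F k) where
  add c c' := ⟨fun X => c.app X + c'.app X, fun f => by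
    rw [Preadditive.comp_add, Preadditive.add_comp, c.naturality, c'.naturality]⟩

instance : Neg (FunctorCochain F k) where
  neg c := ⟨fun X => -c.app X, fun f => by
    rw [Preadditive.comp_neg, Preadditive.neg_comp, c.naturality]⟩

/-- Cochains are added componentwise. -/
instance : AddCommGroup (FunctorCochain F k) where
  add_assoc a b c := FunctorCochain.ext (funext fun X => add_assoc (a.app X) (b.app X) (c.app X))
  zero_add a := FunctorCochain.ext (funext fun X => zero_add (a.app X))
  add_zero a := FunctorCochain.ext (funext fun X => add_zero (a.app X))
  nsmul := nsmulRec
  zsmul := zsmulRec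
  neg_add_cancel a := FunctorCochain.ext (funext fun X => neg_add_cancel (a.app X))
  add_comm a b := FunctorCochain.ext (funext fun X => add_comm (a.app X) (b.app X))

theorem zero_app (X : Fin k → C) : (0 : FunctorCochain F k).app X = 0 := rfl

theorem add_app (c c' : FunctorCochain F k) (X : Fin k → C) :
    (c + c').app X = c.app X + c'.app X := rfl

end FunctorCochain

/-- The identity `1`-cochain `F X ⟶ F X`. -/
def idCochain (F : C ⥤ D) : FunctorCochain F 1 where
  app X := (λ_ (F.obj (X 0))).hom ≫ F.map (λ_ (X 0)).inv
  naturality {X Y} f := by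
    change (𝟙 (𝟙_ D) ⊗ₘ F.map (f 0)) ≫ (λ_ _).hom ≫ F.map (λ_ _).inv =
      ((λ_ _).hom ≫ F.map (λ_ _).inv) ≫ F.map (𝟙 (𝟙_ C) ⊗ₘ f 0)
    simp [← Functor.map_comp]

/-- The `2`-cochain `μ : F X₁ ⊗ F X₂ ⟶ F (X₁ ⊗ X₂)` of a monoidal functor. -/
def muCochain (F : C ⥤ D) [F.LaxMonoidal] : FunctorCochain F 2 where
  app X := (λ_ (F.obj (X 0))).hom ▷ F.obj (X 1) ≫ Functor.LaxMonoidal.μ F (X 0) (X 1) ≫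
    F.map ((λ_ (X 0)).inv ▷ X 1)
  naturality {X Y} f := by
    change ((𝟙 (𝟙_ D) ⊗ₘ F.map (f 0)) ⊗ₘ F.map (f 1)) ≫ (λ_ _).hom ▷ _ ≫
        Functor.LaxMonoidal.μ F _ _ ≫ F.map ((λ_ _).inv ▷ _) =
      ((λ_ _).hom ▷ _ ≫ Functor.LaxMonoidal.μ F _ _ ≫ F.map ((λ_ _).inv ▷ _)) ≫
        F.map ((𝟙 (𝟙_ C) ⊗ₘ f 0) ⊗ₘ f 1)
    have h : (F.map (f 0) ⊗ₘ F.map (f 1)) ≫ Functor.LaxMonoidal.μ F _ _ =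
        Functor.LaxMonoidal.μ F _ _ ≫ F.map (f 0 ⊗ₘ f 1) :=
      Functor.LaxMonoidal.μ_natural F (f 0) (f 1)
    have h1 : ((𝟙 (𝟙_ D) ⊗ₘ F.map (f 0)) ⊗ₘ F.map (f 1)) ≫ (λ_ (F.obj (Y 0))).hom ▷ _ =
        (λ_ (F.obj (X 0))).hom ▷ _ ≫ (F.map (f 0) ⊗ₘ F.map (f 1)) := by
      rw [tensorHom_comp_whiskerRight, whiskerRight_comp_tensorHom, id_tensorHom,
        leftUnitor_naturality]
    have h2 : (f 0 ⊗ₘ f 1) ≫ (λ_ (Y 0)).inv ▷ _ =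
        (λ_ (X 0)).inv ▷ _ ≫ ((𝟙 (𝟙_ C) ⊗ₘ f 0) ⊗ₘ f 1) := by
      rw [tensorHom_comp_whiskerRight, whiskerRight_comp_tensorHom, id_tensorHom,
        leftUnitor_inv_naturality]
    rw [reassoc_of% h1, reassoc_of% h, ← F.map_comp, h2, F.map_comp, Category.assoc,
      Category.assoc]

/-- Substitution of cochains of `F`: with `T q` the tensor product of the `X`'s in the block `q`,
`⨂ F X ≅ ⨂_q ⨂ F X ⟶ ⨂_q F (T q) ⟶ F (⨂_q T q) ≅ F (⨂ X)`. -/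
def substCochain {F : C ⥤ D} {i : ℕ} (c : FunctorCochain F i)
    (g : Fin i → Homog (FunctorCochain F)) :
    FunctorCochain F (blockSum i fun q => (g q).1) where
  app X := (blockIso (fun q => (g q).1) (fun t => F.obj (X t))).hom ≫
    tensorMap i (fun q => (g q).2.app (fun t => X (blockIdx _ q t))) ≫
    c.app (fun q => tensorObj (g q).1 (fun t => X (blockIdx _ q t))) ≫
    F.map (blockIso (fun q => (g q).1) X).inv
  naturality {X Y} f := by
    have h1 := blockIso_naturality (fun q => (g q).1) (fun t => F.map (f t))
    have h2 := blockIso_naturality (fun q => (g q).1) (fun t => f t)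
    have h2' : tensorMap i (fun q => tensorMap (g q).1 (fun t => f (blockIdx _ q t))) ≫
          (blockIso (fun q => (g q).1) Y).inv =
        (blockIso (fun q => (g q).1) X).inv ≫ tensorMap _ (fun t => f t) := by
      rw [Iso.comp_inv_eq, Category.assoc, h2, Iso.inv_hom_id_assoc]
    have h3 : tensorMap i (fun q => tensorMap (g q).1 (fun t => F.map (f (blockIdx _ q t)))) ≫
          tensorMap i (fun q => (g q).2.app (fun t => Y (blockIdx _ q t))) =
        tensorMap i (fun q => (g q).2.app (fun t => X (blockIdx _ q t))) ≫
          tensorMap i (fun q => F.map (tensorMap (g q).1 (fun t => f (blockIdx _ q t)))) := by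
      rw [← tensorMap_comp, ← tensorMap_comp]
      congr 1
      funext q
      exact (g q).2.naturality _
    have h4 := c.naturality
      (fun q => tensorMap (g q).1 (fun t => f (blockIdx (fun q => (g q).1) q t)))
    rw [reassoc_of% h1, reassoc_of% h3, reassoc_of% h4, ← F.map_comp, h2', F.map_comp]
    simp only [Category.assoc]

/-- The cochains of a monoidal functor with their substitution. -/
def functorSubstitution (F : C ⥤ D) [F.LaxMonoidal] : Substitution (FunctorCochain F) where
  one := idCochain F
  m := muCochain F
  comp c g := substCochain c g

/-- The operations on the Hochschild complex of a monoidal functor. -/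
def functorOperations (F : C ⥤ D) [F.LaxMonoidal] [Preadditive D] :
    Operations (FunctorCochain F) :=
  (functorSubstitution F).operations

/-! ### The Hochschild complex of a monoid -/

/-- The `k`-cochains of an object `A`: the morphisms `A ⊗ ⋯ ⊗ A ⟶ A`; for `k = 0` these are the
morphisms `𝟙 ⟶ A`. -/
abbrev MonoidCochain (A : D) (k : ℕ) : Type v₂ := tensorObj k (fun _ : Fin k => A) ⟶ A

/-- The cochains of a monoid with their substitution. -/
def monoidSubstitution (A : D) (M : MonObj A) : Substitution (MonoidCochain A) where
  one := (λ_ A).hom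
  m := (λ_ A).hom ▷ A ≫ M.mul
  comp c g := (blockIso (fun q => (g q).1) (fun _ => A)).hom ≫ tensorMap _ (fun q => (g q).2) ≫ c

/-- The operations on the Hochschild complex of a monoid. -/
def monoidOperations (A : D) (M : MonObj A) [Preadditive D] : Operations (MonoidCochain A) :=
  (monoidSubstitution A M).operations

/-- Evaluation at the monoidal unit: the component of a `k`-cochain at `𝟙, …, 𝟙`, followed by
`F (𝟙 ⊗ ⋯ ⊗ 𝟙) ≅ F 𝟙`. -/
def evalUnit (F : C ⥤ D) [Preadditive D] (k : ℕ) :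
    FunctorCochain F k →+ MonoidCochain (F.obj (𝟙_ C)) k where
  toFun c := c.app (fun _ => 𝟙_ C) ≫ F.map (unitIso C k).hom
  map_zero' := by rw [FunctorCochain.zero_app, Limits.zero_comp]
  map_add' c c' := by rw [FunctorCochain.add_app, Preadditive.add_comp]

end Functor

end SHGerstenhaber

end

/-! Both cochain complexes are nonsymmetric operads with an associative multiplication `m`, and the
theorem is the Gerstenhaber–Voronov argument for such operads. The braces are the primary structure:
`d x = m∘(x) - (-1)^|x| x∘(m)` and `x·y = (-1)^(deg x) m∘(x,y)`, and associativity of `m` becomes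
`m∘(m) = 0` (`IsOperad.mult_brace_mult`).

The one hard law is the pre-Jacobi identity (`IsOperad.brace_brace`). A brace `x∘(ys)` is a signed
sum of substitutions `x(w)` over the words `w` of length `deg x` that shuffle `ys` with identity
cochains (`braceHom_eq`). In an iterated substitution `(x(w))(u)` operad associativity distributes
the consecutive blocks of `u` among the letters of `w`. Shuffling into the joined places amounts to
cutting `ys` into intervals and shuffling each into its own block (`shSum_add_index`), so every
letter of `w` is replaced by its brace with an interval (`IsOperad.brace_signedSub`). An identity
letter absorbs at most one `y`; these letters therefore supply the free arguments and the remaining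
identities of the right-hand side (`IsOperad.shSum_blockSub`). The signs match because shifted
degrees add under substitution and the identity has shifted degree `0`.

The other laws are cases with `m` among the entries, where few terms survive because `m` has two
inputs. `(m∘(m))∘(ys) = 0` for one, two and three arguments drives `d² = 0`, the Leibniz rule and
associativity. Expanding `(m∘(x,x'))∘(ys)` gives distributivity. The homotopy identity compares
`(x∘(m))∘(ys)` with `(x∘(ys))∘(m)` (`IsOperad.preJacobiSum_mult`) and adds `(m∘(x))∘(ys)`.

The operad laws for the cochains (`monoidSubstitution_isOperad`, `functorSubstitution_isOperad`)
combine naturality with coherence: all regrouping isomorphisms come from the free monoidal category,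
where parallel morphisms coincide. Evaluation at the unit preserves the identity, `m` and
substitution (`isHom_evalUnit`), hence every operation built from them. -/

open CategoryTheory MonoidalCategory DirectSum

noncomputable section

namespace SHGerstenhaber

/-! ### Sums over shuffles and over deconcatenations -/

section Sums

variable {α M N : Type*} [AddCommGroup M] [AddCommGroup N]

/-- The sum of `f w` over all words `w` of length `n` obtained by inserting the letters of a list,
in their order, into the word `e ⋯ e`. -/
def shSum (e : α) : ℕ → (List α → M) → List α → M
  | 0, f, [] => f []
  | 0, _, _ :: _ => 0
  | n + 1, f, [] => shSum e n (fun w => f (e :: w)) []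
  | n + 1, f, z :: zs =>
    shSum e n (fun w => f (e :: w)) (z :: zs) + shSum e n (fun w => f (z :: w)) zs

/-- The sum of `F a b` over all ways to write a list as `a ++ b`. -/
def splitSum : (List α → List α → M) → List α → M
  | F, [] => F [] []
  | F, y :: ys => F [] (y :: ys) + splitSum (fun a b => F (y :: a) b) ys

theorem shSum_add (e : α) : ∀ (n : ℕ) (f g : List α → M) (ys : List α),
    shSum e n (fun w => f w + g w) ys = shSum e n f ys + shSum e n g ys
  | 0, _, _, [] => rfl
  | 0, _, _, _ :: _ => (add_zero 0).symm
  | n + 1, f, g, [] => shSum_add e n _ _ []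
  | n + 1, f, g, y :: ys => by
    simp only [shSum, shSum_add e n]
    abel

theorem shSum_map (φ : M →+ N) (e : α) : ∀ (n : ℕ) (f : List α → M) (ys : List α),
    shSum e n (fun w => φ (f w)) ys = φ (shSum e n f ys)
  | 0, _, [] => rfl
  | 0, _, _ :: _ => (map_zero φ).symm
  | n + 1, f, [] => shSum_map φ e n _ []
  | n + 1, f, y :: ys => by simp only [shSum, shSum_map φ e n, map_add]

theorem shSum_zero (e : α) (n : ℕ) (ys : List α) : shSum e n (fun _ => (0 : M)) ys = 0 := by
  simpa using shSum_map (0 : M →+ M) e n (fun _ => (0 : M)) ys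

theorem shSum_smul (u : ℤˣ) (e : α) (n : ℕ) (f : List α → M) (ys : List α) :
    shSum e n (fun w => u • f w) ys = u • shSum e n f ys :=
  shSum_map (DistribSMul.toAddMonoidHom M u) e n f ys

/-- A sum over shuffles only involves words with the right length and additive invariants. -/
theorem shSum_mem {A : Type*} [AddCommGroup A] (δ : α → A) (e : α) (H : AddSubgroup M) :
    ∀ (n : ℕ) (f : List α → M) (ys : List α),
    (∀ w : List α, w.length = n → (w.map δ).sum = (ys.map δ).sum + (n - ys.length : ℤ) • δ e →
      f w ∈ H) → shSum e n f ys ∈ H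
  | 0, f, [], h => h [] rfl (by simp)
  | 0, _, _ :: _, _ => H.zero_mem
  | n + 1, f, [], h => by
    refine shSum_mem δ e H n _ [] fun w hw hδ => h _ (by simp [hw]) ?_
    simp only [List.map_cons, List.sum_cons, hδ, List.map_nil, List.sum_nil, List.length_nil]
    push_cast
    module
  | n + 1, f, y :: ys, h => by
    refine H.add_mem (shSum_mem δ e H n _ _ fun w hw hδ => h _ (by simp [hw]) ?_)
      (shSum_mem δ e H n _ _ fun w hw hδ => h _ (by simp [hw]) ?_)
    · simp only [List.map_cons, List.sum_cons, hδ, List.length_cons]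
      push_cast
      module
    · simp only [List.map_cons, List.sum_cons, hδ, List.length_cons]
      push_cast
      module

/-- With `δ` the shifted degree and `e` the identity cochain, whose shifted degree is `0`, this
allows `redSum w` to be replaced by `redSum ys` in signs under the sum. It is `shSum_mem` for the
difference and the zero subgroup. -/
theorem shSum_congr {A : Type*} [AddCommGroup A] (δ : α → A) (e : α)
    (n : ℕ) (f g : List α → M) (ys : List α)
    (h : ∀ w : List α, w.length = n →
      (w.map δ).sum = (ys.map δ).sum + (n - ys.length : ℤ) • δ e → f w = g w) :
    shSum e n f ys = shSum e n g ys := by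
  have h0 := shSum_mem δ e ⊥ n (fun w => f w + -g w) ys fun w h1 h2 => by
    rw [h w h1 h2, add_neg_cancel]; exact AddSubgroup.zero_mem _
  rw [shSum_add] at h0
  have h1 : shSum e n (fun w => -g w) ys = -shSum e n g ys :=
    shSum_map (-AddMonoidHom.id M) e n g ys
  rwa [h1, AddSubgroup.mem_bot, ← sub_eq_add_neg, sub_eq_zero] at h0

theorem shSum_eq_zero_of_lt (e : α) : ∀ (n : ℕ) (f : List α → M) (ys : List α),
    n < ys.length → shSum e n f ys = 0
  | 0, _, _ :: _, _ => rfl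
  | n + 1, f, y :: ys, h => by
    rw [shSum, shSum_eq_zero_of_lt e n _ _ (by simp at h ⊢; omega),
      shSum_eq_zero_of_lt e n _ _ (by simpa using h), add_zero]

theorem shSum_self (e : α) : ∀ (f : List α → M) (ys : List α), shSum e ys.length f ys = f ys
  | f, [] => rfl
  | f, y :: ys => by
    rw [List.length_cons, shSum, shSum_eq_zero_of_lt e _ _ _ (by simp), zero_add, shSum_self]

theorem shSum_nil (e : α) : ∀ (n : ℕ) (f : List α → M), shSum e n f [] = f (List.replicate n e)
  | 0, _ => rfl
  | n + 1, f => by rw [shSum, shSum_nil e n, List.replicate_succ]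

theorem shSum_map_list {β : Type*} (ι : α → β) (e : α) : ∀ (n : ℕ) (f : List β → M) (ys : List α),
    shSum (ι e) n f (ys.map ι) = shSum e n (fun w => f (w.map ι)) ys
  | 0, _, [] => rfl
  | 0, _, _ :: _ => rfl
  | n + 1, f, [] => shSum_map_list ι e n _ []
  | n + 1, f, y :: ys => by
    have h1 := shSum_map_list ι e n (fun w => f (ι e :: w)) (y :: ys)
    have h2 := shSum_map_list ι e n (fun w => f (ι y :: w)) ys
    exact congrArg₂ (· + ·) h1 h2

theorem splitSum_add : ∀ (F G : List α → List α → M) (ys : List α),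
    splitSum (fun a b => F a b + G a b) ys = splitSum F ys + splitSum G ys
  | _, _, [] => rfl
  | F, G, y :: ys => by
    simp only [splitSum, splitSum_add _ _ ys]
    abel

theorem splitSum_map (φ : M →+ N) : ∀ (F : List α → List α → M) (ys : List α),
    splitSum (fun a b => φ (F a b)) ys = φ (splitSum F ys)
  | _, [] => rfl
  | F, y :: ys => by simp only [splitSum, splitSum_map φ _ ys, map_add]

theorem splitSum_zero (ys : List α) : splitSum (fun _ _ => (0 : M)) ys = 0 := by
  simpa using splitSum_map (0 : M →+ M) (fun _ _ => (0 : M)) ys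

theorem splitSum_smul (u : ℤˣ) (F : List α → List α → M) (ys : List α) :
    splitSum (fun a b => u • F a b) ys = u • splitSum F ys :=
  splitSum_map (DistribSMul.toAddMonoidHom M u) F ys

theorem splitSum_congr : ∀ (F G : List α → List α → M) (ys : List α),
    (∀ a b, a ++ b = ys → F a b = G a b) → splitSum F ys = splitSum G ys
  | _, _, [], h => h [] [] rfl
  | F, G, y :: ys, h => by
    rw [splitSum, splitSum, h [] (y :: ys) rfl,
      splitSum_congr _ _ ys fun a b hab => h (y :: a) b (by rw [← hab]; rfl)]

/-- Only the deconcatenation `(ys, [])` contributes if `F` vanishes on all others. -/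
theorem splitSum_eq_last : ∀ (F : List α → List α → M) (ys : List α),
    (∀ a b, b ≠ [] → F a b = 0) → splitSum F ys = F ys []
  | _, [], _ => rfl
  | F, y :: ys, h => by
    rw [splitSum, h _ _ (by simp), zero_add, splitSum_eq_last _ _ fun a b hb => h _ _ hb]

theorem splitSum_eq_sum_range : ∀ (F : List α → List α → M) (ys : List α),
    splitSum F ys = ∑ k ∈ Finset.range (ys.length + 1), F (ys.take k) (ys.drop k)
  | F, [] => by simp [splitSum]
  | F, y :: ys => by
    rw [List.length_cons, Finset.sum_range_succ', splitSum, splitSum_eq_sum_range _ ys]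
    simp only [List.take_succ_cons, List.drop_succ_cons, List.take_zero, List.drop_zero]
    exact add_comm _ _

/-- Shuffling into `a + b` places amounts to splitting the letters between the first `a` and the
last `b` places. -/
theorem shSum_add_index (e : α) (b : ℕ) : ∀ (a : ℕ) (f : List α → M) (ys : List α),
    shSum e (a + b) f ys =
      splitSum (fun p s => shSum e a (fun u => shSum e b (fun v => f (u ++ v)) s) p) ys
  | 0, f, [] => by simp [splitSum, shSum]
  | 0, f, y :: ys => by simp [splitSum, shSum, splitSum_zero]
  | a + 1, f, [] => by
    rw [Nat.add_right_comm, shSum, shSum_add_index e b a]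
    rfl
  | a + 1, f, y :: ys => by
    rw [Nat.add_right_comm, shSum, shSum_add_index e b a, shSum_add_index e b a]
    simp only [splitSum, shSum, splitSum_add]
    simp only [List.cons_append]
    abel

end Sums

/-! ### Multiadditive functions on lists -/

section MultiAdd

universe w

variable {V : ℕ → Type w} [∀ n, AddCommGroup (V n)] {T M : Type*} [AddCommGroup T]
  [AddCommGroup M]

/-- A function of lists that is additive in each entry. -/
def MultiAdd (f : List T → M) : Prop :=
  ∀ L y z L', f (L ++ (y + z) :: L') = f (L ++ y :: L') + f (L ++ z :: L')

/-- A function of lists of homogeneous elements that is additive in each entry. -/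
def HomogMultiAdd (f : List (Homog V) → M) : Prop :=
  ∀ L k (a b : V k) L',
    f (L ++ ⟨k, a + b⟩ :: L') = f (L ++ ⟨k, a⟩ :: L') + f (L ++ ⟨k, b⟩ :: L')

theorem MultiAdd.cons {f : List T → M} (hf : MultiAdd f) (x : T) :
    MultiAdd fun L => f (x :: L) := fun L => hf (x :: L)

/-- A multiadditive function as an additive map of one entry. -/
def MultiAdd.slot {f : List T → M} (hf : MultiAdd f) (L L' : List T) : T →+ M :=
  AddMonoidHom.mk' (fun y => f (L ++ y :: L')) fun y z => hf L y z L'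

theorem MultiAdd.zero {f : List T → M} (hf : MultiAdd f) (L L' : List T) :
    f (L ++ 0 :: L') = 0 := (hf.slot L L').map_zero

theorem MultiAdd.smul {f : List T → M} (hf : MultiAdd f) (u : ℤˣ) (L : List T) (x : T)
    (L' : List T) : f (L ++ u • x :: L') = u • f (L ++ x :: L') := by
  rw [Units.smul_def, Units.smul_def]
  exact (hf.slot L L').map_zsmul _ _

/-- The recursion always places a letter in front, which leaves a multiadditive function of the
rest. When the sum `y + z` is itself the first letter, additivity of `f` in its first entry is
needed as well. -/
theorem MultiAdd.shSum {e : T} : ∀ (n : ℕ) {f : List T → M}, MultiAdd f →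
    MultiAdd (shSum e n f)
  -- No places but at least one letter: all three sums vanish by definition.
  | 0, f, hf, [], y, z, L' => (add_zero 0).symm
  | 0, f, hf, _ :: _, y, z, L' => (add_zero 0).symm
  | n + 1, f, hf, [], y, z, L' => by
    have h1 := MultiAdd.shSum (e := e) n (hf.cons e) [] y z L'
    have h2 : SHGerstenhaber.shSum e n (fun w => f ((y + z) :: w)) L' =
        SHGerstenhaber.shSum e n (fun w => f (y :: w)) L' +
          SHGerstenhaber.shSum e n (fun w => f (z :: w)) L' := by
      rw [← shSum_add]
      congr 1
      funext w
      exact hf [] y z w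
    simp only [List.nil_append] at h1
    simp only [List.nil_append, SHGerstenhaber.shSum, h1, h2]
    abel
  | n + 1, f, hf, x :: L, y, z, L' => by
    have h1 := MultiAdd.shSum (e := e) n (hf.cons e) (x :: L) y z L'
    have h2 := MultiAdd.shSum (e := e) n (hf.cons x) L y z L'
    simp only [List.cons_append] at h1
    simp only [List.cons_append, SHGerstenhaber.shSum, h1, h2]
    abel

theorem HomogMultiAdd.cons {f : List (Homog V) → M} (hf : HomogMultiAdd f) (x : Homog V) :
    HomogMultiAdd fun L => f (x :: L) := fun L => hf (x :: L)

/-- The multiadditive extension of a function of lists of homogeneous elements. -/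
def ext : List (⨁ n, V n) → (List (Homog V) → M) → M
  | [], f => f []
  | z :: zs, f => open Classical in ∑ k ∈ DFinsupp.support z, ext zs fun L => f (⟨k, z k⟩ :: L)

theorem ext_add : ∀ (L : List (⨁ n, V n)) (f g : List (Homog V) → M),
    ext L (fun w => f w + g w) = ext L f + ext L g
  | [], _, _ => rfl
  | z :: zs, f, g => by simp only [ext, ext_add zs, Finset.sum_add_distrib]

/-- A sum over supports is not visibly additive, since the support of `y + z` is not determined by
those of `y` and `z`. As a value of `DirectSum.toAddMonoid` it is additive by construction. -/
theorem ext_cons {f : List (Homog V) → M} (hf : HomogMultiAdd f) (z : ⨁ n, V n)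
    (zs : List (⨁ n, V n)) :
    ext (z :: zs) f = DirectSum.toAddMonoid (fun k => AddMonoidHom.mk'
      (fun a : V k => ext zs fun L => f (⟨k, a⟩ :: L)) fun a b => by
        rw [← ext_add]; congr 1; funext L; exact hf [] k a b L) z := by
  classical
  refine Eq.trans ?_ (DFinsupp.sumAddHom_apply _ z).symm
  rw [ext, DFinsupp.sum]
  refine Finset.sum_congr (by congr!) fun k _ => rfl

theorem ext_multiAdd : ∀ {f : List (Homog V) → M}, HomogMultiAdd f →
    MultiAdd fun L => ext L f := by
  intro f hf L
  induction L generalizing f with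
  | nil => intro y z L'; simp only [List.nil_append, ext_cons hf, map_add]
  | cons x L ih =>
    intro y z L'
    simp only [List.cons_append, ext, ← Finset.sum_add_distrib]
    exact Finset.sum_congr rfl fun k _ => ih (hf.cons _) y z L'

theorem ext_tot : ∀ {f : List (Homog V) → M}, HomogMultiAdd f → ∀ L : List (Homog V),
    ext (L.map Homog.tot) f = f L
  | f, _, [] => rfl
  | f, hf, x :: L => by
    rw [List.map_cons, ext_cons hf]
    exact (DirectSum.toAddMonoid_of _ x.1 x.2).trans (ext_tot (hf.cons _) L)

/-- Multiadditive functions are determined by their values on homogeneous elements. -/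
theorem MultiAdd.eq_of_tot {f g : List (⨁ n, V n) → M} (hf : MultiAdd f) (hg : MultiAdd g)
    (h : ∀ L : List (Homog V), f (L.map Homog.tot) = g (L.map Homog.tot))
    (L : List (⨁ n, V n)) : f L = g L := by
  -- Entries are made homogeneous from left to right: `P` is the part already treated, and each slot
  -- is an additive map, determined by its values on homogeneous elements.
  suffices ∀ (Q : List (⨁ n, V n)) (P : List (Homog V)),
      f (P.map Homog.tot ++ Q) = g (P.map Homog.tot ++ Q) from this L []
  intro Q
  induction Q with
  | nil => intro P; simpa using h P
  | cons z Q ih =>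
    intro P
    refine DFunLike.congr_fun (f := hf.slot (P.map Homog.tot) Q)
      (g := hg.slot (P.map Homog.tot) Q) (DirectSum.addHom_ext fun k a => ?_) z
    have h1 := ih (P ++ [⟨k, a⟩])
    rw [List.map_append, List.append_assoc] at h1
    exact h1

/-- The bridge to `operations`: a product of supports splits off its first factor, which is the
recursion of `ext`. -/
theorem sum_piFinset_eq_ext : ∀ (L : List (⨁ n, V n)) (f : List (Homog V) → M),
    (open Classical in
      ∑ j ∈ Fintype.piFinset (fun p : Fin L.length => DFinsupp.support (L.get p)),
        f (List.ofFn fun p => ⟨j p, L.get p (j p)⟩)) = ext L f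
  | [], f => by simp [ext]
  | z :: zs, f => by
    classical
    have h := fun k => sum_piFinset_eq_ext zs fun L => f (⟨k, z k⟩ :: L)
    simp only [ext, ← h]
    rw [← Finset.sum_product']
    refine Finset.sum_nbij' (fun j => (j 0, fun p => j p.succ))
      (fun j => Fin.cons (α := fun _ => ℕ) j.1 j.2) ?_ ?_ ?_ ?_ ?_
    · intro j hj
      rw [Fintype.mem_piFinset] at hj
      rw [Finset.mem_product, Fintype.mem_piFinset]
      exact ⟨hj 0, fun p => hj p.succ⟩
    · rintro ⟨k, j⟩ hj
      rw [Finset.mem_product, Fintype.mem_piFinset] at hj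
      rw [Fintype.mem_piFinset]
      exact Fin.cases hj.1 hj.2
    · intro j _
      exact Fin.cons_self_tail j
    · rintro ⟨k, j⟩ _
      rfl
    · intro j _
      simp only [List.length_cons, List.ofFn_succ]
      rfl

end MultiAdd

/-! ### Braces as sums over shuffles -/

theorem blockSum_eq_sum : ∀ (i : ℕ) (m : Fin i → ℕ), blockSum i m = ∑ q, m q
  | 0, _ => rfl
  | i + 1, m => by rw [blockSum, blockSum_eq_sum i, Fin.sum_univ_castSucc]

theorem offset_zero {i : ℕ} (m : Fin (i + 1) → ℕ) : offset m 0 = 0 := rfl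

/-- `blockSum` peels off the last block whereas lists peel off the first; passing through a `Finset`
sum reconciles the two. -/
theorem offset_succ {i : ℕ} (m : Fin (i + 1) → ℕ) (q : Fin i) :
    offset m q.succ = m 0 + offset (fun t => m t.succ) q := by
  simp only [offset, blockSum_eq_sum]
  exact Fin.sum_univ_succ (fun t : Fin (q.1 + 1) => m ⟨t.1, t.2.trans (Nat.succ_lt_succ q.2)⟩)

section Words

universe w

variable {V : ℕ → Type w}

theorem redSum_nil : redSum ([] : List (Homog V)) = 0 := rfl

theorem redSum_cons (y : Homog V) (ys : List (Homog V)) :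
    redSum (y :: ys) = y.red + redSum ys := by simp [redSum]

theorem redSum_append (ys zs : List (Homog V)) : redSum (ys ++ zs) = redSum ys + redSum zs := by
  simp [redSum]

theorem redSum_eq (ys : List (Homog V)) :
    redSum ys = ((ys.map Sigma.fst).sum : ℕ) - (ys.length : ℤ) := by
  induction ys with
  | nil => rfl
  | cons y ys ih => rw [redSum_cons, ih, Homog.red]; push_cast [List.map_cons, List.sum_cons,
      List.length_cons]; ring

/-- The exponent `∑ |w_q| k_q` of the sign of a word, `k_q` being the number of inputs to the left
of those of the letter `w_q`. -/
def wordSign : List (Homog V) → ℤ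
  | [] => 0
  | w :: ws => redSum ws * w.1 + wordSign ws

/-- The same double sum over pairs of letters, grouped by the left letter instead of the right one:
the `w.1` inputs of the first letter lie to the left of every later letter. -/
theorem wordSign_ofFn : ∀ {i : ℕ} (F : Fin i → Homog V),
    wordSign (List.ofFn F) = ∑ q, (F q).red * (offset (fun q => (F q).1) q : ℤ)
  | 0, _ => rfl
  | i + 1, F => by
    rw [List.ofFn_succ, wordSign, wordSign_ofFn, Fin.sum_univ_succ, offset_zero]
    simp only [offset_succ, redSum, List.map_ofFn, List.sum_ofFn, Nat.cast_add, mul_add,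
      Finset.sum_add_distrib, Finset.sum_mul]
    simp

theorem wordSign_append (ws us : List (Homog V)) : wordSign (ws ++ us) =
    wordSign ws + wordSign us + redSum us * ((ws.map Sigma.fst).sum : ℕ) := by
  induction ws with
  | nil => simp [wordSign]
  | cons w ws ih =>
    simp only [List.cons_append, wordSign, ih, redSum_append, List.map_cons, List.sum_cons]
    push_cast
    ring

namespace Substitution

variable (O : Substitution V)

/-- The identity cochain as a homogeneous element. -/
def unit : Homog V := ⟨1, O.one⟩

/-- Identity cochains contribute nothing to a sign as letters; they only count as one input each for
the letters to their right. -/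
theorem red_unit : O.unit.red = 0 := rfl

/-- The multiplication as a homogeneous element. -/
def mult : Homog V := ⟨2, O.m⟩

theorem red_mult : O.mult.red = 1 := rfl

/-- The first `i` letters of a word. -/
abbrev entries (w : List (Homog V)) (i : ℕ) (q : Fin i) : Homog V := w.getD q.1 O.unit

theorem entries_ofFn {i : ℕ} (F : Fin i → Homog V) : O.entries (List.ofFn F) i = F := by
  funext q
  simp [entries]

variable {O} in
theorem word_apply {i r : ℕ} {s : Fin r → Fin i} (hs : Function.Injective s)
    (ys : Fin r → Homog V) (p : Fin r) : O.word s ys (s p) = ys p := by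
  have h : ∃ p', s p' = s p := ⟨p, rfl⟩
  rw [word, dif_pos h, hs h.choose_spec]

variable {O} in
theorem word_of_notMem {i r : ℕ} {s : Fin r → Fin i} (ys : Fin r → Homog V) {q : Fin i}
    (h : q ∉ Set.range s) : O.word s ys q = O.unit := dif_neg h

variable {O} in
/-- A word is determined by its letters at the places `s p` and elsewhere. -/
theorem word_eq {i r : ℕ} {s : Fin r → Fin i} (hs : Function.Injective s)
    {ys : Fin r → Homog V} {q : Fin i} {y : Homog V} (h1 : ∀ p, s p = q → ys p = y)
    (h2 : q ∉ Set.range s → O.unit = y) : O.word s ys q = y := by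
  by_cases h : q ∈ Set.range s
  · obtain ⟨p, rfl⟩ := h
    rw [word_apply hs, h1 p rfl]
  · rw [word_of_notMem ys h, h2 h]

theorem word_succ {i r : ℕ} {s : Fin r → Fin i} (hs : Function.Injective s)
    (ys : Fin r → Homog V) : List.ofFn (O.word (fun p => (s p).succ) ys) =
      O.unit :: List.ofFn (O.word s ys) := by
  have hs' : Function.Injective fun p => (s p).succ := (Fin.succ_injective _).comp hs
  rw [List.ofFn_succ]
  congr 1
  · exact word_of_notMem ys fun ⟨p, hp⟩ => Fin.succ_ne_zero _ hp
  · congr 1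
    funext q
    refine word_eq hs' (fun p hp => ?_) fun h => ?_
    · rw [← Fin.succ_injective _ hp, word_apply hs]
    · rw [word_of_notMem]
      exact fun ⟨p, hp⟩ => h ⟨p, congrArg Fin.succ hp⟩

theorem word_cons {i r : ℕ} {s : Fin r → Fin i} (hs : Function.Injective s)
    (ys : Fin (r + 1) → Homog V) :
    List.ofFn (O.word (Fin.cons 0 fun p => (s p).succ : Fin (r + 1) → Fin (i + 1)) ys) =
      ys 0 :: List.ofFn (O.word s fun p => ys p.succ) := by
  have hs' : Function.Injective (Fin.cons 0 fun p => (s p).succ : Fin (r + 1) → Fin (i + 1)) :=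
    Fin.cons_injective_iff.2 ⟨fun ⟨p, hp⟩ => Fin.succ_ne_zero _ hp,
      (Fin.succ_injective _).comp hs⟩
  rw [List.ofFn_succ]
  congr 1
  · exact word_apply hs' ys 0
  · congr 1
    funext q
    refine word_eq hs' (fun p => ?_) fun h => ?_
    · refine Fin.cases (fun hp => (Fin.succ_ne_zero _ hp.symm).elim) (fun p hp => ?_) p
      rw [← Fin.succ_injective _ hp, word_apply hs]
    · rw [word_of_notMem]
      exact fun ⟨p, hp⟩ => h ⟨p.succ, congrArg Fin.succ hp⟩

theorem strictMono_cons {i r : ℕ} {s : Fin r → Fin i} (hs : StrictMono s) :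
    StrictMono (Fin.cons 0 fun p => (s p).succ : Fin (r + 1) → Fin (i + 1)) := by
  intro p p'
  refine Fin.cases ?_ (fun p => ?_) p <;> refine Fin.cases ?_ (fun p' => ?_) p'
  · exact fun h => (lt_irrefl _ h).elim
  · exact fun _ => Fin.succ_pos _
  · exact fun h => (not_lt_bot h).elim
  · intro h
    exact Fin.succ_lt_succ_iff.2 (hs (Fin.succ_lt_succ_iff.1 h))

/-- A strictly monotone map into `Fin (i + 1)` avoids `0` or starts with `0`. -/
theorem filter_strictMono_succ (i r : ℕ) : (open Classical in
    (Finset.univ : Finset (Fin r → Fin (i + 1))).filter StrictMono =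
      ((Finset.univ : Finset (Fin r → Fin i)).filter StrictMono).image
          (fun s p => (s p).succ) ∪
        (Finset.univ : Finset (Fin r → Fin (i + 1))).filter
          fun s => StrictMono s ∧ ∃ p, s p = 0) := by
  classical
  ext s
  simp only [Finset.mem_filter, Finset.mem_univ, true_and, Finset.mem_union, Finset.mem_image]
  constructor
  · intro hs
    by_cases h : ∃ p, s p = 0
    · exact Or.inr ⟨hs, h⟩
    · push Not at h
      refine Or.inl ⟨fun p => (s p).pred (h p), fun p p' hp => ?_, ?_⟩
      · exact Fin.pred_lt_pred_iff.2 (hs hp)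
      · funext p
        exact Fin.succ_pred _ _
  · rintro (⟨s, hs, rfl⟩ | ⟨hs, -⟩)
    · exact fun p p' hp => Fin.succ_lt_succ_iff.2 (hs hp)
    · exact hs

theorem filter_strictMono_zero (i r : ℕ) : (open Classical in
    (Finset.univ : Finset (Fin (r + 1) → Fin (i + 1))).filter
        (fun s => StrictMono s ∧ ∃ p, s p = 0) =
      ((Finset.univ : Finset (Fin r → Fin i)).filter StrictMono).image
        fun s => (Fin.cons 0 fun p => (s p).succ : Fin (r + 1) → Fin (i + 1))) := by
  classical
  ext s
  simp only [Finset.mem_filter, Finset.mem_univ, true_and, Finset.mem_image]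
  constructor
  · rintro ⟨hs, p, hp⟩
    have h0 : s 0 = 0 := le_antisymm ((hs.monotone (Fin.zero_le p)).trans hp.le) (Fin.zero_le _)
    have h (p : Fin r) : s p.succ ≠ 0 := fun h =>
      (hs (Fin.succ_pos p)).ne (h0.trans h.symm)
    refine ⟨fun p => (s p.succ).pred (h p), fun p p' hp => ?_, ?_⟩
    · exact Fin.pred_lt_pred_iff.2 (hs (Fin.succ_lt_succ_iff.2 hp))
    · funext p
      refine Fin.cases h0.symm (fun p => ?_) p
      exact Fin.succ_pred _ (h p)
  · rintro ⟨s, hs, rfl⟩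
    exact ⟨strictMono_cons hs, 0, rfl⟩

/-- A strictly increasing choice of places either avoids the first place, which then carries the
identity, or puts the first letter there. These are the two summands in the recursion of `shSum`. -/
theorem sum_word_eq_shSum {M : Type*} [AddCommGroup M] : ∀ (i r : ℕ)
    (ys : Fin r → Homog V) (f : List (Homog V) → M), (open Classical in
    ∑ s ∈ (Finset.univ : Finset (Fin r → Fin i)).filter StrictMono,
      f (List.ofFn (O.word s ys))) = shSum O.unit i f (List.ofFn ys)
  | 0, 0, ys, f => by
    classical
    have h (s : Fin 0 → Fin 0) : StrictMono s := fun p => p.elim0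
    simp [shSum, h]
  | 0, r + 1, ys, f => by
    classical
    rw [List.ofFn_succ]
    exact Finset.sum_eq_zero fun s => (s 0).elim0
  | i + 1, r, ys, f => by
    classical
    have hinj : Function.Injective fun (s : Fin r → Fin i) p => (s p).succ := fun s t h =>
      funext fun p => Fin.succ_injective _ (congrFun h p)
    rw [filter_strictMono_succ, Finset.sum_union, Finset.sum_image hinj.injOn]
    · have h1 : ∑ s ∈ (Finset.univ : Finset (Fin r → Fin i)).filter StrictMono,
          f (List.ofFn (O.word (fun p => (s p).succ) ys)) =
          shSum O.unit i (fun w => f (O.unit :: w)) (List.ofFn ys) := by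
        rw [← sum_word_eq_shSum i r]
        refine Finset.sum_congr rfl fun s hs => ?_
        rw [word_succ _ (Finset.mem_filter.1 hs).2.injective]
      rw [h1]
      cases r with
      | zero => simp [shSum]
      | succ r =>
        have hinj' : Function.Injective fun (s : Fin r → Fin i) =>
            (Fin.cons 0 fun p => (s p).succ : Fin (r + 1) → Fin (i + 1)) := fun s t h =>
          funext fun p => Fin.succ_injective _ (congrFun h p.succ)
        rw [filter_strictMono_zero, Finset.sum_image hinj'.injOn, List.ofFn_succ, shSum]
        congr 1
        rw [← sum_word_eq_shSum i r]
        refine Finset.sum_congr rfl fun s hs => ?_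
        rw [word_cons _ (Finset.mem_filter.1 hs).2.injective]
    · rw [Finset.disjoint_left]
      intro s h1 h2
      obtain ⟨s, -, rfl⟩ := Finset.mem_image.1 h1
      obtain ⟨-, p, hp⟩ := (Finset.mem_filter.1 h2).2
      exact Fin.succ_ne_zero _ hp

variable [∀ n, AddCommGroup (V n)]

/-- The signed substitution of a word in a cochain. -/
def signedSub {i : ℕ} (x : V i) (w : List (Homog V)) : ⨁ n, V n :=
  if w.length = i then (wordSign w).negOnePow • O.sub x (O.entries w i) else 0

/-- The sign in `braceHom` sums over the inserted letters only, `wordSign` over all letters of the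
word. They agree because the extra letters are identities. -/
theorem braceHom_eq {i r : ℕ} (x : V i) (ys : Fin r → Homog V) :
    O.braceHom x ys = shSum O.unit i (O.signedSub x) (List.ofFn ys) := by
  classical
  rw [← sum_word_eq_shSum, braceHom]
  refine Finset.sum_congr (by congr!) fun s hs => ?_
  have hs : StrictMono s := by simpa using hs
  rw [signedSub, if_pos (List.length_ofFn), entries_ofFn, wordSign_ofFn]
  congr 2
  refine Fintype.sum_of_injective s hs.injective _ _ (fun q hq => ?_) fun p => ?_
  · rw [word_of_notMem ys hq, red_unit, zero_mul]
  · rw [word_apply hs.injective]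

end Substitution

end Words

/-! ### The brace identity -/

section Brace

universe w

variable {V : ℕ → Type w} [∀ n, AddCommGroup (V n)] {M : Type*} [AddCommGroup M]

theorem MultiAdd.homog {f : List (⨁ n, V n) → M} (hf : MultiAdd f) :
    HomogMultiAdd fun L : List (Homog V) => f (L.map Homog.tot) := fun L k a b L' => by
  have h : Homog.tot (⟨k, a + b⟩ : Homog V) = Homog.tot ⟨k, a⟩ + Homog.tot ⟨k, b⟩ :=
    map_add (DirectSum.of V k) a b
  simp only [List.map_append, List.map_cons, h]
  exact hf _ _ _ _

namespace Substitution

/-- The laws of a nonsymmetric operad with an associative multiplication, for cochains with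
simultaneous substitution. -/
structure IsOperad (O : Substitution V) : Prop where
  comp_add : ∀ {i : ℕ} (x y : V i) (g : Fin i → Homog V),
    O.comp (x + y) g = O.comp x g + O.comp y g
  sub_add_entry : ∀ {i : ℕ} (x : V i) (n : Fin i → ℕ) (y : ∀ q, V (n q)) (q : Fin i)
    (a b : V (n q)), O.sub x (fun t => ⟨n t, Function.update y q (a + b) t⟩) =
      O.sub x (fun t => ⟨n t, Function.update y q a t⟩) +
        O.sub x (fun t => ⟨n t, Function.update y q b t⟩)
  one_sub : ∀ y : Homog V, O.sub O.one (fun _ => y) = y.tot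
  sub_one : ∀ {i : ℕ} (x : V i), O.sub x (fun _ => ⟨1, O.one⟩) = DirectSum.of V i x
  sub_comp : ∀ {i : ℕ} (x : V i) (g : Fin i → Homog V)
    (h : Fin (blockSum i fun q => (g q).1) → Homog V),
    O.sub (O.comp x g) h = O.sub x fun q =>
      ⟨_, O.comp (g q).2 fun t => h (blockIdx (fun q => (g q).1) q t)⟩
  m_assoc : O.sub O.m ![⟨2, O.m⟩, ⟨1, O.one⟩] = O.sub O.m ![⟨1, O.one⟩, ⟨2, O.m⟩]

variable {O : Substitution V}

theorem IsOperad.sub_update_add (hO : O.IsOperad) {i : ℕ} (x : V i) (g : Fin i → Homog V)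
    (q : Fin i) (k : ℕ) (a b : V k) : O.sub x (Function.update g q ⟨k, a + b⟩) =
      O.sub x (Function.update g q ⟨k, a⟩) + O.sub x (Function.update g q ⟨k, b⟩) := by
  -- The degrees are separated from the cochains, with degree `k` already at place `q`. Then both
  -- summands live in `V (n q)` and `sub_add_entry` applies.
  obtain ⟨n, y, hn, hy⟩ : ∃ (n : Fin i → ℕ) (y : ∀ q, V (n q)), n q = k ∧
      ∀ t ≠ q, g t = ⟨n t, y t⟩ :=
    ⟨fun t => (Function.update g q ⟨k, 0⟩ t).1, fun t => (Function.update g q ⟨k, 0⟩ t).2,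
      by simp, fun t h => by simp [h]⟩
  subst hn
  have h (c : V (n q)) :
      Function.update g q ⟨n q, c⟩ = fun t => ⟨n t, Function.update y q c t⟩ := by
    funext t
    by_cases ht : t = q
    · subst ht
      simp
    · simp [ht, hy t ht]
  rw [h, h, h, hO.sub_add_entry]

/-- The sign depends only on the degrees of the letters, so changing a cochain within its degree
leaves the sign alone and additivity is that of the substitution. -/
theorem IsOperad.homogMultiAdd_signedSub (hO : O.IsOperad) {i : ℕ} (x : V i) :
    HomogMultiAdd (O.signedSub x) := by
  intro L k a b L'
  by_cases hi : (L ++ (⟨k, 0⟩ : Homog V) :: L').length = i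
  · have hlt : L.length < i := by simp at hi; omega
    have h (c : V k) : O.signedSub x (L ++ ⟨k, c⟩ :: L') =
        (wordSign (L ++ (⟨k, 0⟩ : Homog V) :: L')).negOnePow •
          O.sub x (Function.update (O.entries (L ++ ⟨k, 0⟩ :: L') i) ⟨L.length, hlt⟩ ⟨k, c⟩) := by
      rw [signedSub, if_pos (by simpa using hi)]
      refine congrArg₂ (fun (s : ℤ) z => s.negOnePow • z) ?_ (congrArg _ (funext fun q => ?_))
      · simp [wordSign_append, wordSign, redSum_cons, Homog.red]
      · by_cases hq : q.1 = L.length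
        · have : q = ⟨L.length, hlt⟩ := Fin.ext hq
          subst this
          simp
        · rw [Function.update_of_ne fun h => hq (congrArg Fin.val h)]
          rcases lt_or_gt_of_ne hq with h | h
          · simp [entries, List.getElem?_append_left h]
          · obtain ⟨t, ht⟩ := Nat.exists_eq_add_of_lt h
            have : q.1 - L.length = t + 1 := by omega
            simp [entries, List.getElem?_append_right h.le, this]
    rw [h, h, h, hO.sub_update_add, smul_add]
  · have h (c : V k) : O.signedSub x (L ++ ⟨k, c⟩ :: L') = 0 := if_neg (by simpa using hi)
    rw [h, h, h, add_zero]

theorem IsOperad.signedSub_add (hO : O.IsOperad) {i : ℕ} (x y : V i) (w : List (Homog V)) :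
    O.signedSub (x + y) w = O.signedSub x w + O.signedSub y w := by
  unfold signedSub
  split_ifs
  · rw [← smul_add, sub, hO.comp_add, map_add]
    rfl
  · rw [add_zero]

variable (O) in
/-- The brace of a homogeneous cochain, multiadditive in the list of arguments. -/
def braceOf {i : ℕ} (x : V i) : List (⨁ n, V n) → ⨁ n, V n :=
  shSum O.unit.tot i fun L => ext L (O.signedSub x)

theorem IsOperad.multiAdd_braceOf (hO : O.IsOperad) {i : ℕ} (x : V i) :
    MultiAdd (O.braceOf x) :=
  MultiAdd.shSum i (ext_multiAdd (hO.homogMultiAdd_signedSub x))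

theorem IsOperad.braceOf_tot (hO : O.IsOperad) {i : ℕ} (x : V i) (ys : List (Homog V)) :
    O.braceOf x (ys.map Homog.tot) = shSum O.unit i (O.signedSub x) ys := by
  rw [braceOf, shSum_map_list]
  simp only [ext_tot (hO.homogMultiAdd_signedSub x)]

theorem IsOperad.braceOf_add (hO : O.IsOperad) {i : ℕ} (x y : V i) (L : List (⨁ n, V n)) :
    O.braceOf (x + y) L = O.braceOf x L + O.braceOf y L := by
  unfold braceOf
  simp only [← shSum_add, ← ext_add, ← hO.signedSub_add]

theorem IsOperad.brace_eq_sum (hO : O.IsOperad) (z : ⨁ n, V n) (L : List (⨁ n, V n)) :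
    O.operations.brace z L = open Classical in ∑ i ∈ DFinsupp.support z, O.braceOf (z i) L := by
  classical
  refine Finset.sum_congr (by congr!) fun i _ => ?_
  have h : HomogMultiAdd (shSum O.unit i (O.signedSub (z i))) := by
    simpa only [hO.braceOf_tot] using (hO.multiAdd_braceOf (z i)).homog
  -- Both `ext` of the homogeneous brace and `braceOf` are multiadditive with the same values on
  -- homogeneous lists. The first is the one that appears in `operations`.
  rw [← MultiAdd.eq_of_tot (ext_multiAdd h) (hO.multiAdd_braceOf (z i))
    (fun L => by rw [ext_tot h, hO.braceOf_tot]) L, ← sum_piFinset_eq_ext]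
  refine Finset.sum_congr (by congr!) fun j _ => ?_
  rw [braceHom_eq]

/-- The brace with a fixed list of arguments as an additive map. -/
theorem IsOperad.brace_eq (hO : O.IsOperad) (z : ⨁ n, V n) (L : List (⨁ n, V n)) :
    O.operations.brace z L = DirectSum.toAddMonoid
      (fun i => AddMonoidHom.mk' (fun x : V i => O.braceOf x L) fun x y => hO.braceOf_add x y L)
      z := by
  classical
  rw [hO.brace_eq_sum]
  refine Eq.trans ?_ (DFinsupp.sumAddHom_apply _ z).symm
  rw [DFinsupp.sum]
  exact Finset.sum_congr (by congr!) fun k _ => rfl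

theorem IsOperad.brace_of (hO : O.IsOperad) {i : ℕ} (x : V i) (L : List (⨁ n, V n)) :
    O.operations.brace (DirectSum.of V i x) L = O.braceOf x L := by
  rw [hO.brace_eq, DirectSum.toAddMonoid_of]
  rfl

theorem IsOperad.brace_add_left (hO : O.IsOperad) (x y : ⨁ n, V n) (L : List (⨁ n, V n)) :
    O.operations.brace (x + y) L = O.operations.brace x L + O.operations.brace y L := by
  rw [hO.brace_eq, map_add, ← hO.brace_eq, ← hO.brace_eq]

theorem IsOperad.multiAdd_brace (hO : O.IsOperad) (x : ⨁ n, V n) :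
    MultiAdd (O.operations.brace x) := fun L y z L' => by
  simp only [hO.brace_eq_sum, ← Finset.sum_add_distrib]
  exact Finset.sum_congr rfl fun i _ => hO.multiAdd_braceOf _ L y z L'

theorem IsOperad.brace_tot (hO : O.IsOperad) (x : Homog V) (ys : List (Homog V)) :
    O.operations.brace x.tot (ys.map Homog.tot) = shSum O.unit x.1 (O.signedSub x.2) ys := by
  rw [Homog.tot, hO.brace_of, hO.braceOf_tot]

/-- Additivity in the first argument. -/
theorem IsOperad.brace_shSum (hO : O.IsOperad) {α : Type*} (e : α) (n : ℕ)
    (f : List α → ⨁ n, V n) (ys : List α) (L : List (⨁ n, V n)) :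
    O.operations.brace (shSum e n f ys) L =
      shSum e n (fun w => O.operations.brace (f w) L) ys :=
  (shSum_map (AddMonoidHom.mk' (fun z => O.operations.brace z L)
    fun x y => hO.brace_add_left x y L) e n f ys).symm

theorem IsOperad.brace_smul_left (hO : O.IsOperad) (u : ℤˣ) (z : ⨁ n, V n)
    (L : List (⨁ n, V n)) : O.operations.brace (u • z) L = u • O.operations.brace z L := by
  rw [Units.smul_def, Units.smul_def]
  exact (AddMonoidHom.mk' (fun z => O.operations.brace z L)
    fun x y => hO.brace_add_left x y L).map_zsmul _ _

/-- Together with `unit_brace_singleton` and `brace_eq_zero` this describes all braces of the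
identity cochain: it stays, becomes its single argument, or gives zero. -/
theorem IsOperad.unit_brace_nil (hO : O.IsOperad) :
    O.operations.brace O.unit.tot [] = O.unit.tot := by
  have h := hO.brace_tot O.unit []
  rw [List.map_nil] at h
  rw [h]
  change O.signedSub O.one [O.unit] = _
  rw [signedSub, if_pos List.length_singleton]
  have : O.entries [O.unit] 1 = fun _ => O.unit := by
    funext q
    rw [Subsingleton.elim q 0]
    rfl
  rw [this, hO.one_sub]
  simp [wordSign, redSum_nil]

theorem IsOperad.unit_brace_singleton (hO : O.IsOperad) (y : Homog V) :
    O.operations.brace O.unit.tot [y.tot] = y.tot := by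
  have h := hO.brace_tot O.unit [y]
  rw [List.map_singleton] at h
  rw [h]
  change 0 + O.signedSub O.one [y] = _
  rw [signedSub, if_pos List.length_singleton]
  have : O.entries [y] 1 = fun _ => y := by
    funext q
    rw [Subsingleton.elim q 0]
    rfl
  rw [this, hO.one_sub]
  simp [wordSign, redSum_nil]

theorem IsOperad.brace_eq_zero (hO : O.IsOperad) (x : Homog V) (L : List (⨁ n, V n))
    (h : x.1 < L.length) : O.operations.brace x.tot L = 0 := by
  rw [Homog.tot, hO.brace_of, braceOf, shSum_eq_zero_of_lt _ _ _ _ h]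

end Substitution

end Brace

/-! ### Iterated substitution: blocks of a word and their signs -/

section PreJacobi

universe w

variable {V : ℕ → Type w} {M : Type*} [AddCommGroup M]

theorem shSum_splitSum {α β : Type*} (e : α) (n : ℕ) (xs : List α) :
    ∀ (ys : List β) (G : List α → List β → List β → M),
    shSum e n (fun w => splitSum (G w) ys) xs =
      splitSum (fun a b => shSum e n (fun w => G w a b) xs) ys
  | [], _ => rfl
  | y :: ys, G => by simp only [splitSum, shSum_add, shSum_splitSum e n xs ys]

theorem sum_fst_cons (w : Homog V) (ws : List (Homog V)) :
    ((w :: ws).map Sigma.fst).sum = w.1 + (ws.map Sigma.fst).sum := by simp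

theorem negOnePow_congr {a b : ℤ} (c : ℤ) (h : a = b + 2 * c) : a.negOnePow = b.negOnePow :=
  (Int.negOnePow_eq_iff a b).2 ⟨c, by rw [h]; ring⟩

theorem smul_negOnePow_smul (a b : ℤ) (x : M) :
    a.negOnePow • b.negOnePow • x = (a + b).negOnePow • x := by
  rw [smul_smul, Int.negOnePow_add]

namespace Substitution

section Blocks

variable (O : Substitution V)

/-- The cochain `w(u₀, u₁, …)`. -/
def subHomog (w : Homog V) (u : List (Homog V)) : Homog V := ⟨_, O.comp w.2 (O.entries u w.1)⟩

/-- The substitution of the consecutive blocks of a word `u` in the letters of a word. -/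
def blocks : List (Homog V) → List (Homog V) → List (Homog V)
  | [], _ => []
  | w :: ws, u => O.subHomog w u :: blocks ws (u.drop w.1)

theorem length_blocks : ∀ ws u : List (Homog V), (O.blocks ws u).length = ws.length
  | [], _ => rfl
  | w :: ws, u => by simp [blocks, length_blocks ws]

theorem entries_append (u v : List (Homog V)) : O.entries (u ++ v) u.length =
    O.entries u u.length := by
  funext q
  simp [entries, List.getElem?_append_left q.2]

theorem subHomog_append (w : Homog V) (u v : List (Homog V)) (h : u.length = w.1) :
    O.subHomog w (u ++ v) = O.subHomog w u := by
  obtain ⟨k, x⟩ := w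
  change u.length = k at h
  subst h
  unfold subHomog
  rw [entries_append]

/-- Links the recursive cutting of `u` to `blockIdx`: dropping the earlier blocks one by one is
dropping `offset` letters at once. -/
theorem getD_blocks : ∀ (ws u : List (Homog V)) (q : Fin ws.length),
    (O.blocks ws u).getD q.1 O.unit =
      O.subHomog (ws.getD q.1 O.unit)
        (u.drop (offset (fun q : Fin ws.length => (ws.getD q.1 O.unit).1) q))
  | [], _, q => q.elim0
  | w :: ws, u, q => by
    refine Fin.cases ?_ (fun q => ?_) q
    · rfl
    · have h := getD_blocks ws (u.drop w.1) q
      rw [List.drop_drop] at h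
      have h2 := offset_succ (fun q : Fin (ws.length + 1) => ((w :: ws).getD q.1 O.unit).1) q
      refine h.trans ?_
      exact congrArg (fun k => O.subHomog (ws.getD q.1 O.unit) (u.drop k)) h2.symm

theorem fst_subHomog (w : Homog V) (u : List (Homog V)) (h : u.length = w.1) :
    (O.subHomog w u).1 = (u.map Sigma.fst).sum := by
  obtain ⟨k, x⟩ := w
  change u.length = k at h
  subst h
  refine (blockSum_eq_sum _ _).trans ?_
  rw [← List.sum_ofFn]
  congr 1
  refine List.ext_getElem (by simp) fun k h1 h2 => ?_
  simp [entries]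

/-- Substituting `w.1` letters changes the degree `w.1` to the sum of theirs, an increase by exactly
their total shifted degree. -/
theorem red_subHomog (w : Homog V) (u : List (Homog V)) (h : u.length = w.1) :
    (O.subHomog w u).red = w.red + redSum u := by
  rw [Homog.red, fst_subHomog O w u h, redSum_eq, h, Homog.red]
  ring

theorem redSum_blocks : ∀ ws u : List (Homog V), u.length = (ws.map Sigma.fst).sum →
    redSum (O.blocks ws u) = redSum ws + redSum u
  | [], u, h => by
    have : u = [] := List.length_eq_zero_iff.1 h
    subst this
    rfl
  | w :: ws, u, h => by
    rw [sum_fst_cons] at h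
    have h1 : (u.take w.1).length = w.1 := by simp; omega
    have h2 := subHomog_append O w (u.take w.1) (u.drop w.1) h1
    have h3 := redSum_append (u.take w.1) (u.drop w.1)
    rw [List.take_append_drop] at h2 h3
    rw [blocks, redSum_cons, h2, red_subHomog O _ _ h1, redSum_blocks ws _ (by simp; omega),
      redSum_cons, h3]
    ring

end Blocks

variable [∀ n, AddCommGroup (V n)] {O : Substitution V}

/-- Operad associativity, transported from families indexed by `Fin` to words. -/
theorem IsOperad.sub_comp_blocks (hO : O.IsOperad) {i : ℕ} (x : V i) (w u : List (Homog V))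
    (h : w.length = i) : O.sub (O.comp x (O.entries w i)) (O.entries u _) =
      O.sub x (O.entries (O.blocks w u) i) := by
  subst h
  rw [hO.sub_comp]
  congr 1
  funext q
  refine Eq.trans ?_ (O.getD_blocks w u q).symm
  unfold subHomog
  congr 2 <;>
  · funext t
    simp [entries, blockIdx]

/-- The signed substitution of the consecutive blocks of a word. -/
def blockSub (O : Substitution V) : (List (⨁ n, V n) → M) → List (Homog V) →
    List (Homog V) → M
  | f, [], [] => f []
  | _, [], _ :: _ => 0
  | f, w :: ws, ys => splitSum (fun p s => (redSum ws * redSum p).negOnePow •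
      blockSub O (fun L => f (O.operations.brace w.tot (p.map Homog.tot) :: L)) ws s) ys

theorem blockSub_add : ∀ (ws ys : List (Homog V)) (f g : List (⨁ n, V n) → M),
    O.blockSub (fun L => f L + g L) ws ys = O.blockSub f ws ys + O.blockSub g ws ys
  | [], [], _, _ => rfl
  | [], _ :: _, _, _ => (add_zero 0).symm
  | w :: ws, ys, f, g => by simp only [blockSub, blockSub_add ws, smul_add, splitSum_add]

/-- `blockSub` is additive in a letter put in front of the words. -/
def blockSubCons (f : List (⨁ n, V n) → M) (hf : MultiAdd f) (ws ys : List (Homog V)) :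
    (⨁ n, V n) →+ M :=
  AddMonoidHom.mk' (fun z => O.blockSub (fun L => f (z :: L)) ws ys) fun y z => by
    rw [← blockSub_add]
    congr 1
    funext L
    exact hf [] y z L

/-- A shuffle into the joined inputs of `ws` cuts `ys` into intervals and shuffles each into the
inputs of one letter, producing that letter's brace. The signs of `ws` and `u` differ from that of
the block word by the signs inside the separate braces and the Koszul signs in `blockSub`. The sign
of the block word is left for `f` to cancel. -/
theorem IsOperad.shSum_blocks (hO : O.IsOperad) : ∀ (ws ys : List (Homog V))
    (f : List (⨁ n, V n) → M), MultiAdd f →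
    shSum O.unit (ws.map Sigma.fst).sum (fun u =>
      (wordSign ws + wordSign u + wordSign (O.blocks ws u)).negOnePow •
        f ((O.blocks ws u).map Homog.tot)) ys = O.blockSub f ws ys
  | [], [], f, hf => by simp [shSum, blockSub, wordSign, blocks]
  | [], _ :: _, f, hf => rfl
  | w :: ws, ys, f, hf => by
    rw [sum_fst_cons, shSum_add_index, blockSub]
    congr 1
    funext p s
    have ih (z : ⨁ n, V n) := hO.shSum_blocks ws s (fun L => f (z :: L)) (hf.cons z)
    have h1 : shSum O.unit w.1 (fun u => O.blockSubCons f hf ws s (O.signedSub w.2 u)) p =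
        O.blockSub (fun L => f (O.operations.brace w.tot (p.map Homog.tot) :: L)) ws s := by
      rw [shSum_map, ← hO.brace_tot]
      rfl
    rw [← h1, ← shSum_smul]
    refine shSum_congr Homog.red _ _ _ _ _ fun u hu hδ => ?_
    have hu' : redSum u = redSum p := by simpa [red_unit, redSum] using hδ
    have h2 : O.signedSub w.2 u = (wordSign u).negOnePow • (O.subHomog w u).tot := if_pos hu
    have h3 : O.blockSubCons f hf ws s (O.signedSub w.2 u) = (wordSign u).negOnePow •
        O.blockSub (fun L => f ((O.subHomog w u).tot :: L)) ws s := by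
      rw [h2, Units.smul_def, map_zsmul, Units.smul_def]
      rfl
    rw [h3, ← ih, ← shSum_smul, ← shSum_smul]
    refine shSum_congr Homog.red _ _ _ _ _ fun v hv _ => ?_
    have h4 : O.blocks (w :: ws) (u ++ v) = O.subHomog w u :: O.blocks ws v := by
      rw [blocks, subHomog_append O _ _ _ hu, ← hu, List.drop_left]
    rw [h4, smul_negOnePow_smul, smul_negOnePow_smul, List.map_cons]
    congr 1
    simp only [wordSign, wordSign_append, fst_subHomog O w u hu, O.redSum_blocks ws v hv, ← hu']
    have h5 := redSum_eq u
    rw [hu] at h5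
    rw [h5]
    -- The degrees in `u` add up to `w.1 + |u|`. Thus `|ws| w.1` and the term pairing `v` with the
    -- inputs of `u` both occur twice, and only the Koszul exponent `|ws| |u|` survives.
    refine negOnePow_congr (redSum ws * w.1 + redSum v * ((u.map Sigma.fst).sum : ℕ)) ?_
    ring

theorem IsOperad.brace_signedSub (hO : O.IsOperad) {i : ℕ} (x : V i) (w ys : List (Homog V))
    (hw : w.length = i) : O.operations.brace (O.signedSub x w) (ys.map Homog.tot) =
      O.blockSub (fun L => ext L (O.signedSub x)) w ys := by
  have hx := hO.homogMultiAdd_signedSub x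
  have hd : blockSum i (fun q => (O.entries w i q).1) = (w.map Sigma.fst).sum := by
    subst hw
    exact O.fst_subHomog ⟨w.length, x⟩ w rfl
  rw [← hO.shSum_blocks w ys _ (ext_multiAdd hx), signedSub, if_pos hw, hO.brace_smul_left]
  have h := hO.brace_tot ⟨_, O.comp x (O.entries w i)⟩ ys
  refine (congrArg _ h).trans ?_
  rw [← shSum_smul, ← hd]
  refine shSum_congr Homog.red _ _ _ _ _ fun u hu _ => ?_
  rw [ext_tot hx, signedSub, if_pos hu, signedSub, if_pos ((O.length_blocks w u).trans hw),
    ← hO.sub_comp_blocks x w u hw, smul_negOnePow_smul, smul_negOnePow_smul]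
  congr 1
  -- The exponent of the block word occurs twice: once in the summand of `shSum_blocks`, once in
  -- `signedSub` of the block word.
  exact negOnePow_congr (-wordSign (O.blocks w u)) (by ring)

/-- An identity letter can receive an interval of length zero or one only. In the first case it
remains an identity, in the second it turns into a free argument `y`, moved past the letters `ws`.
-/
theorem IsOperad.blockSub_unit (hO : O.IsOperad) {f : List (⨁ n, V n) → M} (hf : MultiAdd f)
    (ws : List (Homog V)) : ∀ ys : List (Homog V), O.blockSub f (O.unit :: ws) ys =
      O.blockSub (fun L => f (O.unit.tot :: L)) ws ys + match ys with
        | [] => 0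
        | y :: ys => (redSum ws * y.red).negOnePow • O.blockSub (fun L => f (y.tot :: L)) ws ys
  | [] => by
    simp [blockSub, splitSum, hO.unit_brace_nil, redSum_nil]
  | y :: ys => by
    have h0 (p : List (Homog V)) (h : 1 < p.length) (s : List (Homog V)) :
        O.blockSub (fun L => f (O.operations.brace O.unit.tot (p.map Homog.tot) :: L)) ws s =
          0 := by
      rw [hO.brace_eq_zero O.unit _ (by simpa [unit] using h)]
      exact (O.blockSubCons f hf ws s).map_zero
    have h1 : ∀ ys : List (Homog V), splitSum (fun p s => (redSum ws * redSum (y :: p)).negOnePow •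
        O.blockSub (fun L => f (O.operations.brace O.unit.tot ((y :: p).map Homog.tot) :: L))
          ws s) ys = (redSum ws * y.red).negOnePow •
            O.blockSub (fun L => f (y.tot :: L)) ws ys := by
      have hy : redSum [y] = y.red := by simp [redSum]
      intro ys
      cases ys with
      | nil => simp [splitSum, hO.unit_brace_singleton, hy]
      | cons y' ys =>
        rw [splitSum, splitSum_congr _ (fun _ _ => 0), splitSum_zero, add_zero, hy,
          List.map_singleton, hO.unit_brace_singleton]
        intro a b _
        rw [h0 _ (by simp), smul_zero]
    rw [blockSub, splitSum, h1]
    simp [hO.unit_brace_nil, redSum_nil]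

end Substitution

end PreJacobi

/-! ### The sum of the pre-Jacobi identity and its proof -/

section PreJacobi

universe w

variable {V : ℕ → Type w} [∀ n, AddCommGroup (V n)] {M : Type*} [AddCommGroup M]

/-- One step of the recursion for `preJacobiSum`: `x` is the first of the elements to be inserted
and `ρ` is the total shifted degree of the others. -/
def preJacobiStep (S : Operations V) (x : Homog V) (ρ : ℤ)
    (R : (List (⨁ n, V n) → M) → List (Homog V) → M) :
    List (Homog V) → (List (⨁ n, V n) → M) → M
  | [], g => R (fun t => g (S.brace x.tot [] :: t)) []
  | y :: ys, g => splitSum (fun a b => (ρ * redSum a).negOnePow •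
        R (fun t => g (S.brace x.tot (a.map Homog.tot) :: t)) b) (y :: ys) +
      ((x.red + ρ) * y.red).negOnePow • preJacobiStep S x ρ R ys (fun t => g (y.tot :: t))

/-- The signed sum of `g` over the argument lists of the pre-Jacobi identity. -/
def preJacobiSum (S : Operations V) :
    List (Homog V) → (List (⨁ n, V n) → M) → List (Homog V) → M
  | [], g, ys => g (ys.map Homog.tot)
  | x :: xs, g, ys => preJacobiStep S x (redSum xs) (preJacobiSum S xs) ys g

theorem preJacobiSum_cons_nil (S : Operations V) (x : Homog V) (xs : List (Homog V))
    (g : List (⨁ n, V n) → M) : preJacobiSum S (x :: xs) g [] =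
      preJacobiSum S xs (fun t => g (S.brace x.tot [] :: t)) [] := rfl

theorem preJacobiSum_cons_cons (S : Operations V) (x : Homog V) (xs : List (Homog V))
    (g : List (⨁ n, V n) → M) (y : Homog V) (ys : List (Homog V)) :
    preJacobiSum S (x :: xs) g (y :: ys) =
      splitSum (fun a b => (redSum xs * redSum a).negOnePow •
        preJacobiSum S xs (fun t => g (S.brace x.tot (a.map Homog.tot) :: t)) b) (y :: ys) +
      ((x.red + redSum xs) * y.red).negOnePow •
        preJacobiSum S (x :: xs) (fun t => g (y.tot :: t)) ys := rfl

theorem preJacobiSum_add (S : Operations V) : ∀ (xs ys : List (Homog V))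
    (f g : List (⨁ n, V n) → M), preJacobiSum S xs (fun t => f t + g t) ys =
      preJacobiSum S xs f ys + preJacobiSum S xs g ys
  | [], _, _, _ => rfl
  | x :: xs, [], f, g => by simp only [preJacobiSum_cons_nil, preJacobiSum_add S xs]
  | x :: xs, y :: ys, f, g => by
    simp only [preJacobiSum_cons_cons, preJacobiSum_add S xs, preJacobiSum_add S (x :: xs) ys,
      smul_add, splitSum_add]
    abel

/-- The argument lists of the pre-Jacobi identity have at least as many entries as there are
elements to be inserted. -/
theorem preJacobiSum_eq_zero (S : Operations V) : ∀ (xs ys : List (Homog V))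
    (g : List (⨁ n, V n) → M), (∀ t, xs.length ≤ t.length → g t = 0) →
      preJacobiSum S xs g ys = 0
  | [], _, _, h => h _ (by simp)
  | x :: xs, [], g, h => by
    rw [preJacobiSum_cons_nil, preJacobiSum_eq_zero S xs]
    exact fun t ht => h _ (by simpa using ht)
  | x :: xs, y :: ys, g, h => by
    rw [preJacobiSum_cons_cons, preJacobiSum_eq_zero S (x :: xs) ys, smul_zero, add_zero,
      splitSum_congr _ (fun _ _ => 0), splitSum_zero]
    · intro a b _
      rw [preJacobiSum_eq_zero S xs, smul_zero]
      exact fun t ht => h _ (by simpa using ht)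
    · exact fun t ht => h _ (by simp at ht ⊢; omega)

/-- Splitting twice selects `i₁ ≤ j₁`. Either `a` is empty, so that the brace of `x` comes first, or
`y` precedes it; then `y` lies in both `a` and `p` and contributes `(|x| + ρ) |y|` to the exponent.
-/
theorem preJacobiStep_eq (S : Operations V) (x : Homog V) (ρ : ℤ)
    (R : (List (⨁ n, V n) → M) → List (Homog V) → M) :
    ∀ (ys : List (Homog V)) (g : List (⨁ n, V n) → M),
    splitSum (fun p s => splitSum (fun a b => (x.red * redSum a + ρ * redSum p).negOnePow •
      R (fun t => g (a.map Homog.tot ++ S.brace x.tot (b.map Homog.tot) :: t)) s) p) ys =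
    preJacobiStep S x ρ R ys g
  | [], g => by simp [splitSum, preJacobiStep, redSum_nil]
  | y :: ys, g => by
    rw [preJacobiStep, ← preJacobiStep_eq S x ρ R ys, ← splitSum_smul]
    simp only [splitSum, splitSum_add, ← splitSum_smul, smul_negOnePow_smul]
    simp only [redSum_cons, redSum_nil, mul_zero, zero_add, List.map_nil, List.nil_append,
      List.map_cons, List.cons_append]
    rw [add_assoc]
    congr 3
    funext p s
    congr 1
    funext a b
    congr 2
    ring

theorem sum_map_flatMap {α β : Type*} (l : List α) (F : α → List β) (g : β → M) :
    ((l.flatMap F).map g).sum = (l.map fun a => ((F a).map g).sum).sum := by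
  induction l with
  | nil => rfl
  | cons a l ih => simp [List.flatMap_cons, ih]

theorem sum_map_range (n : ℕ) (g : ℕ → M) :
    ((List.range n).map g).sum = ∑ k ∈ Finset.range n, g k := by
  rw [Finset.sum, Finset.range_val, Multiset.range, Multiset.map_coe, Multiset.sum_coe]

/-- Turns the explicit index ranges of the law into the recursive form on which the induction runs.
-/
theorem sum_preJacobiTerms (S : Operations V) : ∀ (xs ys : List (Homog V))
    (g : List (⨁ n, V n) → M),
    ((preJacobiTerms S xs ys).map fun t => t.1.negOnePow • g t.2).sum = preJacobiSum S xs g ys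
  | [], ys, g => by simp [preJacobiTerms, preJacobiSum]
  | x :: xs, ys, g => by
    rw [preJacobiTerms, preJacobiSum, ← preJacobiStep_eq, splitSum_eq_sum_range, sum_map_flatMap,
      sum_map_range]
    refine Finset.sum_congr rfl fun b hb => ?_
    have hb : b ≤ ys.length := Nat.lt_succ_iff.1 (Finset.mem_range.1 hb)
    rw [splitSum_eq_sum_range, sum_map_flatMap, sum_map_range, List.length_take,
      Nat.min_eq_left hb]
    refine Finset.sum_congr rfl fun a ha => ?_
    have ha : a ≤ b := Nat.lt_succ_iff.1 (Finset.mem_range.1 ha)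
    rw [List.map_map, List.take_take, Nat.min_eq_left ha,
      ← sum_preJacobiTerms S xs (ys.drop b), List.smul_sum, List.map_map]
    congr 1
    refine List.map_congr_left fun t _ => ?_
    simp only [Function.comp_apply, smul_negOnePow_smul]

namespace Substitution

variable {O : Substitution V}

/-- Induction on the number of places by the first letter of the inner word. If it is `x`, it takes
an initial interval of `ys`. If it is an identity, it either remains one, matching an identity
placed by the outer shuffle, or absorbs the first `y`, matching that `y` as a free argument. -/
theorem IsOperad.shSum_blockSub (hO : O.IsOperad) : ∀ (i : ℕ) (xs ys : List (Homog V))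
    (f : List (⨁ n, V n) → M), MultiAdd f →
    shSum O.unit i (fun w => O.blockSub f w ys) xs =
      preJacobiSum O.operations xs (shSum O.unit.tot i f) ys
  | 0, [], [], f, hf => rfl
  | 0, [], _ :: _, f, hf => rfl
  | 0, x :: xs, ys, f, hf => by
    -- With no places left the inner shuffle vanishes; so does the outer one, because every argument
    -- list still contains a brace of `x`.
    rw [preJacobiSum_eq_zero]
    · rfl
    · intro t ht
      cases t with
      | nil => simp at ht
      | cons => rfl
  | i + 1, [], [], f, hf => by
    have ih := hO.shSum_blockSub i [] [] _ (hf.cons O.unit.tot)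
    simp only [shSum, hO.blockSub_unit hf, add_zero]
    exact ih
  | i + 1, [], y :: ys, f, hf => by
    have ih := hO.shSum_blockSub i [] (y :: ys) _ (hf.cons O.unit.tot)
    have ih' := hO.shSum_blockSub i [] ys _ (hf.cons y.tot)
    simp only [shSum, hO.blockSub_unit hf, shSum_add, ih]
    refine congrArg _ (Eq.trans ?_ ih')
    refine shSum_congr Homog.red _ _ _ _ _ fun w _ hw => ?_
    have hw : redSum w = 0 := by simpa [red_unit, redSum] using hw
    rw [hw, zero_mul, Int.negOnePow_zero, one_smul]
  | i + 1, x :: xs, ys, f, hf => by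
    have ih := fun ys => hO.shSum_blockSub i (x :: xs) ys _ (hf.cons O.unit.tot)
    have ih1 := fun ys c => hO.shSum_blockSub i (x :: xs) ys _ (hf.cons c)
    have ih2 := fun ys c => hO.shSum_blockSub i xs ys _ (hf.cons c)
    have h1 : shSum O.unit i (fun w => O.blockSub f (x :: w) ys) xs =
        splitSum (fun a b => (redSum xs * redSum a).negOnePow • preJacobiSum O.operations xs
          (shSum O.unit.tot i fun L =>
            f (O.operations.brace x.tot (a.map Homog.tot) :: L)) b) ys := by
      simp only [blockSub]
      rw [shSum_splitSum]
      congr 1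
      funext a b
      rw [← ih2, ← shSum_smul]
      refine shSum_congr Homog.red _ _ _ _ _ fun w _ hw => ?_
      have hw : redSum w = redSum xs := by simpa [red_unit, redSum] using hw
      rw [hw]
    have h2 : shSum O.unit i (fun w => O.blockSub f (O.unit :: w) ys) (x :: xs) =
        preJacobiSum O.operations (x :: xs) (shSum O.unit.tot i fun L => f (O.unit.tot :: L)) ys +
          match ys with
          | [] => 0
          | y :: ys => ((x.red + redSum xs) * y.red).negOnePow • preJacobiSum O.operations
              (x :: xs) (shSum O.unit.tot i fun L => f (y.tot :: L)) ys := by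
      simp only [hO.blockSub_unit hf, shSum_add, ih]
      congr 1
      cases ys with
      | nil => exact shSum_zero _ _ _
      | cons y ys =>
        dsimp only
        rw [← ih1, ← shSum_smul]
        refine shSum_congr Homog.red _ _ _ _ _ fun w _ hw => ?_
        have hw : redSum w = x.red + redSum xs := by simpa [red_unit, redSum] using hw
        rw [hw]
    rw [shSum, h1, h2]
    cases ys with
    | nil =>
      simp only [preJacobiSum_cons_nil, shSum, preJacobiSum_add, splitSum, redSum_nil, mul_zero,
        Int.negOnePow_zero, one_smul, add_zero, List.map_nil]
    | cons y ys =>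
      simp only [preJacobiSum_cons_cons, shSum, preJacobiSum_add, smul_add, splitSum_add]
      abel

/-- The brace is expanded as a sum over words, `brace_signedSub` treats each word, and
`shSum_blockSub` resums. -/
theorem IsOperad.brace_brace (hO : O.IsOperad) (x : Homog V) (xs ys : List (Homog V)) :
    O.operations.brace (O.operations.brace x.tot (xs.map Homog.tot)) (ys.map Homog.tot) =
      preJacobiSum O.operations xs (O.operations.brace x.tot) ys := by
  have h := hO.shSum_blockSub x.1 xs ys _ (ext_multiAdd (hO.homogMultiAdd_signedSub x.2))
  have h2 : shSum O.unit.tot x.1 (fun L => ext L (O.signedSub x.2)) =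
      O.operations.brace x.tot := funext fun L => (hO.brace_of x.2 L).symm
  rw [h2] at h
  rw [← h, hO.brace_tot, hO.brace_shSum]
  refine shSum_congr Homog.red _ _ _ _ _ fun w hw _ => ?_
  exact hO.brace_signedSub x.2 w ys hw

end Substitution

end PreJacobi

/-! ### The differential and the product in terms of braces -/

section Laws

universe w

variable {V : ℕ → Type w} [∀ n, AddCommGroup (V n)] {M : Type*} [AddCommGroup M]

/-- The elements of the total group that are concentrated in degree `n`. -/
def concentrated (V : ℕ → Type w) [∀ n, AddCommGroup (V n)] (n : ℤ) :
    AddSubgroup (⨁ n, V n) where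
  carrier := {z | ∀ k : ℕ, (k : ℤ) ≠ n → z k = 0}
  zero_mem' := fun _ _ => rfl
  add_mem' {a b} ha hb k hk := by
    rw [DirectSum.add_apply, ha k hk, hb k hk, add_zero]
  neg_mem' {a} ha k hk := (DFinsupp.neg_apply a k).trans ((congrArg _ (ha k hk)).trans neg_zero)

theorem tot_mem (x : Homog V) {n : ℤ} (h : (x.1 : ℤ) = n) : x.tot ∈ concentrated V n :=
  fun _ hk => DirectSum.of_eq_of_ne _ _ _ fun h' => hk (h' ▸ h)

theorem smul_mem (u : ℤˣ) {n : ℤ} {z : ⨁ n, V n} (h : z ∈ concentrated V n) :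
    u • z ∈ concentrated V n := by
  rw [Units.smul_def]
  exact zsmul_mem h _

theorem eq_tot_of_mem {n : ℤ} {z : ⨁ n, V n} (h : z ∈ concentrated V n) :
    z = 0 ∨ ∃ x : Homog V, (x.1 : ℤ) = n ∧ z = x.tot := by
  by_cases hn : ∃ k : ℕ, (k : ℤ) = n
  · obtain ⟨k, hk⟩ := hn
    refine Or.inr ⟨⟨k, z k⟩, hk, ?_⟩
    refine DFinsupp.ext fun l => ?_
    by_cases hl : l = k
    · subst hl
      exact (DirectSum.of_eq_same _ _).symm
    · exact (h l fun h' => hl (by omega)).trans (DirectSum.of_eq_of_ne _ _ _ hl).symm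
  · push Not at hn
    exact Or.inl (DFinsupp.ext fun k => h k (hn k))

theorem negOnePow_neg_smul (n : ℤ) (x : M) : (n + 1).negOnePow • x = -(n.negOnePow • x) := by
  rw [Int.negOnePow_succ, Units.smul_def, Units.smul_def, Units.val_neg, neg_smul]

theorem shSum_singleton {α : Type*} (e y : α) : ∀ (n : ℕ) (f : List α → M),
    shSum e n f [y] = ∑ i : Fin n, f (List.ofFn (Function.update (fun _ => e) i y))
  | 0, _ => rfl
  | n + 1, f => by
    rw [shSum, shSum_singleton e y n, shSum_nil, Fin.sum_univ_succ, add_comm]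
    congr 1
    · rw [List.ofFn_succ, Function.update_self]
      congr 2
      rw [← List.ofFn_const]
      congr 1
    · refine Finset.sum_congr rfl fun i _ => ?_
      rw [List.ofFn_succ]
      congr 2
      congr 1
      funext q
      by_cases h : q = i
      · subst h
        simp
      · rw [Function.update_of_ne h, Function.update_of_ne fun h' => h (Fin.succ_injective _ h')]

namespace Substitution

variable (O : Substitution V)

theorem signedSub_ofFn {i : ℕ} (x : V i) (F : Fin i → Homog V) :
    O.signedSub x (List.ofFn F) =
      (∑ q, (F q).red * (offset (fun q => (F q).1) q : ℤ)).negOnePow • O.sub x F := by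
  rw [signedSub, if_pos List.length_ofFn, entries_ofFn, wordSign_ofFn]

theorem signedSub_pair (x : V 2) (a b : Homog V) :
    O.signedSub x [a, b] = (b.red * a.1).negOnePow • O.sub x ![a, b] := by
  have h : [a, b] = List.ofFn ![a, b] := by simp
  have h0 : wordSign [a, b] = b.red * a.1 := by simp [wordSign, redSum]
  rw [← h0, signedSub, if_pos (by rfl)]
  congr 2
  rw [h, entries_ofFn]

/-- The only letter with nonzero shifted degree is the multiplication, and to its left stand `q`
identities with one input each. -/
theorem signedSub_update_mult {i : ℕ} (x : V i) (q : Fin i) :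
    O.signedSub x (List.ofFn (Function.update (fun _ => O.unit) q O.mult)) =
      (q.1 : ℤ).negOnePow • O.sub x (Function.update (fun _ => O.unit) q O.mult) := by
  rw [signedSub_ofFn]
  congr 2
  rw [Finset.sum_eq_single q]
  · rw [Function.update_self, red_mult, one_mul, offset, blockSum_eq_sum]
    rw [Finset.sum_congr rfl (g := fun _ => 1)]
    · simp
    · intro t _
      rw [Function.update_of_ne]
      · rfl
      · exact fun h => t.2.ne (congrArg Fin.val h)
  · intro t _ ht
    rw [Function.update_of_ne ht, red_unit, zero_mul]
  · simp

variable {O}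

theorem IsOperad.mult_brace_singleton (hO : O.IsOperad) (x : Homog V) :
    O.operations.brace O.mult.tot [x.tot] =
      x.red.negOnePow • O.sub O.m ![O.unit, x] + O.sub O.m ![x, O.unit] := by
  refine (hO.brace_tot O.mult [x]).trans ?_
  change (0 + O.signedSub O.m [O.unit, x]) + O.signedSub O.m [x, O.unit] = _
  rw [signedSub_pair, signedSub_pair, zero_add, red_unit, zero_mul, Int.negOnePow_zero, one_smul]
  congr 3
  simp [unit]

theorem IsOperad.mult_brace_pair (hO : O.IsOperad) (x y : Homog V) :
    O.operations.brace O.mult.tot [x.tot, y.tot] =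
      (y.red * x.1).negOnePow • O.sub O.m ![x, y] := by
  refine (hO.brace_tot O.mult [x, y]).trans ?_
  rw [← signedSub_pair]
  exact shSum_self O.unit (O.signedSub O.m) [x, y]

theorem IsOperad.brace_mult (hO : O.IsOperad) (x : Homog V) :
    O.operations.brace x.tot [O.mult.tot] = ∑ q : Fin x.1, (q.1 : ℤ).negOnePow •
      O.sub x.2 (Function.update (fun _ => O.unit) q O.mult) := by
  refine (hO.brace_tot x [O.mult]).trans ?_
  rw [shSum_singleton]
  exact Finset.sum_congr rfl fun q _ => O.signedSub_update_mult x.2 q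

/-- The two insertions of the multiplication into itself carry opposite signs because its shifted
degree is `1`, and they agree by associativity. -/
theorem IsOperad.mult_brace_mult (hO : O.IsOperad) :
    O.operations.brace O.mult.tot [O.mult.tot] = 0 := by
  rw [hO.mult_brace_singleton, red_mult]
  have h : O.sub O.m ![O.mult, O.unit] = O.sub O.m ![O.unit, O.mult] := hO.m_assoc
  rw [h, Int.negOnePow_one, Units.smul_def, Units.val_neg, neg_smul, Units.val_one, one_smul,
    neg_add_cancel]

/-- The differential as an additive map. -/
def dAux (O : Substitution V) (hO : O.IsOperad) : (⨁ n, V n) →+ ⨁ n, V n :=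
  DirectSum.toAddMonoid fun k : ℕ => AddMonoidHom.mk'
    (fun c : V k => O.operations.brace O.mult.tot [DirectSum.of V k c] -
      ((k : ℤ) - 1).negOnePow • O.operations.brace (DirectSum.of V k c) [O.mult.tot])
    fun a b => by
      have h := hO.multiAdd_brace O.mult.tot [] (DirectSum.of V k a) (DirectSum.of V k b) []
      rw [List.nil_append, List.nil_append, List.nil_append] at h
      rw [map_add, h, hO.brace_add_left, smul_add]
      abel

theorem IsOperad.dHom_eq (hO : O.IsOperad) (x : Homog V) : O.dHom x.2 =
    O.operations.brace O.mult.tot [x.tot] -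
      x.red.negOnePow • O.operations.brace x.tot [O.mult.tot] := by
  rw [hO.mult_brace_singleton, hO.brace_mult, dHom, Finset.smul_sum]
  -- The index starts from `0` here, so the exponent `l + k - 1` with `l = q + 1` is `q + |x| + 1`:
  -- one sign more than in `x∘(m)`.
  have h : ∀ q : Fin x.1, (((q.1 : ℤ) + 1) + x.1 - 1).negOnePow •
      O.sub x.2 (Function.update (fun _ => ⟨1, O.one⟩) q ⟨2, O.m⟩) =
      -(x.red.negOnePow • (q.1 : ℤ).negOnePow •
        O.sub x.2 (Function.update (fun _ => O.unit) q O.mult)) := fun q => by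
    rw [smul_negOnePow_smul, ← negOnePow_neg_smul]
    congr 2
    rw [Homog.red]
    ring
  rw [Finset.sum_congr rfl fun q _ => h q, Finset.sum_neg_distrib]
  change x.red.negOnePow • O.sub O.m ![O.unit, x] + _ + O.sub O.m ![x, O.unit] = _
  abel

theorem IsOperad.d_eq (hO : O.IsOperad) (z : ⨁ n, V n) : O.operations.d z = O.dAux hO z := by
  classical
  refine Eq.trans ?_ (DFinsupp.sumAddHom_apply _ z).symm
  rw [DFinsupp.sum]
  exact Finset.sum_congr (by congr!) fun k _ => hO.dHom_eq ⟨k, z k⟩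

theorem IsOperad.d_tot (hO : O.IsOperad) (x : Homog V) : O.operations.d x.tot =
    O.operations.brace O.mult.tot [x.tot] -
      x.red.negOnePow • O.operations.brace x.tot [O.mult.tot] := by
  rw [hO.d_eq, dAux]
  exact DirectSum.toAddMonoid_of _ x.1 x.2

/-- The sign involution `x ↦ (-1)^(deg x) x`. -/
def signInv : (⨁ n, V n) →+ ⨁ n, V n :=
  DirectSum.toAddMonoid fun k =>
    (DistribSMul.toAddMonoidHom (⨁ n, V n) (k : ℤ).negOnePow).comp (DirectSum.of V k)

theorem signInv_tot (x : Homog V) : signInv x.tot = (x.1 : ℤ).negOnePow • x.tot :=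
  DirectSum.toAddMonoid_of _ x.1 x.2

/-- The brace carries the exponent `(j - 1) i`, and `ij = i + (j - 1) i`. -/
theorem IsOperad.mulHom_eq (hO : O.IsOperad) (x y : Homog V) : O.mulHom x.2 y.2 =
    (x.1 : ℤ).negOnePow • O.operations.brace O.mult.tot [x.tot, y.tot] := by
  rw [hO.mult_brace_pair, smul_negOnePow_smul, mulHom]
  congr 2
  rw [Homog.red]
  ring

/-- The sign `(-1)^(deg x)` makes sense only degreewise; absorbed in `signInv` it leaves a formula
on the total group whose biadditivity is that of the brace. -/
theorem IsOperad.mul_eq (hO : O.IsOperad) (x y : ⨁ n, V n) :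
    O.operations.mul x y = O.operations.brace O.mult.tot [signInv x, y] := by
  classical
  have hm := hO.multiAdd_brace O.mult.tot
  have hx : x = ∑ i ∈ DFinsupp.support x, DirectSum.of V i (x i) :=
    (DirectSum.sum_support_of x).symm
  have hy : y = ∑ i ∈ DFinsupp.support y, DirectSum.of V i (y i) :=
    (DirectSum.sum_support_of y).symm
  have h1 (z : ⨁ n, V n) : O.operations.brace O.mult.tot [z, y] =
      ∑ j ∈ DFinsupp.support y, O.operations.brace O.mult.tot [z, DirectSum.of V j (y j)] := by
    change hm.slot [z] [] y = _
    conv_lhs => rw [hy]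
    rw [map_sum]
    rfl
  have h2 (z : ⨁ n, V n) : O.operations.brace O.mult.tot [signInv x, z] =
      ∑ i ∈ DFinsupp.support x,
        O.operations.brace O.mult.tot [signInv (DirectSum.of V i (x i)), z] := by
    change hm.slot [] [z] (signInv x) = _
    conv_lhs => rw [hx]
    rw [map_sum, map_sum]
    rfl
  rw [h1, Finset.sum_congr rfl fun j _ => h2 _, Finset.sum_comm]
  refine Finset.sum_congr (by congr!) fun i _ => Finset.sum_congr (by congr!) fun j _ => ?_
  refine (hO.mulHom_eq ⟨i, x i⟩ ⟨j, y j⟩).trans ?_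
  have h3 := signInv_tot (V := V) ⟨i, x i⟩
  rw [Homog.tot] at h3
  rw [h3]
  exact (hm.smul _ [] _ _).symm

theorem IsOperad.d_add (hO : O.IsOperad) (x y : ⨁ n, V n) :
    O.operations.d (x + y) = O.operations.d x + O.operations.d y := by
  simp only [hO.d_eq, map_add]

theorem IsOperad.add_mul (hO : O.IsOperad) (x y z : ⨁ n, V n) :
    O.operations.mul (x + y) z = O.operations.mul x z + O.operations.mul y z := by
  simp only [hO.mul_eq, map_add]
  exact hO.multiAdd_brace O.mult.tot [] _ _ [z]

theorem IsOperad.mul_add (hO : O.IsOperad) (x y z : ⨁ n, V n) :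
    O.operations.mul x (y + z) = O.operations.mul x y + O.operations.mul x z := by
  simp only [hO.mul_eq]
  exact hO.multiAdd_brace O.mult.tot [signInv x] y z []

/-- Needed when `x` is itself a brace or a differential, known only to be concentrated in an integer
degree. If that degree is negative, `x` is zero. -/
theorem IsOperad.mul_of_mem (hO : O.IsOperad) {n : ℤ} {x : ⨁ n, V n}
    (hx : x ∈ concentrated V n) (y : ⨁ n, V n) : O.operations.mul x y =
      n.negOnePow • O.operations.brace O.mult.tot [x, y] := by
  have hm := hO.multiAdd_brace O.mult.tot
  rw [hO.mul_eq]
  rcases eq_tot_of_mem hx with rfl | ⟨x, rfl, rfl⟩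
  · have h := hm.zero [] [y]
    rw [List.nil_append] at h
    rw [map_zero, h, smul_zero]
  · rw [signInv_tot]
    exact hm.smul _ [] _ _

theorem IsOperad.d_of_mem (hO : O.IsOperad) {n : ℤ} {x : ⨁ n, V n}
    (hx : x ∈ concentrated V n) : O.operations.d x = O.operations.brace O.mult.tot [x] -
      (n - 1).negOnePow • O.operations.brace x [O.mult.tot] := by
  rcases eq_tot_of_mem hx with rfl | ⟨x, rfl, rfl⟩
  · have h := (hO.multiAdd_brace O.mult.tot).zero [] []
    rw [List.nil_append] at h
    rw [hO.d_eq, map_zero, h, hO.brace_eq, map_zero, smul_zero, sub_zero]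
  · exact hO.d_tot x

/-! ### Degrees -/

theorem IsOperad.brace_mem (hO : O.IsOperad) (x : Homog V) (ys : List (Homog V)) :
    O.operations.brace x.tot (ys.map Homog.tot) ∈ concentrated V (x.1 + redSum ys) := by
  rw [hO.brace_tot]
  refine shSum_mem Homog.red _ _ _ _ _ fun w hw hδ => ?_
  have hδ : redSum w = redSum ys := by simpa [red_unit, redSum] using hδ
  rw [signedSub, if_pos hw]
  have h := O.red_subHomog x w hw
  rw [Homog.red, Homog.red, hδ] at h
  exact smul_mem _ (tot_mem (O.subHomog x w) (by linarith))

theorem IsOperad.d_mem (hO : O.IsOperad) (x : Homog V) :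
    O.operations.d x.tot ∈ concentrated V (x.1 + 1) := by
  have h1 := hO.brace_mem O.mult [x]
  have h2 := hO.brace_mem x [O.mult]
  rw [redSum_cons, redSum_nil, add_zero] at h1 h2
  have h3 : (O.mult.1 : ℤ) + x.red = x.1 + 1 := by
    rw [Homog.red]
    change (2 : ℤ) + _ = _
    ring
  rw [h3] at h1
  rw [hO.d_tot]
  exact sub_mem h1 (smul_mem _ h2)

theorem IsOperad.mult_brace_pair_mem (hO : O.IsOperad) (x y : Homog V) :
    O.operations.brace O.mult.tot [x.tot, y.tot] ∈ concentrated V (x.1 + y.1) := by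
  have h1 := hO.brace_mem O.mult [x, y]
  have h3 : (O.mult.1 : ℤ) + redSum [x, y] = x.1 + y.1 := by
    simp only [redSum_cons, redSum_nil, Homog.red]
    change (2 : ℤ) + _ = _
    ring
  rwa [h3] at h1

theorem IsOperad.mul_mem (hO : O.IsOperad) (x y : Homog V) :
    O.operations.mul x.tot y.tot ∈ concentrated V (x.1 + y.1) := by
  rw [hO.mul_of_mem (tot_mem x rfl)]
  exact smul_mem _ (hO.mult_brace_pair_mem x y)

end Substitution

end Laws

/-! ### The laws of a strong homotopy Gerstenhaber algebra -/

section Laws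

universe w

variable {V : ℕ → Type w} [∀ n, AddCommGroup (V n)] {M : Type*} [AddCommGroup M]

theorem preJacobiSum_singleton_cons (S : Operations V) (x : Homog V)
    (g : List (⨁ n, V n) → M) (y : Homog V) (ys : List (Homog V)) :
    preJacobiSum S [x] g (y :: ys) =
      splitSum (fun a b => g (S.brace x.tot (a.map Homog.tot) :: b.map Homog.tot)) (y :: ys) +
        (x.red * y.red).negOnePow • preJacobiSum S [x] (fun t => g (y.tot :: t)) ys := by
  rw [preJacobiSum_cons_cons]
  simp [preJacobiSum, redSum_nil]

theorem preJacobiSum_singleton_of_two (S : Operations V) (x : Homog V)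
    {g : List (⨁ n, V n) → M} (hg : ∀ t, 2 ≤ t.length → g t = 0) (ys : List (Homog V)) :
    preJacobiSum S [x] g ys = g [S.brace x.tot (ys.map Homog.tot)] := by
  cases ys with
  | nil => rfl
  | cons y ys =>
    rw [preJacobiSum_singleton_cons, splitSum_eq_last, preJacobiSum_eq_zero S [x] ys, smul_zero,
      add_zero]
    · rfl
    · exact fun t ht => hg _ (by simpa using ht)
    · intro a b hb
      refine hg _ ?_
      have := List.length_pos_of_ne_nil hb
      simp
      omega

theorem splitSum_eq_last_two {α : Type*} : ∀ (F : List α → List α → M) (ys : List α)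
    (hys : ys ≠ []), (∀ a b, 2 ≤ b.length → F a b = 0) →
      splitSum F ys = F ys.dropLast [ys.getLast hys] + F ys []
  | _, [], h, _ => (h rfl).elim
  | F, [y], _, _ => rfl
  | F, y :: y' :: ys, _, h => by
    rw [splitSum, h _ _ (by simp), zero_add,
      splitSum_eq_last_two _ (y' :: ys) (by simp) fun a b hb => h _ _ hb]
    rfl

/-- Applied to braces of `m`, which accept at most two arguments: `x` takes everything, everything
but the last, or everything but the first. -/
theorem preJacobiSum_singleton_of_three (S : Operations V) (x : Homog V)
    {g : List (⨁ n, V n) → M} (hg : ∀ t, 3 ≤ t.length → g t = 0) (ys : List (Homog V))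
    (hys : ys ≠ []) : preJacobiSum S [x] g ys =
      g [S.brace x.tot (ys.dropLast.map Homog.tot), (ys.getLast hys).tot] +
        g [S.brace x.tot (ys.map Homog.tot)] +
        (x.red * (ys.head hys).red).negOnePow •
          g [(ys.head hys).tot, S.brace x.tot (ys.tail.map Homog.tot)] := by
  cases ys with
  | nil => exact (hys rfl).elim
  | cons y ys =>
    rw [preJacobiSum_singleton_cons, splitSum_eq_last_two _ _ hys,
      preJacobiSum_singleton_of_two S x fun t ht => hg _ (by simpa using ht)]
    · rfl
    · exact fun a b hb => hg _ (by simpa using hb)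

namespace Substitution

variable {O : Substitution V}

theorem IsOperad.mult_brace_eq_zero (hO : O.IsOperad) (L : List (⨁ n, V n)) (h : 3 ≤ L.length) :
    O.operations.brace O.mult.tot L = 0 :=
  hO.brace_eq_zero O.mult L h

theorem IsOperad.brace_nil (hO : O.IsOperad) (x : ⨁ n, V n) : O.operations.brace x [] = x := by
  rw [hO.brace_eq]
  refine DFunLike.congr_fun (g := AddMonoidHom.id _) (DirectSum.addHom_ext fun i x => ?_) x
  rw [DirectSum.toAddMonoid_of]
  refine (hO.braceOf_tot x []).trans ?_
  rw [shSum_nil]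
  have h : List.replicate i O.unit = List.ofFn fun _ : Fin i => O.unit := by simp
  rw [h, signedSub_ofFn, Finset.sum_eq_zero fun q _ => by rw [red_unit, zero_mul],
    Int.negOnePow_zero, one_smul]
  exact hO.sub_one x

theorem IsOperad.preJacobiSum_nil (hO : O.IsOperad) : ∀ (xs : List (Homog V))
    (g : List (⨁ n, V n) → M), preJacobiSum O.operations xs g [] = g (xs.map Homog.tot)
  | [], _ => rfl
  | x :: xs, g => by
    rw [preJacobiSum_cons_nil, hO.preJacobiSum_nil xs, hO.brace_nil]
    rfl

theorem IsOperad.brace_mult_brace (hO : O.IsOperad) (x : Homog V) (ys : List (Homog V))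
    (hys : ys ≠ []) :
    O.operations.brace (O.operations.brace O.mult.tot [x.tot]) (ys.map Homog.tot) =
      O.operations.brace O.mult.tot
          [O.operations.brace x.tot (ys.dropLast.map Homog.tot), (ys.getLast hys).tot] +
        O.operations.brace O.mult.tot [O.operations.brace x.tot (ys.map Homog.tot)] +
        (x.red * (ys.head hys).red).negOnePow • O.operations.brace O.mult.tot
          [(ys.head hys).tot, O.operations.brace x.tot (ys.tail.map Homog.tot)] :=
  (hO.brace_brace O.mult [x] ys).trans
    (preJacobiSum_singleton_of_three _ x hO.mult_brace_eq_zero ys hys)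

theorem IsOperad.brace_mult_pair (hO : O.IsOperad) (x x' : Homog V) (ys : List (Homog V)) :
    O.operations.brace (O.operations.brace O.mult.tot [x.tot, x'.tot]) (ys.map Homog.tot) =
      splitSum (fun a b => (x'.red * redSum a).negOnePow • O.operations.brace O.mult.tot
        [O.operations.brace x.tot (a.map Homog.tot),
          O.operations.brace x'.tot (b.map Homog.tot)]) ys := by
  have h2 (z : ⨁ n, V n) : ∀ t : List (⨁ n, V n), 2 ≤ t.length →
      O.operations.brace O.mult.tot (z :: t) = 0 := fun t ht =>
    hO.mult_brace_eq_zero _ (by simpa using ht)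
  have hx' : redSum [x'] = x'.red := by simp [redSum]
  refine (hO.brace_brace O.mult [x, x'] ys).trans ?_
  cases ys with
  | nil =>
    rw [preJacobiSum_cons_nil, preJacobiSum_singleton_of_two _ x' (h2 _)]
    simp [splitSum, redSum_nil]
  | cons y ys =>
    rw [preJacobiSum_cons_cons, preJacobiSum_eq_zero _ [x, x'] _ _ (h2 _), smul_zero, add_zero,
      hx']
    simp only [preJacobiSum_singleton_of_two _ x' (h2 _)]

/-- The expansion of `(m∘(m))∘(ys) = 0`. One, two and three arguments give the relations behind `d²
= 0`, the Leibniz rule and associativity. -/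
theorem IsOperad.mult_mult_relation (hO : O.IsOperad) (ys : List (Homog V)) (hys : ys ≠ []) :
    O.operations.brace O.mult.tot
          [O.operations.brace O.mult.tot (ys.dropLast.map Homog.tot), (ys.getLast hys).tot] +
        O.operations.brace O.mult.tot [O.operations.brace O.mult.tot (ys.map Homog.tot)] +
        (ys.head hys).red.negOnePow • O.operations.brace O.mult.tot
          [(ys.head hys).tot, O.operations.brace O.mult.tot (ys.tail.map Homog.tot)] = 0 := by
  have h := hO.brace_mult_brace O.mult ys hys
  rw [hO.mult_brace_mult, red_mult, one_mul, hO.brace_eq, map_zero] at h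
  exact h.symm

/-- The second `m` goes to the right of the first, to its left, or into it. The first two terms
cancel since `|m|` is odd, and the last contains `m∘(m) = 0`. -/
theorem IsOperad.brace_mult_brace_mult (hO : O.IsOperad) (x : Homog V) :
    O.operations.brace (O.operations.brace x.tot [O.mult.tot]) [O.mult.tot] = 0 := by
  have h1 := hO.brace_brace x [O.mult] [O.mult]
  rw [preJacobiSum_singleton_cons, hO.preJacobiSum_nil, red_mult, mul_one,
    Int.negOnePow_one] at h1
  simp only [List.map_cons, List.map_nil, splitSum, hO.brace_nil, hO.mult_brace_mult] at h1
  have h2 := (hO.multiAdd_brace x.tot).zero [] []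
  rw [List.nil_append] at h2
  rw [h1, h2, Units.smul_def, Units.val_neg, neg_smul, Units.val_one, one_smul, add_zero,
    add_neg_cancel]

theorem negOnePow_eq_or (n : ℤ) : n.negOnePow = 1 ∨ n.negOnePow = -1 := Int.units_eq_one_or _

theorem neg_one_units_smul (x : M) : (-1 : ℤˣ) • x = -x := by
  rw [Units.smul_def, Units.val_neg, neg_smul, Units.val_one, one_smul]

/-- Once `(m∘(x))∘(m)` is expanded, the terms `m∘(x∘(m))` cancel and `(x∘(m))∘(m)` vanishes; the
rest is `mult_mult_relation` for the single argument `x`. -/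
theorem IsOperad.d_d_tot (hO : O.IsOperad) (x : Homog V) :
    O.operations.d (O.operations.d x.tot) = 0 := by
  have hm := hO.multiAdd_brace O.mult.tot
  have h1 := hO.brace_mult_brace x [O.mult] (by simp)
  have h2 := hO.brace_mult_brace_mult x
  have h3 := hO.mult_mult_relation [x] (by simp)
  have h4 (y z : ⨁ n, V n) : O.operations.brace O.mult.tot [y - z] =
      O.operations.brace O.mult.tot [y] - O.operations.brace O.mult.tot [z] :=
    (hm.slot [] []).map_sub y z
  have h5 (u : ℤˣ) (z : ⨁ n, V n) : O.operations.brace O.mult.tot [u • z] =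
      u • O.operations.brace O.mult.tot [z] := hm.smul u [] z []
  have h6 (y z : ⨁ n, V n) (L) : O.operations.brace (y - z) L =
      O.operations.brace y L - O.operations.brace z L := by
    rw [hO.brace_eq, map_sub, ← hO.brace_eq, ← hO.brace_eq]
  simp only [List.map_cons, List.map_nil, List.dropLast_singleton, List.getLast_singleton,
    List.head_cons, List.tail_cons, red_mult, mul_one, hO.brace_nil] at h1 h3
  have hx : ((x.1 : ℤ) + 1 - 1).negOnePow = -x.red.negOnePow := by
    rw [← Int.negOnePow_succ, Homog.red]
    congr 1
    ring
  rw [hO.d_of_mem (hO.d_mem x), hx, hO.d_tot, h4, h5, h6, hO.brace_smul_left, h1, h2]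
  rcases negOnePow_eq_or x.red with h | h <;>
  · simp only [h, neg_one_units_smul, one_smul, neg_neg] at h3 ⊢
    refine Eq.trans ?_ h3
    abel

theorem IsOperad.d_d (hO : O.IsOperad) (x : ⨁ n, V n) :
    O.operations.d (O.operations.d x) = 0 := by
  rw [hO.d_eq, hO.d_eq]
  refine DFunLike.congr_fun (f := (O.dAux hO).comp (O.dAux hO)) (g := 0)
    (DirectSum.addHom_ext fun i x => ?_) x
  rw [AddMonoidHom.comp_apply, ← hO.d_eq, ← hO.d_eq]
  exact hO.d_d_tot ⟨i, x⟩

theorem IsOperad.mul_tot (hO : O.IsOperad) (x : Homog V) (y : ⨁ n, V n) :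
    O.operations.mul x.tot y =
      (x.1 : ℤ).negOnePow • O.operations.brace O.mult.tot [x.tot, y] :=
  hO.mul_of_mem (tot_mem x rfl) y

theorem IsOperad.mult_brace_smul (hO : O.IsOperad) (u : ℤˣ) (y z : ⨁ n, V n) :
    O.operations.brace O.mult.tot [y, u • z] = u • O.operations.brace O.mult.tot [y, z] :=
  (hO.multiAdd_brace O.mult.tot).smul u [y] z []

theorem IsOperad.mult_brace_smul_left (hO : O.IsOperad) (u : ℤˣ) (y z : ⨁ n, V n) :
    O.operations.brace O.mult.tot [u • y, z] = u • O.operations.brace O.mult.tot [y, z] :=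
  (hO.multiAdd_brace O.mult.tot).smul u [] y [z]

/-- In `mult_mult_relation` for three arguments the middle term contains `m∘(x,y,z) = 0`, so the two
bracketings agree up to a sign. -/
theorem IsOperad.mul_assoc_tot (hO : O.IsOperad) (x y z : Homog V) :
    O.operations.mul (O.operations.mul x.tot y.tot) z.tot =
      O.operations.mul x.tot (O.operations.mul y.tot z.tot) := by
  have h1 := hO.mult_mult_relation [x, y, z] (by simp)
  have h2 := hO.mult_brace_eq_zero [x.tot, y.tot, z.tot] (by simp)
  have h3 := (hO.multiAdd_brace O.mult.tot).zero [] []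
  rw [List.nil_append] at h3
  simp only [List.map_cons, List.map_nil, List.dropLast_cons_cons, List.dropLast_singleton,
    List.getLast_cons_cons, List.getLast_singleton, List.head_cons, List.tail_cons, h2, h3,
    add_zero] at h1
  rw [hO.mul_of_mem (hO.mul_mem x y), hO.mul_tot, hO.mul_tot, hO.mul_tot,
    hO.mult_brace_smul, hO.mult_brace_smul_left, eq_neg_of_add_eq_zero_left h1, Homog.red,
    Int.negOnePow_add, Int.negOnePow_sub, Int.negOnePow_one]
  rcases negOnePow_eq_or x.1 with h | h <;> rcases negOnePow_eq_or y.1 with h' | h' <;>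
  simp [h, h']

theorem IsOperad.mul_assoc (hO : O.IsOperad) (x y z : ⨁ n, V n) :
    O.operations.mul (O.operations.mul x y) z = O.operations.mul x (O.operations.mul y z) := by
  have h0 (y : ⨁ n, V n) : O.operations.mul 0 y = 0 :=
    (AddMonoidHom.mk' (fun x => O.operations.mul x y) fun _ _ => hO.add_mul _ _ _).map_zero
  have h0' (x : ⨁ n, V n) : O.operations.mul x 0 = 0 :=
    (AddMonoidHom.mk' (O.operations.mul x) fun _ _ => hO.mul_add _ _ _).map_zero
  induction x using DirectSum.induction_on with
  | zero => simp only [h0]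
  | add x x' hx hx' => simp only [hO.add_mul, hx, hx']
  | of i x =>
    induction y using DirectSum.induction_on with
    | zero => simp only [h0, h0']
    | add y y' hy hy' => simp only [hO.add_mul, hO.mul_add, hy, hy']
    | of j y =>
      induction z using DirectSum.induction_on with
      | zero => simp only [h0']
      | add z z' hz hz' => simp only [hO.mul_add, hz, hz']
      | of k z => exact hO.mul_assoc_tot ⟨i, x⟩ ⟨j, y⟩ ⟨k, z⟩

/-- The half `m∘(-)` of the differential is handled by `mult_mult_relation` for `x, y`, the half
`(-)∘(m)` by the expansion of `(m∘(x,y))∘(m)`. -/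
theorem IsOperad.d_mul (hO : O.IsOperad) (x y : Homog V) :
    O.operations.d (O.operations.mul x.tot y.tot) =
      O.operations.mul (O.operations.d x.tot) y.tot +
        (x.1 : ℤ).negOnePow • O.operations.mul x.tot (O.operations.d y.tot) := by
  have hm := hO.multiAdd_brace O.mult.tot
  have h1 := hO.mult_mult_relation [x, y] (by simp)
  have h2 := hO.brace_mult_pair x y [O.mult]
  have h5 (u : ℤˣ) (z : ⨁ n, V n) : O.operations.brace O.mult.tot [u • z] =
      u • O.operations.brace O.mult.tot [z] := hm.smul u [] z []
  have h6 (y z w : ⨁ n, V n) : O.operations.brace O.mult.tot [y - z, w] =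
      O.operations.brace O.mult.tot [y, w] - O.operations.brace O.mult.tot [z, w] :=
    (hm.slot [] [w]).map_sub y z
  have h7 (y z w : ⨁ n, V n) : O.operations.brace O.mult.tot [w, y - z] =
      O.operations.brace O.mult.tot [w, y] - O.operations.brace O.mult.tot [w, z] :=
    (hm.slot [w] []).map_sub y z
  simp only [List.map_cons, List.map_nil, List.dropLast_cons_cons, List.dropLast_singleton,
    List.getLast_cons_cons, List.getLast_singleton, List.head_cons, List.tail_cons, splitSum,
    redSum_nil, redSum_cons, red_mult, add_zero, mul_zero, mul_one, Int.negOnePow_zero, one_smul,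
    hO.brace_nil] at h1 h2
  rw [hO.d_of_mem (hO.mul_mem x y), hO.mul_of_mem (hO.d_mem x), hO.mul_tot, hO.mul_tot, hO.d_tot,
    hO.d_tot, h5, h6, h7, hO.mult_brace_smul, hO.mult_brace_smul_left, hO.brace_smul_left, h2]
  have h3 : O.operations.brace O.mult.tot [O.operations.brace O.mult.tot [x.tot, y.tot]] =
      -(O.operations.brace O.mult.tot [O.operations.brace O.mult.tot [x.tot], y.tot] +
        x.red.negOnePow • O.operations.brace O.mult.tot
          [x.tot, O.operations.brace O.mult.tot [y.tot]]) := by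
    rw [eq_neg_iff_add_eq_zero, ← h1]
    abel
  rw [h3]
  simp only [Homog.red, Int.negOnePow_add, Int.negOnePow_sub, Int.negOnePow_one]
  rcases negOnePow_eq_or x.1 with h | h <;> rcases negOnePow_eq_or y.1 with h' | h' <;>
  · simp [h, h']
    abel

theorem IsOperad.mul_brace (hO : O.IsOperad) (x x' : Homog V) (ys : List (Homog V)) :
    O.operations.brace (O.operations.mul x.tot x'.tot) (ys.map Homog.tot) =
      splitSum (fun a b => ((x'.1 : ℤ) * redSum a).negOnePow •
        O.operations.mul (O.operations.brace x.tot (a.map Homog.tot))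
          (O.operations.brace x'.tot (b.map Homog.tot))) ys := by
  rw [hO.mul_tot, hO.brace_smul_left, hO.brace_mult_pair, ← splitSum_smul]
  congr 1
  funext a b
  rw [hO.mul_of_mem (hO.brace_mem x a), smul_negOnePow_smul, smul_negOnePow_smul]
  congr 1
  refine negOnePow_congr (-redSum a) ?_
  rw [Homog.red]
  ring

/-- The terms `f(…, d y_k, …)` of the homotopy identity. -/
def dSum (S : Operations V) : List (Homog V) → (List (⨁ n, V n) → M) → M
  | [], _ => 0
  | y :: ys, f => f (S.d y.tot :: ys.map Homog.tot) +
      y.red.negOnePow • dSum S ys fun t => f (y.tot :: t)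

/-- The terms `f(…, y_k · y_{k+1}, …)` of the homotopy identity. -/
def mulSum (S : Operations V) : List (Homog V) → (List (⨁ n, V n) → M) → M
  | [], _ => 0
  | [_], _ => 0
  | y :: y' :: ys, f => y.red.negOnePow • f (S.mul y.tot y'.tot :: ys.map Homog.tot) +
      y.red.negOnePow • mulSum S (y' :: ys) fun t => f (y.tot :: t)

theorem dSum_eq (S : Operations V) : ∀ (ys : List (Homog V)) (f : List (⨁ n, V n) → M),
    dSum S ys f = ∑ k : Fin ys.length, (redSum (ys.take k.1)).negOnePow •
      f ((ys.take k.1).map Homog.tot ++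
        S.d (ys[k.1]'(by omega)).tot :: (ys.drop (k.1 + 1)).map Homog.tot)
  | [], _ => rfl
  | y :: ys, f => by
    refine Eq.trans ?_ (Fin.sum_univ_succ (n := ys.length) _).symm
    rw [dSum, dSum_eq S ys, Finset.smul_sum]
    congr 1
    · simp [redSum_nil]
    · refine Finset.sum_congr rfl fun k _ => ?_
      simp [redSum_cons, smul_negOnePow_smul]

theorem mulSum_eq (S : Operations V) : ∀ (ys : List (Homog V)) (f : List (⨁ n, V n) → M),
    mulSum S ys f = ∑ k : Fin (ys.length - 1), (redSum (ys.take (k.1 + 1))).negOnePow •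
      f ((ys.take k.1).map Homog.tot ++
        S.mul (ys[k.1]'(by omega)).tot (ys[k.1 + 1]'(by omega)).tot ::
          (ys.drop (k.1 + 2)).map Homog.tot)
  | [], _ => rfl
  | [_], _ => rfl
  | y :: y' :: ys, f => by
    refine Eq.trans ?_ (Fin.sum_univ_succ (n := ys.length) _).symm
    rw [mulSum, mulSum_eq S (y' :: ys), Finset.smul_sum]
    congr 1
    · simp [redSum_nil, redSum_cons]
    · refine Finset.sum_congr rfl fun k _ => ?_
      simp [redSum_cons, smul_negOnePow_smul]

theorem IsOperad.preJacobiSum_mult_cons (hO : O.IsOperad) (y : Homog V) (ys : List (Homog V))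
    {f : List (⨁ n, V n) → M} (hf : MultiAdd f) :
    preJacobiSum O.operations [O.mult] f (y :: ys) =
      f (O.mult.tot :: (y :: ys).map Homog.tot) +
        f (O.operations.brace O.mult.tot [y.tot] :: ys.map Homog.tot) + (match ys with
          | [] => 0
          | y' :: ys => f (O.operations.brace O.mult.tot [y.tot, y'.tot] ::
              ys.map Homog.tot)) +
        y.red.negOnePow • preJacobiSum O.operations [O.mult] (fun t => f (y.tot :: t)) ys := by
  rw [preJacobiSum_singleton_cons, red_mult, one_mul]
  congr 1
  cases ys with
  | nil => simp [splitSum, hO.brace_nil]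
  | cons y' ys =>
    simp only [splitSum, List.map_cons, List.map_nil, hO.brace_nil, add_assoc]
    congr 2
    cases ys with
    | nil => rfl
    | cons y'' ys =>
      rw [splitSum]
      refine Eq.trans (congrArg₂ (· + ·) rfl ?_) (add_zero _)
      rw [← splitSum_zero ys]
      refine splitSum_congr _ _ _ fun a b _ => ?_
      rw [hO.mult_brace_eq_zero _ (by simp)]
      exact hf.zero [] _

/-- The commutator of inserting `m` and inserting `ys`. Terms with `m` as a separate argument
cancel, `m∘(y_k)` and `y_k∘(m)` combine to `d y_k`, and `m∘(y_k, y_{k+1})` is the product up to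
sign. -/
theorem IsOperad.preJacobiSum_mult (hO : O.IsOperad) : ∀ (ys : List (Homog V))
    (f : List (⨁ n, V n) → M), MultiAdd f →
    preJacobiSum O.operations [O.mult] f ys -
        (redSum ys).negOnePow • preJacobiSum O.operations ys f [O.mult] =
      dSum O.operations ys f - mulSum O.operations ys f
  | [], f, _ => by
    rw [hO.preJacobiSum_nil]
    simp [preJacobiSum, dSum, mulSum, redSum_nil]
  | y :: ys, f, hf => by
    have ih := hO.preJacobiSum_mult ys _ (hf.cons y.tot)
    have h1 : preJacobiSum O.operations (y :: ys) f [O.mult] =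
        preJacobiSum O.operations ys (fun t => f (y.tot :: t)) [O.mult] +
          (redSum ys).negOnePow •
            f (O.operations.brace y.tot [O.mult.tot] :: ys.map Homog.tot) +
          (redSum (y :: ys)).negOnePow • f (O.mult.tot :: (y :: ys).map Homog.tot) := by
      rw [preJacobiSum_cons_cons, hO.preJacobiSum_nil]
      simp [splitSum, hO.preJacobiSum_nil, redSum_nil, redSum_cons, red_mult, hO.brace_nil]
    have h2 := hO.preJacobiSum_mult_cons y ys hf
    have h3 : f (O.operations.d y.tot :: ys.map Homog.tot) =
        f (O.operations.brace O.mult.tot [y.tot] :: ys.map Homog.tot) -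
          y.red.negOnePow • f (O.operations.brace y.tot [O.mult.tot] :: ys.map Homog.tot) := by
      rw [hO.d_tot]
      have h4 := (hf.slot [] (ys.map Homog.tot)).map_sub
      have h5 := fun u z => hf.smul u [] z (ys.map Homog.tot)
      exact (h4 _ _).trans (congrArg _ (h5 _ _))
    have ih' : preJacobiSum O.operations [O.mult] (fun t => f (y.tot :: t)) ys =
        dSum O.operations ys (fun t => f (y.tot :: t)) -
          mulSum O.operations ys (fun t => f (y.tot :: t)) + (redSum ys).negOnePow •
            preJacobiSum O.operations ys (fun t => f (y.tot :: t)) [O.mult] :=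
      sub_eq_iff_eq_add.1 ih
    rw [h1, h2, ih', dSum, h3]
    cases ys with
    | nil =>
      simp only [mulSum, redSum_cons, redSum_nil, add_zero]
      rcases negOnePow_eq_or y.red with h | h <;>
      · simp [h]
        abel
    | cons y' ys =>
      have h6 : y.red.negOnePow • f (O.operations.mul y.tot y'.tot :: ys.map Homog.tot) =
          -f (O.operations.brace O.mult.tot [y.tot, y'.tot] :: ys.map Homog.tot) := by
        have h7 := hf.smul (y.1 : ℤ).negOnePow [] (O.operations.brace O.mult.tot
          [y.tot, y'.tot]) (ys.map Homog.tot)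
        rw [List.nil_append, List.nil_append] at h7
        -- Degree and shifted degree have opposite parity, hence the minus sign in front of the sum
        -- of products.
        have h8 : (y.red + y.1).negOnePow = -1 :=
          (negOnePow_congr y.1 (by rw [Homog.red]; ring)).trans (by simp : (-1 : ℤ).negOnePow = -1)
        rw [hO.mul_tot, h7, smul_negOnePow_smul, h8, neg_one_units_smul]
      rw [mulSum, h6, redSum_cons y, Int.negOnePow_add]
      generalize (redSum (y' :: ys)) = r
      rcases negOnePow_eq_or y.red with h | h <;> rcases negOnePow_eq_or r with h' | h' <;>
      · simp [h, h']
        abel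

/-- In `d(x∘(ys)) - (d x)∘(ys)` the term `m∘(x∘(ys))` cancels. The rest of `(m∘(x))∘(ys)` gives the
two outer products, and `preJacobiSum_mult` accounts for the inner terms. -/
theorem IsOperad.d_brace (hO : O.IsOperad) (x : Homog V) (ys : List (Homog V)) (hys : ys ≠ []) :
    O.operations.d (O.operations.brace x.tot (ys.map Homog.tot)) -
        O.operations.brace (O.operations.d x.tot) (ys.map Homog.tot) -
        x.red.negOnePow • dSum O.operations ys (O.operations.brace x.tot) =
      ((x.1 : ℤ) * (ys.head hys).red).negOnePow • O.operations.mul (ys.head hys).tot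
          (O.operations.brace x.tot (ys.tail.map Homog.tot)) -
        x.red.negOnePow • mulSum O.operations ys (O.operations.brace x.tot) +
        (x.red + redSum ys.dropLast).negOnePow •
          O.operations.mul (O.operations.brace x.tot (ys.dropLast.map Homog.tot))
            (ys.getLast hys).tot := by
  have h1 := hO.preJacobiSum_mult ys _ (hO.multiAdd_brace x.tot)
  have h2 := hO.brace_brace x ys [O.mult]
  have h3 := hO.brace_brace x [O.mult] ys
  have h4 := hO.brace_mult_brace x ys hys
  simp only [List.map_cons, List.map_nil] at h2 h3
  rw [← h2, ← h3] at h1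
  have h5 (y z : ⨁ n, V n) (L) : O.operations.brace (y - z) L =
      O.operations.brace y L - O.operations.brace z L := by
    rw [hO.brace_eq, map_sub, ← hO.brace_eq, ← hO.brace_eq]
  rw [hO.d_of_mem (hO.brace_mem x ys), hO.d_tot, h5, hO.brace_smul_left, h4,
    hO.mul_of_mem (hO.brace_mem x ys.dropLast), hO.mul_tot, smul_negOnePow_smul,
    smul_negOnePow_smul]
  have e1 : ((x.1 : ℤ) + redSum ys - 1).negOnePow =
      x.red.negOnePow * (redSum ys).negOnePow := by
    rw [← Int.negOnePow_add, Homog.red]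
    congr 1
    ring
  have e2 : ((x.1 : ℤ) * (ys.head hys).red + (ys.head hys).1).negOnePow =
      -(x.red * (ys.head hys).red).negOnePow := by
    rw [← Int.negOnePow_succ]
    refine negOnePow_congr (ys.head hys).red ?_
    simp only [Homog.red]
    ring
  have e3 : (x.red + redSum ys.dropLast + (x.1 + redSum ys.dropLast)).negOnePow = -1 := by
    refine (negOnePow_congr (x.1 + redSum ys.dropLast) ?_).trans
      (by simp : (-1 : ℤ).negOnePow = -1)
    rw [Homog.red]
    ring
  rw [e1, e2, e3]
  rw [eq_add_of_sub_eq h1.symm]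
  generalize (x.red * (ys.head hys).red).negOnePow = u
  rcases negOnePow_eq_or x.red with h | h <;>
    rcases negOnePow_eq_or (redSum ys) with h' | h' <;>
    rcases Int.units_eq_one_or u with rfl | rfl <;>
  · simp [h, h']
    abel

/-- The Gerstenhaber–Voronov operations on the cochains of an operad with multiplication satisfy
the laws of a strong homotopy Gerstenhaber algebra. -/
theorem IsOperad.isSHGerstenhaberAlgebra (hO : O.IsOperad) :
    IsSHGerstenhaberAlgebra O.operations where
  d_add := hO.d_add
  add_mul := hO.add_mul
  mul_add := hO.mul_add
  brace_add_left := hO.brace_add_left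
  brace_add_right x := hO.multiAdd_brace x
  d_degree x n hn := hO.d_mem x n fun h => hn (by exact_mod_cast h)
  mul_degree x y n hn := hO.mul_mem x y n fun h => hn (by exact_mod_cast h)
  brace_degree x ys n hn := hO.brace_mem x ys n fun h => hn (by
    rw [redSum_eq] at h
    omega)
  d_d := hO.d_d
  mul_assoc := hO.mul_assoc
  d_mul := hO.d_mul
  brace_nil := hO.brace_nil
  brace_brace x xs ys := by rw [sum_preJacobiTerms, hO.brace_brace]
  mul_brace x x' ys := by rw [hO.mul_brace, splitSum_eq_sum_range]
  d_brace x ys hys := by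
    rw [← dSum_eq O.operations ys (O.operations.brace x.tot),
      ← mulSum_eq O.operations ys (O.operations.brace x.tot)]
    exact hO.d_brace x ys hys

end Substitution

end Laws

/-! ### Coherence for iterated tensor products -/

theorem blockSum_add (a : ℕ) : ∀ (b : ℕ) (m : Fin (a + b) → ℕ), blockSum (a + b) m =
    blockSum a (fun q => m (Fin.castAdd b q)) + blockSum b (fun q => m (Fin.natAdd a q))
  | 0, _ => rfl
  | b + 1, m => by
    have h := blockSum_add a b fun q => m q.castSucc
    exact (congrArg (· + m (Fin.last (a + b))) h).trans (Nat.add_assoc _ _ _)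

theorem offset_natAdd (a b : ℕ) (m : Fin (a + b) → ℕ) (q : Fin b) : offset m (Fin.natAdd a q) =
    blockSum a (fun q => m (Fin.castAdd b q)) + offset (fun q => m (Fin.natAdd a q)) q :=
  blockSum_add a q.1 fun t => m ⟨t.1, t.2.trans (Fin.natAdd a q).2⟩

/-- The sizes of the blocks of a two-step division add up. -/
theorem blockSum_blockSum : ∀ {i : ℕ} (n : Fin i → ℕ) (m : Fin (blockSum i n) → ℕ),
    blockSum i (fun p => blockSum (n p) fun t => m (blockIdx n p t)) =
      blockSum (blockSum i n) m
  | 0, _, _ => rfl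
  | i + 1, n, m => by
    refine Eq.trans ?_ (blockSum_add (blockSum i fun q => n q.castSucc) (n (Fin.last i)) m).symm
    rw [← blockSum_blockSum (fun q => n q.castSucc)]
    rfl

theorem offset_blockIdx : ∀ {i : ℕ} (n : Fin i → ℕ) (m : Fin (blockSum i n) → ℕ) (p : Fin i)
    (t : Fin (n p)), offset (fun p => blockSum (n p) fun t => m (blockIdx n p t)) p +
      offset (fun t => m (blockIdx n p t)) t = offset m (blockIdx n p t)
  | 0, _, _, p, _ => p.elim0
  | i + 1, n, m, p, t => by
    induction p using Fin.lastCases with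
    | last =>
      refine Eq.trans ?_ (offset_natAdd (blockSum i fun q => n q.castSucc) (n (Fin.last i)) m
        t).symm
      refine congrArg₂ (· + ·) ?_ rfl
      exact blockSum_blockSum (fun q => n q.castSucc)
        fun q => m (Fin.castAdd (n (Fin.last i)) q)
    | cast p =>
      exact offset_blockIdx (fun q => n q.castSucc)
        (fun q => m (Fin.castAdd (n (Fin.last i)) q)) p t

/-- Dividing in two steps reaches the same positions, but the total lengths agree only
propositionally; hence the `Fin.cast` here and the `eqToHom` in the coherence statements. -/
theorem cast_blockIdx {i : ℕ} (n : Fin i → ℕ) (m : Fin (blockSum i n) → ℕ) (p : Fin i)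
    (t : Fin (n p)) (s : Fin (m (blockIdx n p t))) :
    Fin.cast (blockSum_blockSum n m)
      (blockIdx (fun p => blockSum (n p) fun t => m (blockIdx n p t)) p
        (blockIdx (fun t => m (blockIdx n p t)) t s)) = blockIdx m (blockIdx n p t) s := by
  apply Fin.ext
  change _ + (_ + s.1) = _ + s.1
  rw [← add_assoc, offset_blockIdx]

section Coherence

universe v u

variable {C : Type u} [Category.{v} C] [MonoidalCategory C]

/-- The evaluation of formal tensor products. -/
abbrev evalFree : FreeMonoidalCategory C ⥤ C := FreeMonoidalCategory.project id

/-- A morphism is a coherence morphism between the values of two formal tensor products. -/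
def IsCoherence {X Y : C} (f : X ⟶ Y) (A B : FreeMonoidalCategory C) : Prop :=
  ∃ (hA : evalFree.obj A = X) (hB : evalFree.obj B = Y) (g : A ⟶ B),
    f = eqToHom hA.symm ≫ evalFree.map g ≫ eqToHom hB

namespace IsCoherence

variable {X Y Z W : C} {A B A' B' : FreeMonoidalCategory C}

/-- The coherence theorem. -/
theorem unique {f g : X ⟶ Y} (hf : IsCoherence f A B) (hg : IsCoherence g A B) : f = g := by
  obtain ⟨_, _, f', rfl⟩ := hf
  obtain ⟨_, _, g', rfl⟩ := hg
  -- Parallel morphisms of the free monoidal category are equal.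
  rw [Subsingleton.elim f' g']

theorem map (g : A ⟶ B) : IsCoherence (evalFree.map g) A B := ⟨rfl, rfl, g, by simp⟩

/-- An equality of values is not enough: the formal tensor products must agree too. This holds in
the applications because factors are labelled by the objects themselves. -/
theorem eqToHom (h : X = Y) (hAB : A = B) (hA : evalFree.obj A = X) :
    IsCoherence (eqToHom h) A B := by
  subst h hAB hA
  exact ⟨rfl, rfl, 𝟙 _, by simp⟩

theorem comp {f : X ⟶ Y} {g : Y ⟶ Z} (hf : IsCoherence f A B) (hg : IsCoherence g B A') :
    IsCoherence (f ≫ g) A A' := by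
  obtain ⟨rfl, rfl, f', rfl⟩ := hf
  obtain ⟨_, rfl, g', rfl⟩ := hg
  exact ⟨rfl, rfl, f' ≫ g', by simp⟩

theorem inv {f : X ≅ Y} (hf : IsCoherence f.hom A B) : IsCoherence f.inv B A := by
  obtain ⟨rfl, rfl, f', hf⟩ := hf
  refine ⟨rfl, rfl, CategoryTheory.inv f', ?_⟩
  have hf' : f = evalFree.mapIso (asIso f') := Iso.ext (by simp [hf])
  simp [hf']

theorem tensorHom {f : X ⟶ Y} {g : Z ⟶ W} (hf : IsCoherence f A B) (hg : IsCoherence g A' B') :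
    IsCoherence (f ⊗ₘ g) (A ⊗ A') (B ⊗ B') := by
  obtain ⟨rfl, rfl, f', rfl⟩ := hf
  obtain ⟨rfl, rfl, g', rfl⟩ := hg
  simp only [eqToHom_refl, Category.id_comp, Category.comp_id]
  -- The tensor product of formal morphisms is defined on representatives, and so is its evaluation.
  induction f' using Quotient.inductionOn with | _ f'
  induction g' using Quotient.inductionOn with | _ g'
  exact map (FreeMonoidalCategory.homMk f' ⊗ₘ FreeMonoidalCategory.homMk g')

theorem id (hA : evalFree.obj A = X) : IsCoherence (𝟙 X) A A := eqToHom rfl rfl hA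

theorem whiskerRight {f : X ⟶ Y} (hf : IsCoherence f A B) (hZ : evalFree.obj A' = Z) :
    IsCoherence (f ▷ Z) (A ⊗ A') (B ⊗ A') := by
  rw [← tensorHom_id]
  exact hf.tensorHom (id hZ)

theorem associator (hX : evalFree.obj A = X) (hY : evalFree.obj B = Y)
    (hZ : evalFree.obj A' = Z) :
    IsCoherence (α_ X Y Z).hom ((A ⊗ B) ⊗ A') (A ⊗ (B ⊗ A')) := by
  subst hX hY hZ
  exact map (α_ A B A').hom

theorem leftUnitor (hX : evalFree.obj A = X) : IsCoherence (λ_ X).hom (𝟙_ _ ⊗ A) A := by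
  subst hX
  exact map (λ_ A).hom

theorem rightUnitor (hX : evalFree.obj A = X) : IsCoherence (ρ_ X).hom (A ⊗ 𝟙_ _) A := by
  subst hX
  exact map (ρ_ A).hom

end IsCoherence

theorem evalFree_tensorObj : ∀ (n : ℕ) {X : Fin n → C} {A : Fin n → FreeMonoidalCategory C},
    (∀ q, evalFree.obj (A q) = X q) → evalFree.obj (tensorObj n A) = tensorObj n X
  | 0, _, _, _ => rfl
  | n + 1, _, _, h =>
    congrArg₂ (fun X Y : C => X ⊗ Y) (evalFree_tensorObj n fun q => h q.castSucc) (h _)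

theorem isCoherence_tensorMap : ∀ (n : ℕ) {X Y : Fin n → C}
    {A B : Fin n → FreeMonoidalCategory C} {f : ∀ q, X q ⟶ Y q},
    (∀ q, IsCoherence (f q) (A q) (B q)) →
      IsCoherence (tensorMap n f) (tensorObj n A) (tensorObj n B)
  | 0, _, _, _, _, _, _ => IsCoherence.id rfl
  | n + 1, _, _, _, _, _, h => (isCoherence_tensorMap n fun q => h q.castSucc).tensorHom (h _)

theorem isCoherence_appendIso (a : ℕ) : ∀ (b : ℕ) {X : Fin (a + b) → C}
    {A : Fin (a + b) → FreeMonoidalCategory C}, (∀ q, evalFree.obj (A q) = X q) →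
    IsCoherence (appendIso a b X).hom (tensorObj (a + b) A)
      (tensorObj a (fun q => A (Fin.castAdd b q)) ⊗ tensorObj b (fun q => A (Fin.natAdd a q)))
  | 0, _, _, h => (IsCoherence.rightUnitor (evalFree_tensorObj a h)).inv
  | b + 1, _, _, h =>
    ((isCoherence_appendIso a b fun q => h q.castSucc).whiskerRight (h _)).comp
      (IsCoherence.associator (evalFree_tensorObj a fun _ => h _)
        (evalFree_tensorObj b fun _ => h _) (h _))

theorem isCoherence_blockIso : ∀ {i : ℕ} (m : Fin i → ℕ) {X : Fin (blockSum i m) → C}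
    {A : Fin (blockSum i m) → FreeMonoidalCategory C}, (∀ q, evalFree.obj (A q) = X q) →
    IsCoherence (blockIso m X).hom (tensorObj (blockSum i m) A)
      (tensorObj i (fun q => tensorObj (m q) (fun t => A (blockIdx m q t))))
  | 0, _, _, _, _ => IsCoherence.id rfl
  | i + 1, m, _, _, h =>
    (isCoherence_appendIso (blockSum i fun q => m q.castSucc) (m (Fin.last i)) h).comp
      ((isCoherence_blockIso (fun q => m q.castSucc) fun q => h (Fin.castAdd _ q)).whiskerRight
        (evalFree_tensorObj _ fun _ => h _))

theorem isCoherence_unitIso : ∀ n : ℕ,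
    IsCoherence (unitIso C n).hom (tensorObj n fun _ => 𝟙_ (FreeMonoidalCategory C)) (𝟙_ _)
  | 0 => IsCoherence.id rfl
  | n + 1 => ((isCoherence_unitIso n).whiskerRight rfl).comp (IsCoherence.leftUnitor rfl)

theorem tensorObj_congr {n n' : ℕ} (h : n' = n) {X : Fin n → C} {X' : Fin n' → C}
    (hX : ∀ q, X' q = X (q.cast h)) : tensorObj n X = tensorObj n' X' := by
  subst h
  exact congrArg _ (funext fun q => (hX q).symm)

/-- Dividing into blocks twice. -/
theorem blockIso_blockIso {i : ℕ} (n : Fin i → ℕ) (m : Fin (blockSum i n) → ℕ)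
    (X : Fin (blockSum (blockSum i n) m) → C)
    (X' : Fin (blockSum i fun p => blockSum (n p) fun t => m (blockIdx n p t)) → C)
    (hX : ∀ q, X' q = X (q.cast (blockSum_blockSum n m))) :
    (blockIso m X).hom ≫
        (blockIso n fun q => tensorObj (m q) fun t => X (blockIdx m q t)).hom =
      eqToHom (tensorObj_congr (blockSum_blockSum n m) hX) ≫
        (blockIso (fun p => blockSum (n p) fun t => m (blockIdx n p t)) X').hom ≫
          tensorMap i (fun p => (blockIso (fun t => m (blockIdx n p t))
              fun q => X' (blockIdx _ p q)).hom ≫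
            tensorMap (n p) fun t => tensorMap (m (blockIdx n p t)) fun s =>
              eqToHom ((hX _).trans (congrArg X (cast_blockIdx n m p t s)))) := by
  -- Each factor becomes the generator named by its object, so factors identified by `hX` receive
  -- the same generator and the `eqToHom` are coherence morphisms.
  let A : Fin (blockSum (blockSum i n) m) → FreeMonoidalCategory C := fun q => .of (X q)
  let A' : Fin (blockSum i fun p => blockSum (n p) fun t => m (blockIdx n p t)) →
    FreeMonoidalCategory C := fun q => .of (X' q)
  have hA (q) : evalFree.obj (A q) = X q := rfl
  have hA' (q) : evalFree.obj (A' q) = X' q := rfl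
  have hAA' (q) : A' q = A (q.cast (blockSum_blockSum n m)) := congrArg _ (hX q)
  refine ((isCoherence_blockIso m hA).comp (isCoherence_blockIso n
    fun q => evalFree_tensorObj (m q) fun t => hA _)).unique
      ((IsCoherence.eqToHom _ (tensorObj_congr (blockSum_blockSum n m) hAA')
        (evalFree_tensorObj _ hA)).comp ((isCoherence_blockIso _ hA').comp
          (isCoherence_tensorMap i fun p => (isCoherence_blockIso _ fun q => hA' _).comp
            (isCoherence_tensorMap _ fun t => isCoherence_tensorMap _ fun s =>
              IsCoherence.eqToHom _ ?_ (hA' _)))))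
  exact (hAA' _).trans (congrArg A (cast_blockIdx n m p t s))

/-- A single block. -/
theorem blockIso_one (m : ℕ) (X : Fin (blockSum 1 fun _ => m) → C) (X' : Fin m → C)
    (h : m = blockSum 1 fun _ => m) (hX : ∀ q, X' q = X (q.cast h)) :
    (blockIso (fun _ : Fin 1 => m) X).hom ≫ (λ_ _).hom =
      eqToHom (tensorObj_congr h hX) ≫ tensorMap m fun t =>
        eqToHom ((hX t).trans (congrArg X (Fin.ext (Nat.zero_add t.1).symm) :
          _ = X (blockIdx (fun _ : Fin 1 => m) 0 t))) := by
  let A : Fin (blockSum 1 fun _ => m) → FreeMonoidalCategory C := fun q => .of (X q)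
  let A' : Fin m → FreeMonoidalCategory C := fun q => .of (X' q)
  have hA (q) : evalFree.obj (A q) = X q := rfl
  have hAA' (q) : A' q = A (q.cast h) := congrArg _ (hX q)
  refine ((isCoherence_blockIso _ hA).comp (IsCoherence.leftUnitor
    (evalFree_tensorObj m fun t => hA _))).unique
      ((IsCoherence.eqToHom _ (tensorObj_congr h hAA')
        (evalFree_tensorObj _ hA)).comp (isCoherence_tensorMap m fun t =>
          IsCoherence.eqToHom _ ?_ rfl))
  exact (hAA' _).trans (congrArg A (Fin.ext (Nat.zero_add t.1).symm))

theorem blockSum_const_one : ∀ i : ℕ, blockSum i (fun _ => 1) = i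
  | 0 => rfl
  | i + 1 => congrArg (· + 1) (blockSum_const_one i)

/-- Blocks of length one. -/
theorem blockIso_const_one (i : ℕ) (X : Fin (blockSum i fun _ => 1) → C) (X' : Fin i → C)
    (h : i = blockSum i fun _ => 1) (hX : ∀ q, X' q = X (q.cast h)) :
    (blockIso (fun _ : Fin i => 1) X).hom ≫ tensorMap i (fun q =>
        (λ_ (X (blockIdx (fun _ : Fin i => 1) q 0))).hom) =
      eqToHom (tensorObj_congr h hX) ≫ tensorMap i fun t =>
        eqToHom ((hX t).trans (congrArg X (Fin.ext (by simp [blockIdx, offset,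
          blockSum_const_one])) : _ = X (blockIdx (fun _ : Fin i => 1) t 0))) := by
  let A : Fin (blockSum i fun _ => 1) → FreeMonoidalCategory C := fun q => .of (X q)
  let A' : Fin i → FreeMonoidalCategory C := fun q => .of (X' q)
  have hA (q) : evalFree.obj (A q) = X q := rfl
  have hAA' (q) : A' q = A (q.cast h) := congrArg _ (hX q)
  refine ((isCoherence_blockIso _ hA).comp (isCoherence_tensorMap i fun q =>
    IsCoherence.leftUnitor rfl)).unique
      ((IsCoherence.eqToHom _ (tensorObj_congr h hAA')
        (evalFree_tensorObj _ hA)).comp (isCoherence_tensorMap i fun t =>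
          IsCoherence.eqToHom _ ?_ rfl))
  exact (hAA' _).trans (congrArg A (Fin.ext (by simp [blockIdx, offset, blockSum_const_one])))

/-- Both sides are values of morphisms between formal products of units, so coherence applies
without any generators. -/
theorem blockIso_unitIso {i : ℕ} (m : Fin i → ℕ) :
    (blockIso m fun _ => 𝟙_ C).hom ≫ tensorMap i (fun q => (unitIso C (m q)).hom) ≫
      (unitIso C i).hom = (unitIso C (blockSum i m)).hom :=
  ((isCoherence_blockIso m fun _ => rfl).comp ((isCoherence_tensorMap i fun q =>
    isCoherence_unitIso (m q)).comp (isCoherence_unitIso i))).unique (isCoherence_unitIso _)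

end Coherence

/-! ### Cochains form an operad with multiplication -/

section TensorMap

universe v u

variable {D : Type u} [Category.{v} D] [MonoidalCategory D]

theorem tensorMap_id : ∀ (n : ℕ) (X : Fin n → D), tensorMap n (fun q => 𝟙 (X q)) = 𝟙 _
  | 0, _ => rfl
  | n + 1, X => by
    rw [tensorMap, tensorMap_id n]
    exact id_tensorHom_id _ _

theorem tensorMap_update_add [Preadditive D] [MonoidalPreadditive D] : ∀ (n : ℕ) {X Y : Fin n → D}
    (f : ∀ q, X q ⟶ Y q) (q : Fin n) (a b : X q ⟶ Y q),
    tensorMap n (Function.update f q (a + b)) =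
      tensorMap n (Function.update f q a) + tensorMap n (Function.update f q b)
  | 0, _, _, _, q, _, _ => q.elim0
  | n + 1, X, Y, f, q, a, b => by
    induction q using Fin.lastCases with
    | last =>
      have h (c : X (Fin.last n) ⟶ Y (Fin.last n)) (q : Fin n) :
          Function.update f (Fin.last n) c q.castSucc = f q.castSucc :=
        Function.update_of_ne (Fin.castSucc_lt_last q).ne _ _
      simp only [tensorMap, h, Function.update_self]
      exact MonoidalPreadditive.tensor_add _ _ _
    | cast p =>
      have h (c : X p.castSucc ⟶ Y p.castSucc) :
          (fun q : Fin n => Function.update f p.castSucc c q.castSucc) =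
            Function.update (fun q : Fin n => f q.castSucc) p c := by
        funext q
        by_cases hq : q = p
        · subst hq
          simp
        · rw [Function.update_of_ne hq, Function.update_of_ne fun h =>
            hq (Fin.castSucc_injective n h)]
      have h' (c : X p.castSucc ⟶ Y p.castSucc) :
          Function.update f p.castSucc c (Fin.last n) = f (Fin.last n) :=
        Function.update_of_ne (Fin.castSucc_lt_last p).ne' _ _
      simp only [tensorMap, h, h', tensorMap_update_add n]
      exact MonoidalPreadditive.add_tensor _ _ _

theorem tensorHom_leftUnitor {P P' Q R R' S : D} (p : P ⟶ P') (q : P' ⟶ Q) (r : R ⟶ R')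
    (s : R' ⟶ S) : ((𝟙 (𝟙_ D) ⊗ₘ (p ≫ q)) ⊗ₘ (r ≫ s)) ≫ (λ_ Q).hom ▷ S =
      ((𝟙 (𝟙_ D) ⊗ₘ p) ⊗ₘ r) ≫ (λ_ P').hom ▷ R' ≫ (q ⊗ₘ s) := by
  rw [tensorHom_comp_whiskerRight, whiskerRight_comp_tensorHom, tensorHom_comp_tensorHom,
    id_tensorHom, id_tensorHom, leftUnitor_naturality, leftUnitor_naturality_assoc]

/-- The canonical isomorphism `X₀ ⊗ X₁ ⊗ X₂ ≅ (X₀ ⊗ X₁) ⊗ X₂`. -/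
def tripleIso₁ (X : Fin 3 → D) : tensorObj 3 X ≅ (X 0 ⊗ X 1) ⊗ X 2 :=
  blockIso ![2, 1] X ≪≫
    ((((Iso.refl (𝟙_ D)) ⊗ᵢ (whiskerRightIso (λ_ (X 0)) (X 1))) ⊗ᵢ (λ_ (X 2))) :
      (𝟙_ D ⊗ ((𝟙_ D ⊗ X 0) ⊗ X 1)) ⊗ (𝟙_ D ⊗ X 2) ≅ (𝟙_ D ⊗ (X 0 ⊗ X 1)) ⊗ X 2) ≪≫
    whiskerRightIso (λ_ (X 0 ⊗ X 1)) (X 2)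

/-- The canonical isomorphism `X₀ ⊗ X₁ ⊗ X₂ ≅ X₀ ⊗ (X₁ ⊗ X₂)`. -/
def tripleIso₂ (X : Fin 3 → D) : tensorObj 3 X ≅ X 0 ⊗ (X 1 ⊗ X 2) :=
  blockIso ![1, 2] X ≪≫
    ((((Iso.refl (𝟙_ D)) ⊗ᵢ (λ_ (X 0))) ⊗ᵢ (whiskerRightIso (λ_ (X 1)) (X 2))) :
      (𝟙_ D ⊗ (𝟙_ D ⊗ X 0)) ⊗ ((𝟙_ D ⊗ X 1) ⊗ X 2) ≅ (𝟙_ D ⊗ X 0) ⊗ (X 1 ⊗ X 2)) ≪≫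
    whiskerRightIso (λ_ (X 0)) (X 1 ⊗ X 2)

theorem tripleIso₁_hom_comp (X : Fin 3 → D) {Z : D} (f : (X 0 ⊗ X 1) ⊗ X 2 ⟶ Z) :
    (tripleIso₁ X).hom ≫ f = (blockIso ![2, 1] X).hom ≫
      (((𝟙 (𝟙_ D) ⊗ₘ (λ_ (X 0)).hom ▷ X 1) ⊗ₘ (λ_ (X 2)).hom) ≫
        (λ_ (X 0 ⊗ X 1)).hom ▷ X 2 ≫ f) :=
  (Category.assoc _ _ _).trans (congrArg _ (Category.assoc _ _ _))

theorem tripleIso₂_hom_comp (X : Fin 3 → D) {Z : D} (f : X 0 ⊗ (X 1 ⊗ X 2) ⟶ Z) :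
    (tripleIso₂ X).hom ≫ f = (blockIso ![1, 2] X).hom ≫
      (((𝟙 (𝟙_ D) ⊗ₘ (λ_ (X 0)).hom) ⊗ₘ (λ_ (X 1)).hom ▷ X 2) ≫
        (λ_ (X 0)).hom ▷ (X 1 ⊗ X 2) ≫ f) :=
  (Category.assoc _ _ _).trans (congrArg _ (Category.assoc _ _ _))

theorem tripleIso_associator (X : Fin 3 → D) :
    (tripleIso₁ X).hom ≫ (α_ _ _ _).hom = (tripleIso₂ X).hom := by
  let A : Fin 3 → FreeMonoidalCategory D := fun q => .of (X q)
  have hA (q) : evalFree.obj (A q) = X q := rfl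
  have h1 : IsCoherence (tripleIso₁ X).hom (tensorObj 3 A) ((A 0 ⊗ A 1) ⊗ A 2) :=
    (isCoherence_blockIso ![2, 1] hA).comp
      ((((IsCoherence.id rfl).tensorHom ((IsCoherence.leftUnitor rfl).whiskerRight rfl)).tensorHom
        (IsCoherence.leftUnitor rfl)).comp ((IsCoherence.leftUnitor rfl).whiskerRight rfl))
  have h2 : IsCoherence (tripleIso₂ X).hom (tensorObj 3 A) (A 0 ⊗ (A 1 ⊗ A 2)) :=
    (isCoherence_blockIso ![1, 2] hA).comp
      ((((IsCoherence.id rfl).tensorHom (IsCoherence.leftUnitor rfl)).tensorHom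
        ((IsCoherence.leftUnitor rfl).whiskerRight rfl)).comp
          ((IsCoherence.leftUnitor rfl).whiskerRight rfl))
  exact (h1.comp (IsCoherence.associator rfl rfl rfl)).unique h2

end TensorMap

/-! ### The operad of a monoid -/

section Monoid

universe v u

variable {D : Type u} [Category.{v} D] [MonoidalCategory D] [Preadditive D]

/-- Operad laws compare cochains whose numbers of inputs agree only propositionally. Inside the
direct sum an `eqToHom` on the source is enough to compare them. -/
theorem monoidCochain_of_eq {A : D} {k k' : ℕ} (h : k' = k) (c : MonoidCochain A k)
    (c' : MonoidCochain A k')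
    (H : c = eqToHom (tensorObj_congr h fun _ => rfl) ≫ c') :
    DirectSum.of (MonoidCochain A) k c = DirectSum.of (MonoidCochain A) k' c' := by
  subst h
  rw [H, eqToHom_refl, Category.id_comp]

theorem monoidSubstitution_one_sub (A : D) (M : MonObj A) (y : Homog (MonoidCochain A)) :
    (monoidSubstitution A M).sub (monoidSubstitution A M).one (fun _ => y) = y.tot := by
  have h : y.1 = blockSum 1 fun _ => y.1 := (Nat.zero_add _).symm
  refine monoidCochain_of_eq h _ _ ?_
  have h0 : (𝟙 (𝟙_ D) ⊗ₘ y.2) ≫ (λ_ A).hom = (λ_ _).hom ≫ y.2 := by simp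
  refine (congrArg ((blockIso (fun _ : Fin 1 => y.1) (fun _ => A)).hom ≫ ·) h0).trans ?_
  have h1 := blockIso_one y.1 (fun _ => A) (fun _ => A) h fun _ => rfl
  simp only [eqToHom_refl, tensorMap_id, Category.comp_id] at h1
  exact (Category.assoc _ _ _).symm.trans (congrArg (· ≫ y.2) h1)

theorem monoidSubstitution_sub_one (A : D) (M : MonObj A) {i : ℕ} (x : MonoidCochain A i) :
    (monoidSubstitution A M).sub x (fun _ => ⟨1, (monoidSubstitution A M).one⟩) =
      DirectSum.of (MonoidCochain A) i x := by
  have h : i = blockSum i fun _ => 1 := (blockSum_const_one i).symm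
  refine monoidCochain_of_eq h _ _ ?_
  change (blockIso (fun _ : Fin i => 1) (fun _ => A)).hom ≫ tensorMap i (fun _ => (λ_ A).hom) ≫
    x = _
  have h1 := blockIso_const_one i (fun _ => A) (fun _ => A) h fun _ => rfl
  simp only [eqToHom_refl, tensorMap_id, Category.comp_id] at h1
  rw [reassoc_of% h1]

theorem monoidSubstitution_sub_comp (A : D) (M : MonObj A) {i : ℕ} (x : MonoidCochain A i)
    (g : Fin i → Homog (MonoidCochain A))
    (h : Fin (blockSum i fun q => (g q).1) → Homog (MonoidCochain A)) :
    (monoidSubstitution A M).sub ((monoidSubstitution A M).comp x g) h =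
      (monoidSubstitution A M).sub x fun q => ⟨_, (monoidSubstitution A M).comp (g q).2
        fun t => h (blockIdx (fun q => (g q).1) q t)⟩ := by
  refine monoidCochain_of_eq (blockSum_blockSum (fun q => (g q).1) fun q => (h q).1) _ _ ?_
  have h1 := blockIso_blockIso (fun q => (g q).1) (fun q => (h q).1) (fun _ => A) (fun _ => A)
    fun _ => rfl
  have h2 := blockIso_naturality (fun q => (g q).1) (X := fun q => tensorObj (h q).1 fun _ => A)
    (Y := fun _ => A) (fun q => (h q).2)
  simp only [eqToHom_refl, tensorMap_id, Category.comp_id] at h1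
  change (blockIso (fun q => (h q).1) fun _ => A).hom ≫ tensorMap _ (fun q => (h q).2) ≫
      (blockIso (fun q => (g q).1) fun _ => A).hom ≫ tensorMap i (fun q => (g q).2) ≫ x =
    _ ≫ (blockIso _ fun _ => A).hom ≫ tensorMap i (fun q =>
      (blockIso (fun t => (h (blockIdx (fun q => (g q).1) q t)).1) fun _ => A).hom ≫
        tensorMap _ (fun t => (h (blockIdx (fun q => (g q).1) q t)).2) ≫ (g q).2) ≫ x
  rw [reassoc_of% h2, reassoc_of% h1, tensorMap_comp, tensorMap_comp]
  simp only [Category.assoc]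

theorem monoidSubstitution_isOperad [MonoidalPreadditive D] (A : D) (M : MonObj A) :
    (monoidSubstitution A M).IsOperad where
  comp_add x y g := by
    change _ ≫ _ ≫ (x + y) = _ ≫ _ ≫ x + _ ≫ _ ≫ y
    rw [Preadditive.comp_add, Preadditive.comp_add]
  sub_add_entry {i} x n y q a b := by
    have h : (blockIso n fun _ => A).hom ≫ tensorMap i (Function.update y q (a + b)) ≫ x =
        (blockIso n fun _ => A).hom ≫ tensorMap i (Function.update y q a) ≫ x +
          (blockIso n fun _ => A).hom ≫ tensorMap i (Function.update y q b) ≫ x := by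
      rw [tensorMap_update_add, Preadditive.add_comp, Preadditive.comp_add]
    exact (congrArg (DirectSum.of (MonoidCochain A) (blockSum i n)) h).trans (map_add _ _ _)
  one_sub := monoidSubstitution_one_sub A M
  sub_one := monoidSubstitution_sub_one A M
  sub_comp := monoidSubstitution_sub_comp A M
  m_assoc := by
    -- For the concrete degrees both block sums compute to `3`, so no transport is needed.
    refine congrArg (DirectSum.of (MonoidCochain A) 3) ?_
    have h1 := tensorHom_leftUnitor ((λ_ A).hom ▷ A) M.mul (λ_ A).hom (𝟙 A)
    have h2 := tensorHom_leftUnitor (λ_ A).hom (𝟙 A) ((λ_ A).hom ▷ A) M.mul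
    have h3 := tripleIso_associator fun _ : Fin 3 => A
    have h4 : (M.mul ⊗ₘ 𝟙 A) ≫ M.mul = (α_ A A A).hom ≫ (𝟙 A ⊗ₘ M.mul) ≫ M.mul := by
      rw [tensorHom_id, id_tensorHom, M.mul_assoc]
    rw [Category.comp_id] at h1 h2
    have h5 : (tripleIso₁ fun _ : Fin 3 => A).hom ≫ (M.mul ⊗ₘ 𝟙 A) ≫ M.mul =
        (tripleIso₂ fun _ : Fin 3 => A).hom ≫ (𝟙 A ⊗ₘ M.mul) ≫ M.mul := by
      rw [h4, reassoc_of% h3]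
    have h6 : ((𝟙 (𝟙_ D) ⊗ₘ ((λ_ A).hom ▷ A ≫ M.mul)) ⊗ₘ (λ_ A).hom) ≫ (λ_ A).hom ▷ A ≫ M.mul =
        ((𝟙 (𝟙_ D) ⊗ₘ (λ_ A).hom ▷ A) ⊗ₘ (λ_ A).hom) ≫ (λ_ (A ⊗ A)).hom ▷ A ≫
          (M.mul ⊗ₘ 𝟙 A) ≫ M.mul := by
      rw [reassoc_of% h1]
    have h7 : ((𝟙 (𝟙_ D) ⊗ₘ (λ_ A).hom) ⊗ₘ ((λ_ A).hom ▷ A ≫ M.mul)) ≫ (λ_ A).hom ▷ A ≫ M.mul =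
        ((𝟙 (𝟙_ D) ⊗ₘ (λ_ A).hom) ⊗ₘ (λ_ A).hom ▷ A) ≫ (λ_ A).hom ▷ (A ⊗ A) ≫
          (𝟙 A ⊗ₘ M.mul) ≫ M.mul := by
      rw [reassoc_of% h2]
    refine (congrArg ((blockIso ![2, 1] fun _ : Fin 3 => A).hom ≫ ·) h6).trans (Eq.trans ?_
      (congrArg ((blockIso ![1, 2] fun _ : Fin 3 => A).hom ≫ ·) h7).symm)
    exact (tripleIso₁_hom_comp _ _).symm.trans (h5.trans (tripleIso₂_hom_comp _ _))

end Monoid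

/-! ### The operad of a lax monoidal functor -/

section Category

universe v u

variable {C : Type u} [Category.{v} C]

/-- Cochains of `F` regroup the source by `blockIso` and the target by its inverse; this converts a
coherence identity for the former into one for the latter. -/
theorem comp_inv_inv_eq_eqToHom {X Y Z W : C} (a : X ≅ Y) (b : Y ≅ Z) (h : X = W) (t : W ⟶ Z)
    (H : a.hom ≫ b.hom = eqToHom h ≫ t) : t ≫ b.inv ≫ a.inv = eqToHom h.symm := by
  subst h
  rw [eqToHom_refl, Category.id_comp] at H
  rw [← H, eqToHom_refl]
  simp

theorem comp_comp_eq_of_eq {P Q R S T P' Q' : C} {b : P ⟶ Q} {l : Q ⟶ R} {l' : R ⟶ S}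
    {x : S ⟶ T} {e : P ⟶ P'} {t : P' ⟶ R} {x' : P' ⟶ Q'} {k : Q' ⟶ T} {W : C} (f : T ⟶ W)
    (h : b ≫ l = e ≫ t) (h' : (t ≫ l') ≫ x = x' ≫ k) :
    b ≫ (l ≫ l') ≫ x ≫ f = e ≫ x' ≫ k ≫ f := by
  rw [Category.assoc, reassoc_of% h, ← reassoc_of% h']

end Category

section FunctorOperad

universe v₁ u₁ v₂ u₂

variable {C : Type u₁} [Category.{v₁} C] [MonoidalCategory C]
  {D : Type u₂} [Category.{v₂} D] [MonoidalCategory D]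

/-- Two families that agree pointwise, rather than one family precomposed with a cast, let the block
components be compared by `eqToHom` and then moved by naturality. -/
theorem functorCochain_of_eq [Preadditive D] {F : C ⥤ D} {k k' : ℕ} (h : k' = k)
    (c : FunctorCochain F k) (c' : FunctorCochain F k')
    (H : ∀ (X : Fin k → C) (X' : Fin k' → C) (hX : ∀ q, X' q = X (q.cast h)),
      c.app X = eqToHom (tensorObj_congr h fun q => congrArg F.obj (hX q)) ≫ c'.app X' ≫
        F.map (eqToHom (tensorObj_congr h hX).symm)) :
    DirectSum.of (FunctorCochain F) k c = DirectSum.of (FunctorCochain F) k' c' := by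
  subst h
  congr 1
  ext X
  simpa using H X X fun _ => rfl

theorem leftUnitor_comp_map (F : C ⥤ D) {P : D} {T U : C} (y : P ⟶ F.obj T)
    (s : 𝟙_ C ⊗ T ⟶ U) : (𝟙 (𝟙_ D) ⊗ₘ y) ≫ ((λ_ _).hom ≫ F.map (λ_ T).inv) ≫ F.map s =
      (λ_ P).hom ≫ y ≫ F.map ((λ_ T).inv ≫ s) := by
  simp

/-- The tensor product of isomorphisms `f₀ ⊗ ⋯ ⊗ f_{n-1}`. -/
def tensorMapIso (n : ℕ) {X Y : Fin n → C} (f : ∀ q, X q ≅ Y q) :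
    tensorObj n X ≅ tensorObj n Y where
  hom := tensorMap n fun q => (f q).hom
  inv := tensorMap n fun q => (f q).inv
  hom_inv_id := by simp [← tensorMap_comp, tensorMap_id]
  inv_hom_id := by simp [← tensorMap_comp, tensorMap_id]

variable (F : C ⥤ D) [F.LaxMonoidal]

/-- Naturality of `μ` and of the unitors collects the structure morphisms in the middle, with source
coherence in front and target coherence inside `F.map`. -/
theorem tensorHom_comp_mu {P P' R R' : D} {A A' B B' U : C} (p : P ⟶ P') (q : P' ⟶ F.obj A)
    (a : A ⟶ A') (r : R ⟶ R') (s : R' ⟶ F.obj B) (b : B ⟶ B') (u : (𝟙_ C ⊗ A') ⊗ B' ⟶ U) :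
    ((𝟙 (𝟙_ D) ⊗ₘ (p ≫ q ≫ F.map a)) ⊗ₘ (r ≫ s ≫ F.map b)) ≫
        ((λ_ _).hom ▷ _ ≫ Functor.LaxMonoidal.μ F A' B' ≫ F.map ((λ_ A').inv ▷ B')) ≫ F.map u =
      ((𝟙 (𝟙_ D) ⊗ₘ p) ⊗ₘ r) ≫ (λ_ _).hom ▷ _ ≫ (q ⊗ₘ s) ≫ Functor.LaxMonoidal.μ F A B ≫
        F.map (((λ_ A).inv ▷ B ≫ ((𝟙 (𝟙_ C) ⊗ₘ a) ⊗ₘ b)) ≫ u) := by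
  have h1 := tensorHom_leftUnitor p (q ≫ F.map a) r (s ≫ F.map b)
  have h2 : (F.map a ⊗ₘ F.map b) ≫ Functor.LaxMonoidal.μ F A' B' =
      Functor.LaxMonoidal.μ F A B ≫ F.map (a ⊗ₘ b) := Functor.LaxMonoidal.μ_natural F a b
  have h3 : (λ_ A).inv ▷ B ≫ ((𝟙 (𝟙_ C) ⊗ₘ a) ⊗ₘ b) = (a ⊗ₘ b) ≫ (λ_ A').inv ▷ B' := by
    rw [tensorHom_comp_whiskerRight, whiskerRight_comp_tensorHom, id_tensorHom,
      leftUnitor_inv_naturality]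
  rw [← tensorHom_comp_tensorHom] at h1
  rw [h3]
  simp only [Category.assoc, F.map_comp]
  rw [reassoc_of% h1, reassoc_of% h2]

/-- After unitors are removed on both sides this is the associativity axiom of a lax monoidal
functor, with the associators absorbed by `tripleIso₁` and `tripleIso₂`. -/
theorem functorSubstitution_m_assoc (X : Fin 3 → C) :
    ((functorSubstitution F).comp (functorSubstitution F).m
        ![⟨2, (functorSubstitution F).m⟩, ⟨1, (functorSubstitution F).one⟩]).app X =
      ((functorSubstitution F).comp (functorSubstitution F).m
        ![⟨1, (functorSubstitution F).one⟩, ⟨2, (functorSubstitution F).m⟩]).app X := by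
  have h1 := tensorHom_comp_mu F ((λ_ (F.obj (X 0))).hom ▷ F.obj (X 1))
    (Functor.LaxMonoidal.μ F (X 0) (X 1)) ((λ_ (X 0)).inv ▷ X 1) (λ_ (F.obj (X 2))).hom (𝟙 _)
    (λ_ (X 2)).inv (blockIso ![2, 1] X).inv
  have h2 := tensorHom_comp_mu F (λ_ (F.obj (X 0))).hom (𝟙 _) (λ_ (X 0)).inv
    ((λ_ (F.obj (X 1))).hom ▷ F.obj (X 2)) (Functor.LaxMonoidal.μ F (X 1) (X 2))
    ((λ_ (X 1)).inv ▷ X 2) (blockIso ![1, 2] X).inv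
  rw [Category.id_comp] at h1 h2
  have hD := tripleIso_associator fun q => F.obj (X q)
  have hC : (α_ (X 0) (X 1) (X 2)).hom ≫ (tripleIso₂ X).inv = (tripleIso₁ X).inv := by
    rw [Iso.comp_inv_eq, ← tripleIso_associator, Iso.inv_hom_id_assoc]
  have h3 : (tripleIso₁ fun q => F.obj (X q)).hom ≫ (Functor.LaxMonoidal.μ F (X 0) (X 1) ⊗ₘ 𝟙 _) ≫
        Functor.LaxMonoidal.μ F (X 0 ⊗ X 1) (X 2) ≫ F.map (tripleIso₁ X).inv =
      (tripleIso₂ fun q => F.obj (X q)).hom ≫ (𝟙 _ ⊗ₘ Functor.LaxMonoidal.μ F (X 1) (X 2)) ≫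
        Functor.LaxMonoidal.μ F (X 0) (X 1 ⊗ X 2) ≫ F.map (tripleIso₂ X).inv := by
    rw [← hC, F.map_comp, tensorHom_id, id_tensorHom, Functor.LaxMonoidal.associativity_assoc,
      reassoc_of% hD]
  refine (congrArg ((blockIso ![2, 1] fun q => F.obj (X q)).hom ≫ ·) h1).trans (Eq.trans ?_
    (congrArg ((blockIso ![1, 2] fun q => F.obj (X q)).hom ≫ ·) h2).symm)
  exact (tripleIso₁_hom_comp _ _).symm.trans (h3.trans (tripleIso₂_hom_comp _ _))

variable [Preadditive D]

theorem functorSubstitution_one_sub (y : Homog (FunctorCochain F)) :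
    (functorSubstitution F).sub (functorSubstitution F).one (fun _ => y) = y.tot := by
  have h : y.1 = blockSum 1 fun _ => y.1 := (Nat.zero_add _).symm
  refine functorCochain_of_eq h _ _ fun X X' hX => ?_
  have h0 := blockIso_one y.1 (fun q => F.obj (X q)) (fun q => F.obj (X' q)) h
    fun q => congrArg F.obj (hX q)
  have h1 := comp_inv_inv_eq_eqToHom _ _ _ _ (blockIso_one y.1 X X' h hX)
  have h2 := y.2.naturality fun t => eqToHom ((hX t).trans
    (congrArg X (Fin.ext (Nat.zero_add t.1).symm) : _ = X (blockIdx (fun _ : Fin 1 => y.1) 0 t)))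
  simp only [eqToHom_map] at h2
  have h3 := leftUnitor_comp_map F (y.2.app fun t => X (blockIdx (fun _ : Fin 1 => y.1) 0 t))
    (blockIso (fun _ : Fin 1 => y.1) X).inv
  refine (congrArg ((blockIso (fun _ : Fin 1 => y.1) fun q => F.obj (X q)).hom ≫ ·) h3).trans ?_
  refine (Category.assoc _ _ _).symm.trans ((congrArg (· ≫ _) h0).trans ?_)
  rw [Category.assoc, reassoc_of% h2, ← F.map_comp]
  exact congrArg (fun f => _ ≫ _ ≫ F.map f) h1

theorem functorSubstitution_sub_one {i : ℕ} (x : FunctorCochain F i) :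
    (functorSubstitution F).sub x (fun _ => ⟨1, (functorSubstitution F).one⟩) =
      DirectSum.of (FunctorCochain F) i x := by
  have h : i = blockSum i fun _ => 1 := (blockSum_const_one i).symm
  refine functorCochain_of_eq h _ _ fun X X' hX => ?_
  have h0 := blockIso_const_one i (fun q => F.obj (X q)) (fun q => F.obj (X' q)) h
    fun q => congrArg F.obj (hX q)
  let b := tensorMapIso i fun q : Fin i => λ_ (X (blockIdx (fun _ => 1) q 0))
  have h1 := comp_inv_inv_eq_eqToHom _ b _ _ (blockIso_const_one i X X' h hX)
  have h2 := x.naturality fun q => eqToHom ((hX q).trans (congrArg X (Fin.ext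
    (by simp [blockIdx, offset, blockSum_const_one])) :
      _ = X (blockIdx (fun _ : Fin i => 1) q 0))) ≫ (λ_ _).inv
  simp only [F.map_comp, eqToHom_map] at h2
  rw [tensorMap_comp, tensorMap_comp] at h2
  have h3 := tensorMap_comp i (fun q => (λ_ (F.obj (X (blockIdx (fun _ : Fin i => 1) q 0)))).hom)
    fun q => F.map (λ_ (X (blockIdx (fun _ => 1) q 0))).inv
  refine (congrArg (fun z => (blockIso (fun _ : Fin i => 1) fun q => F.obj (X q)).hom ≫ z ≫ _)
    h3).trans ((comp_comp_eq_of_eq _ h0 h2).trans ?_)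
  exact congrArg (fun z => _ ≫ _ ≫ z) ((F.map_comp _ _).symm.trans
    (congrArg F.map ((Category.assoc _ _ _).trans h1)))

/-- `hD` regroups the source and `hC` the target. Between them, `hn` moves the inner cochains past
the outer regrouping, and naturality of the `h`'s, the `g`'s and `x` carries the comparison of `X'`
with `X` through the three levels. -/
theorem functorSubstitution_sub_comp {i : ℕ} (x : FunctorCochain F i)
    (g : Fin i → Homog (FunctorCochain F))
    (h : Fin (blockSum i fun q => (g q).1) → Homog (FunctorCochain F)) :
    (functorSubstitution F).sub ((functorSubstitution F).comp x g) h =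
      (functorSubstitution F).sub x fun q => ⟨_, (functorSubstitution F).comp (g q).2
        fun t => h (blockIdx (fun q => (g q).1) q t)⟩ := by
  refine functorCochain_of_eq (blockSum_blockSum (fun q => (g q).1) fun q => (h q).1) _ _
    fun X X' hX => ?_
  have hD := blockIso_blockIso (fun q => (g q).1) (fun q => (h q).1) (fun q => F.obj (X q))
    (fun q => F.obj (X' q)) fun q => congrArg F.obj (hX q)
  have hC := comp_inv_inv_eq_eqToHom _ _ _ _
    (blockIso_blockIso (fun q => (g q).1) (fun q => (h q).1) X X' hX)
  rw [Category.assoc, ← Iso.eq_inv_comp] at hC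
  have hn := blockIso_naturality (fun q => (g q).1)
    (fun q => (h q).2.app fun t => X (blockIdx (fun q => (h q).1) q t))
  -- The identification of a factor of `X'`, indexed by two nested blocks, with the corresponding
  -- factor of `X`.
  let φ (p t s) := eqToHom ((hX _).trans (congrArg X
    (cast_blockIdx (fun q => (g q).1) (fun q => (h q).1) p t s)))
  have hφ (p t) := (h (blockIdx (fun q => (g q).1) p t)).2.naturality (φ p t)
  have hφ' (p) := (g p).2.naturality fun t => tensorMap _ (φ p t)
  have hx := x.naturality fun p => (blockIso (fun t => (h (blockIdx (fun q => (g q).1) p t)).1)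
    fun q => X' (blockIdx _ p q)).hom ≫ tensorMap _ fun t => tensorMap _ (φ p t)
  have hp (p : Fin i) :
      ((blockIso (fun t => (h (blockIdx (fun q => (g q).1) p t)).1)
          fun q => F.obj (X' (blockIdx _ p q))).hom ≫
        tensorMap _ fun t => tensorMap _ fun s => F.map (φ p t s)) ≫
        (tensorMap _ fun t => (h (blockIdx (fun q => (g q).1) p t)).2.app _) ≫
          (g p).2.app _ =
      (((functorSubstitution F).comp (g p).2
        fun t => h (blockIdx (fun q => (g q).1) p t)).app fun q => X' (blockIdx _ p q)) ≫
          F.map ((blockIso (fun t => (h (blockIdx (fun q => (g q).1) p t)).1)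
            fun q => X' (blockIdx _ p q)).hom ≫
              tensorMap _ fun t => tensorMap _ (φ p t)) := by
    change _ = (_ ≫ _ ≫ _ ≫ F.map (Iso.inv _)) ≫ _
    simp only [Category.assoc, ← F.map_comp, Iso.inv_hom_id_assoc]
    rw [← hφ', ← reassoc_of% tensorMap_comp, ← reassoc_of% tensorMap_comp]
    simp only [hφ]
  have hp' : (tensorMap i fun p => ((blockIso (fun t => (h (blockIdx (fun q => (g q).1) p t)).1)
          fun q => F.obj (X' (blockIdx _ p q))).hom ≫
        tensorMap _ fun t => tensorMap _ fun s => F.map (φ p t s))) ≫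
      (tensorMap i fun p => tensorMap _ fun t => (h (blockIdx (fun q => (g q).1) p t)).2.app _) ≫
      (tensorMap i fun p => (g p).2.app _) =
      (tensorMap i fun p => ((functorSubstitution F).comp (g p).2
        fun t => h (blockIdx (fun q => (g q).1) p t)).app fun q => X' (blockIdx _ p q)) ≫
      tensorMap i fun p => F.map ((blockIso (fun t => (h (blockIdx (fun q => (g q).1) p t)).1)
            fun q => X' (blockIdx _ p q)).hom ≫
              tensorMap _ fun t => tensorMap _ (φ p t)) := by
    rw [← tensorMap_comp, ← tensorMap_comp, ← tensorMap_comp]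
    exact congrArg (tensorMap i) (funext hp)
  simp only [φ, eqToHom_map] at hp' hx
  change (blockIso (fun q => (h q).1) fun q => F.obj (X q)).hom ≫
    tensorMap _ (fun q => (h q).2.app fun t => X (blockIdx (fun q => (h q).1) q t)) ≫
      ((blockIso (fun q => (g q).1) fun q => F.obj (tensorObj (h q).1
          fun t => X (blockIdx (fun q => (h q).1) q t))).hom ≫
        tensorMap i (fun q => (g q).2.app fun t => _) ≫ x.app (fun q => _) ≫
        F.map (blockIso (fun q => (g q).1) fun q => tensorObj (h q).1
          fun t => X (blockIdx (fun q => (h q).1) q t)).inv) ≫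
        F.map (blockIso (fun q => (h q).1) X).inv =
    _ ≫ ((blockIso _ fun q => F.obj (X' q)).hom ≫ tensorMap i (fun p => FunctorCochain.app
        ((functorSubstitution F).comp (g p).2
          fun t => h (blockIdx (fun q => (g q).1) p t)) _) ≫ x.app (fun p => _) ≫
      F.map (blockIso _ X').inv) ≫ _
  simp only [Category.assoc]
  rw [reassoc_of% hn, reassoc_of% hD, reassoc_of% hp', reassoc_of% hx, ← F.map_comp,
    ← F.map_comp, ← F.map_comp, hC]

theorem functorSubstitution_isOperad [MonoidalPreadditive D] :
    (functorSubstitution F).IsOperad where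
  comp_add x y g := by
    ext X
    change _ ≫ _ ≫ (x.app _ + y.app _) ≫ _ = _ ≫ _ ≫ x.app _ ≫ _ + _ ≫ _ ≫ y.app _ ≫ _
    simp only [Preadditive.comp_add, Preadditive.add_comp]
  sub_add_entry {i} x n y q a b := by
    refine Eq.trans (congrArg (DirectSum.of (FunctorCochain F) (blockSum i n)) ?_) (map_add _ _ _)
    ext X
    -- Taking components commutes with changing one entry, which reduces additivity to that of
    -- `tensorMap`.
    have h (c : FunctorCochain F (n q)) :
        (fun t => (Function.update y q c t).app fun s => X (blockIdx n t s)) =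
          Function.update (fun t => (y t).app fun s => X (blockIdx n t s)) q
            (c.app fun s => X (blockIdx n q s)) := by
      funext t
      by_cases ht : t = q
      · subst ht
        simp
      · simp [ht]
    have h1 : (blockIso n fun s => F.obj (X s)).hom ≫
          tensorMap i (fun t => (Function.update y q (a + b) t).app fun s => X (blockIdx n t s)) ≫
            x.app (fun t => tensorObj (n t) fun s => X (blockIdx n t s)) ≫
              F.map (blockIso n X).inv =
        (blockIso n fun s => F.obj (X s)).hom ≫
          tensorMap i (fun t => (Function.update y q a t).app fun s => X (blockIdx n t s)) ≫
            x.app (fun t => tensorObj (n t) fun s => X (blockIdx n t s)) ≫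
              F.map (blockIso n X).inv +
        (blockIso n fun s => F.obj (X s)).hom ≫
          tensorMap i (fun t => (Function.update y q b t).app fun s => X (blockIdx n t s)) ≫
            x.app (fun t => tensorObj (n t) fun s => X (blockIdx n t s)) ≫
              F.map (blockIso n X).inv := by
      rw [h, h, h, FunctorCochain.add_app, tensorMap_update_add, Preadditive.add_comp,
        Preadditive.comp_add]
    exact h1
  one_sub := functorSubstitution_one_sub F
  sub_one := functorSubstitution_sub_one F
  sub_comp := functorSubstitution_sub_comp F
  m_assoc := congrArg (DirectSum.of (FunctorCochain F) 3)
    (FunctorCochain.ext (funext (functorSubstitution_m_assoc F)))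

end FunctorOperad

/-! ### Homomorphisms -/

section Hom

universe w w'

variable {V : ℕ → Type w} [∀ n, AddCommGroup (V n)] {W : ℕ → Type w'} [∀ n, AddCommGroup (W n)]
  (φ : ∀ n, V n →+ W n)

/-- The image of a homogeneous element. -/
abbrev Homog.map (x : Homog V) : Homog W := ⟨x.1, φ x.1 x.2⟩

theorem Homog.map_tot (x : Homog V) : DirectSum.map φ x.tot = (x.map φ).tot :=
  DirectSum.map_of φ x.1 x.2

theorem map_units_smul {M N : Type*} [AddCommGroup M] [AddCommGroup N] (f : M →+ N) (u : ℤˣ)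
    (x : M) : f (u • x) = u • f x := by
  rw [Units.smul_def, Units.smul_def, map_zsmul]

theorem redSum_map (w : List (Homog V)) : redSum (w.map (Homog.map φ)) = redSum w :=
  congrArg List.sum List.map_map

theorem wordSign_map : ∀ w : List (Homog V), wordSign (w.map (Homog.map φ)) = wordSign w
  | [] => rfl
  | x :: w => by rw [List.map_cons, wordSign, wordSign, redSum_map, wordSign_map w]

namespace Substitution

theorem map_signInv (x : ⨁ n, V n) : DirectSum.map φ (signInv x) = signInv (DirectSum.map φ x) := by
  refine DFunLike.congr_fun (f := (DirectSum.map φ).comp signInv)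
    (g := signInv.comp (DirectSum.map φ)) (DirectSum.addHom_ext fun k a => ?_) x
  have h := signInv_tot (⟨k, a⟩ : Homog V)
  have h' := signInv_tot (Homog.map φ ⟨k, a⟩)
  rw [← Homog.map_tot] at h'
  change DirectSum.map φ (signInv (Homog.tot ⟨k, a⟩)) =
    signInv (DirectSum.map φ (Homog.tot ⟨k, a⟩))
  rw [h, h', map_units_smul]

/-- Additive maps that commute with the substitution and preserve the identity and the
multiplication. -/
structure IsHom (O : Substitution V) (O' : Substitution W) (φ : ∀ n, V n →+ W n) : Prop where
  map_one : φ 1 O.one = O'.one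
  map_m : φ 2 O.m = O'.m
  map_comp : ∀ {i : ℕ} (x : V i) (g : Fin i → Homog V),
    φ _ (O.comp x g) = O'.comp (φ i x) fun q => (g q).map φ

variable {φ} {O : Substitution V} {O' : Substitution W}

/-- The maps preserve degrees, so signs are unchanged; missing letters default to the identity,
which is preserved. -/
theorem IsHom.map_signedSub (hφ : IsHom O O' φ) {i : ℕ} (x : V i) (w : List (Homog V)) :
    DirectSum.map φ (O.signedSub x w) = O'.signedSub (φ i x) (w.map (Homog.map φ)) := by
  have h : O'.entries (w.map (Homog.map φ)) i = fun q => (O.entries w i q).map φ := by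
    funext q
    have h1 : O'.unit = O.unit.map φ := Sigma.ext rfl (heq_of_eq hφ.map_one.symm)
    rw [entries, h1, List.getD_map]
  rw [signedSub, signedSub, List.length_map, wordSign_map, h]
  split_ifs
  · rw [map_units_smul]
    refine congrArg _ ((DirectSum.map_of φ _ _).trans ?_)
    rw [hφ.map_comp]
    rfl
  · rw [map_zero]

theorem IsHom.map_brace (hφ : IsHom O O' φ) (hO : O.IsOperad) (hO' : O'.IsOperad)
    (x : ⨁ n, V n) (L : List (⨁ n, V n)) :
    DirectSum.map φ (O.operations.brace x L) =
      O'.operations.brace (DirectSum.map φ x) (L.map (DirectSum.map φ)) := by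
  let f : (⨁ n, V n) →+ ⨁ n, W n := (DirectSum.map φ).comp
    (AddMonoidHom.mk' (fun x => O.operations.brace x L) fun x y => hO.brace_add_left x y L)
  let g : (⨁ n, V n) →+ ⨁ n, W n := (AddMonoidHom.mk' (fun x => O'.operations.brace x
    (L.map (DirectSum.map φ))) fun x y => hO'.brace_add_left x y _).comp (DirectSum.map φ)
  refine DFunLike.congr_fun (f := f) (g := g) (DirectSum.addHom_ext fun k a => ?_) x
  refine MultiAdd.eq_of_tot (f := fun L => DirectSum.map φ (O.operations.brace (.of V k a) L))
    (g := fun L => O'.operations.brace (DirectSum.map φ (.of V k a)) (L.map (DirectSum.map φ)))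
    (fun L y z L' => ?_) (fun L y z L' => ?_) (fun ys => ?_) L
  · exact (congrArg _ (hO.multiAdd_brace _ _ _ _ _)).trans (map_add _ _ _)
  · simp only [List.map_append, List.map_cons, map_add]
    exact hO'.multiAdd_brace _ _ _ _ _
  · have h : (ys.map Homog.tot).map (DirectSum.map φ) = (ys.map (Homog.map φ)).map Homog.tot := by
      rw [List.map_map, List.map_map]
      exact List.map_congr_left fun y _ => Homog.map_tot φ y
    have h1 := hO.brace_tot ⟨k, a⟩ ys
    have h2 := hO'.brace_tot (Homog.map φ ⟨k, a⟩) (ys.map (Homog.map φ))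
    have h3 : O'.unit = O.unit.map φ := Sigma.ext rfl (heq_of_eq hφ.map_one.symm)
    rw [← Homog.map_tot, h3, shSum_map_list] at h2
    simp only [h]
    refine (congrArg _ h1).trans (Eq.trans ?_ h2.symm)
    rw [← shSum_map]
    simp only [hφ.map_signedSub]

theorem IsHom.map_mult_tot (hφ : IsHom O O' φ) :
    DirectSum.map φ O.mult.tot = O'.mult.tot :=
  (Homog.map_tot φ _).trans (congrArg (DirectSum.of W 2) hφ.map_m)

/-- Differential and product are expressed by braces with `m`, so compatibility with braces and `m`
suffices. -/
theorem IsHom.isSHGerstenhaberHom (hφ : IsHom O O' φ) (hO : O.IsOperad) (hO' : O'.IsOperad) :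
    IsSHGerstenhaberHom O.operations O'.operations φ where
  map_d x := by
    rw [hO.d_eq, hO'.d_eq]
    refine DFunLike.congr_fun (f := (DirectSum.map φ).comp (O.dAux hO))
      (g := (O'.dAux hO').comp (DirectSum.map φ)) (DirectSum.addHom_ext fun k a => ?_) x
    have h1 := hO.d_tot ⟨k, a⟩
    have h2 := hO'.d_tot (Homog.map φ ⟨k, a⟩)
    rw [hO.d_eq] at h1
    rw [hO'.d_eq, ← Homog.map_tot] at h2
    change DirectSum.map φ (O.dAux hO (Homog.tot ⟨k, a⟩)) =
      O'.dAux hO' (DirectSum.map φ (Homog.tot ⟨k, a⟩))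
    rw [h1, h2, map_sub, map_units_smul, hφ.map_brace hO hO', hφ.map_brace hO hO',
      hφ.map_mult_tot, List.map_singleton, List.map_singleton, hφ.map_mult_tot]
    congr 2
  map_mul x y := by
    rw [hO.mul_eq, hO'.mul_eq, hφ.map_brace hO hO', hφ.map_mult_tot, ← map_signInv]
    rfl
  map_brace := hφ.map_brace hO hO'

end Substitution

end Hom

/-! ### Evaluation at the monoidal unit -/

section Evaluation

universe v₁ u₁ v₂ u₂

variable {C : Type u₁} [Category.{v₁} C] [MonoidalCategory C]
  {D : Type u₂} [Category.{v₂} D] [MonoidalCategory D] (F : C ⥤ D) [F.LaxMonoidal]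

/-- The monoid `F 𝟙`. -/
abbrev unitMonObj : MonObj (F.obj (𝟙_ C)) where
  one := Functor.LaxMonoidal.ε F
  mul := Functor.LaxMonoidal.μ F (𝟙_ C) (𝟙_ C) ≫ F.map (λ_ (𝟙_ C)).hom
  one_mul := by simp
  mul_one := by simp [unitors_equal]
  -- Associativity is that of the image of the trivial monoid `𝟙`. The unit is given separately so
  -- that it is `ε` on the nose.
  mul_assoc := (F.monObjObj (𝟙_ C)).mul_assoc

variable [Preadditive D]

theorem isHom_evalUnit :
    (functorSubstitution F).IsHom (monoidSubstitution _ (unitMonObj F)) (evalUnit F) where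
  map_one := by
    have h : ((λ_ (F.obj (𝟙_ C))).hom ≫ F.map (λ_ (𝟙_ C)).inv) ≫
        F.map (𝟙 (𝟙_ C) ▷ 𝟙_ C ≫ (λ_ (𝟙_ C)).hom) = (λ_ (F.obj (𝟙_ C))).hom := by
      rw [id_whiskerRight, Category.id_comp, Category.assoc, ← F.map_comp, Iso.inv_hom_id,
        F.map_id, Category.comp_id]
    exact h
  map_m := by
    have h : ((λ_ (F.obj (𝟙_ C))).hom ▷ F.obj (𝟙_ C) ≫ Functor.LaxMonoidal.μ F (𝟙_ C) (𝟙_ C) ≫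
        F.map ((λ_ (𝟙_ C)).inv ▷ 𝟙_ C)) ≫
          F.map ((𝟙 (𝟙_ C) ▷ 𝟙_ C ≫ (λ_ (𝟙_ C)).hom) ▷ 𝟙_ C ≫ (λ_ (𝟙_ C)).hom) =
        (λ_ (F.obj (𝟙_ C))).hom ▷ F.obj (𝟙_ C) ≫
          Functor.LaxMonoidal.μ F (𝟙_ C) (𝟙_ C) ≫ F.map (λ_ (𝟙_ C)).hom := by
      rw [id_whiskerRight, Category.id_comp, Category.assoc, Category.assoc, ← F.map_comp,
        inv_hom_whiskerRight_assoc]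
    exact h
  map_comp {i} x g := by
    -- Naturality of `x` along `𝟙 ⊗ ⋯ ⊗ 𝟙 ≅ 𝟙` in every block allows each inserted cochain to be
    -- evaluated first; `h2` says that collapsing the blocks and then their product collapses
    -- everything.
    have h1 := x.naturality (Y := fun _ => 𝟙_ C) fun q => (unitIso C (g q).1).hom
    have h2 := blockIso_unitIso (C := C) fun q => (g q).1
    have h3 : ((blockIso (fun q => (g q).1) fun _ => F.obj (𝟙_ C)).hom ≫
        tensorMap i (fun q => (g q).2.app fun _ => 𝟙_ C) ≫
          x.app (fun q => tensorObj (g q).1 fun _ => 𝟙_ C) ≫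
            F.map (blockIso (fun q => (g q).1) fun _ => 𝟙_ C).inv) ≫
          F.map (unitIso C (blockSum i fun q => (g q).1)).hom =
        (blockIso (fun q => (g q).1) fun _ => F.obj (𝟙_ C)).hom ≫
          tensorMap i (fun q => (g q).2.app (fun _ => 𝟙_ C) ≫ F.map (unitIso C (g q).1).hom) ≫
            x.app (fun _ => 𝟙_ C) ≫ F.map (unitIso C i).hom := by
      rw [tensorMap_comp, ← h2]
      simp only [Category.assoc, ← F.map_comp, Iso.inv_hom_id_assoc]
      rw [F.map_comp, reassoc_of% h1]
    exact h3

end Evaluation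

end SHGerstenhaber

end

theorem mainTheorem6 {C : Type*} [Category C] [MonoidalCategory C]
    {D : Type*} [Category D] [MonoidalCategory D] [Preadditive D] [MonoidalPreadditive D]
    (F : C ⥤ D) [F.LaxMonoidal] :
    ∃ M : MonObj (F.obj (𝟙_ C)),
      M.one = Functor.LaxMonoidal.ε F ∧
      M.mul = Functor.LaxMonoidal.μ F (𝟙_ C) (𝟙_ C) ≫ F.map (λ_ (𝟙_ C)).hom ∧
      SHGerstenhaber.IsSHGerstenhaberAlgebra (SHGerstenhaber.functorOperations F) ∧
      SHGerstenhaber.IsSHGerstenhaberAlgebra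
        (SHGerstenhaber.monoidOperations (F.obj (𝟙_ C)) M) ∧
      SHGerstenhaber.IsSHGerstenhaberHom (SHGerstenhaber.functorOperations F)
        (SHGerstenhaber.monoidOperations (F.obj (𝟙_ C)) M) (SHGerstenhaber.evalUnit F) :=
  have hF := SHGerstenhaber.functorSubstitution_isOperad F
  have hM := SHGerstenhaber.monoidSubstitution_isOperad _ (SHGerstenhaber.unitMonObj F)
  ⟨SHGerstenhaber.unitMonObj F, rfl, rfl, hF.isSHGerstenhaberAlgebra, hM.isSHGerstenhaberAlgebra,
    (SHGerstenhaber.isHom_evalUnit F).isSHGerstenhaberHom hF hM⟩
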